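/- Let $M$ be a compact oriented Riemannian manifold (without boundary) of dimension $2n\ge 2$. Let $\mathcal E$ be a self-adjoint Clifford module over $M$: a Hermitian vector bundle on which the cotangent vectors $\xi\in T_x^*M$ act by skew-adjoint operators $c(\xi)$ on $\mathcal E_x$, linear in $\xi$ and smooth in $x$, with $c(\xi)^2=-|\xi|^2$. Let $\nabla^{\mathcal E}$ be a Hermitian Clifford connection on $\mathcal E$, i.e. a Hermitian connection with $[\nabla^{\mathcal E}_X,c(a)]=c(\nabla_Xa)$ for all vector fields $X$ and one-forms $a$, where $\nabla$ is the Levi-Civita connection. Let $\mathcal E=\mathcal E^+\oplus\mathcal E^-$ be the decomposition into the $\pm1$-eigenbundles of the chirality operator $\Gamma=i^n c(e^1)\cdots c(e^{2n})$, where $e^1,\dots,e^{2n}$ is an oriented orthonormal basis of $T_x^*M$. Let $\mathcal L$ be a Hermitian line bundle over $M$ with a Hermitian connection $\nabla^{\mathcal L}$ and curvature $F^{\mathcal L}=(\nabla^{\mathcal L})^2$, an imaginary valued two-form. For an integer $k\ge0$ let $\nabla_k$ be the product connection on $\mathcal E\otimes\mathcal L^k$, let $D_k=\sum_j (c(e^j)\otimes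 1)\,(\nabla_k)_{e_j}$ be the Dirac operator on smooth sections of $\mathcal E\otimes\mathcal L^k$, where $e_1,\dots,e_{2n}$ is a local orthonormal frame of $TM$ with dual frame $e^1,\dots,e^{2n}$, and let $\Delta_k=\nabla_k^*\nabla_k$ be the metric Laplacian, where $\nabla_k^*$ is the formal adjoint of $\nabla_k$ with respect to the $L_2$-scalar products. Let $\langle\cdot,\cdot\rangle$ be the $L_2$-scalar product of sections defined by the Riemannian volume and the Hermitian metrics, with norm $\|\cdot\|$. For $x\in M$ let $\tilde J_x:T_xM\to T_xM$ be the skew-symmetric map with $iF^{\mathcal L}(v,w)=g(v,\tilde J_xw)$, let $i\mu_1(x),\dots,i\mu_l(x)$, listed with multiplicity, be its eigenvalues with $\mu_j(x)>0$, and set $\tau(x)=\mu_1(x)+\dots+\mu_l(x)$ and $m(x)=\min_j\mu_j(x)$. Suppose that $F^{\mathcal L}$ is non-degenerate at every point of $M$, so that $(iF^{\mathcal L})^n$ is a volume form and defines an orientation of $M$. (a) If this orientation coincides with the given orientation of $M$, then there is a constant $C$, independent of $k$ and $s$, such that for every integer $k\ge0$ and every smooth section $s$ of $\mathcal E^-\otimes\mathcal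 L^k$ $$\big\langle (D_k^2-\Delta_k)s,s\big\rangle\ \ge\ -k\,\big\langle(\tau-2m)s,s\big\rangle-C\|s\|^2 .$$ (b) If this orientation is opposite to the given orientation of $M$, then there is a constant $C$, independent of $k$ and $s$, such that the same estimate holds for every integer $k\ge0$ and every smooth section $s$ of $\mathcal E^+\otimes\mathcal L^k$. -/

import Mathlib

open Bundle Manifold MeasureTheory Topology
open scoped ContDiff TensorProduct

noncomputable section

namespace DiracTwist

/-! ### The base manifold -/

section Base

variable {n : ℕ} {M : Type*} [TopologicalSpace M]
  [ChartedSpace (EuclideanSpace ℝ (Fin (2 * n))) M]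
  [IsManifold (𝓡 (2 * n)) ∞ M]

instance instFiniteDimensionalTangent (x : M) :
    FiniteDimensional ℝ (TangentSpace (𝓡 (2 * n)) x) :=
  inferInstanceAs (FiniteDimensional ℝ (EuclideanSpace ℝ (Fin (2 * n))))

variable (n M) in
/-- An orientation of a `2n`-dimensional manifold: an orientation of every tangent space which is
locally constant in the local trivializations of the tangent bundle. -/
structure ManifoldOrientation where
  /-- The orientation of the tangent space at a point. -/
  at' : ∀ x : M, Orientation ℝ (TangentSpace (𝓡 (2 * n)) x) (Fin (2 * n))
  locallyConstant : ∀ x₀ : M, ∃ U ∈ 𝓝 x₀,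
    ∃ o₀ : Orientation ℝ (EuclideanSpace ℝ (Fin (2 * n))) (Fin (2 * n)),
    ∀ y ∈ U, ∀ hy : y ∈ (trivializationAt (EuclideanSpace ℝ (Fin (2 * n)))
        (fun x : M => TangentSpace (𝓡 (2 * n)) x) x₀).baseSet,
      Orientation.map (Fin (2 * n))
        ((trivializationAt (EuclideanSpace ℝ (Fin (2 * n)))
          (fun x : M => TangentSpace (𝓡 (2 * n)) x) x₀).linearEquivAt ℝ y hy) (at' y) = o₀

variable [RiemannianBundle (fun x : M => TangentSpace (𝓡 (2 * n)) x)]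

/-- The covector `⟨v, ·⟩` dual to the tangent vector `v`. -/
def flat {x : M} (v : TangentSpace (𝓡 (2 * n)) x) : TangentSpace (𝓡 (2 * n)) x →L[ℝ] ℝ :=
  innerSL ℝ v

variable (n) in
/-- The Riemannian density `√(det g_{ij})` in the chart at `x₀`, as a function on the model
space. -/
def chartDensity (x₀ : M) (y : EuclideanSpace ℝ (Fin (2 * n))) : ℝ :=
  √ (Matrix.gram ℝ (fun i : Fin (2 * n) =>
      mfderiv 𝓘(ℝ, EuclideanSpace ℝ (Fin (2 * n))) (𝓡 (2 * n)) (extChartAt (𝓡 (2 * n)) x₀).symm y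
        (EuclideanSpace.basisFun (Fin (2 * n)) ℝ i))).det

variable [MeasurableSpace M] [BorelSpace M]

variable (n) in
/-- The Riemannian volume `√(det g_{ij}) dx` of the domain of the chart at `x₀`. -/
def chartVolume (x₀ : M) : Measure M :=
  Measure.map (extChartAt (𝓡 (2 * n)) x₀).symm
    ((volume.restrict (extChartAt (𝓡 (2 * n)) x₀).target).withDensity
      fun y => ENNReal.ofReal (chartDensity n x₀ y))

variable [CompactSpace M] [T2Space M]

variable (n M) in
/-- A smooth partition of unity subordinate to the chart domains. -/
def chartPartition : SmoothPartitionOfUnity M (𝓡 (2 * n)) M Set.univ :=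
  (SmoothPartitionOfUnity.exists_isSubordinate_chartAt_source (𝓡 (2 * n)) M).choose

variable (n M) in
/-- The Riemannian volume measure, glued from the volumes of the charts by a partition of unity
(it does not depend on the partition of unity). -/
def riemannianVolume : Measure M :=
  Measure.sum fun x₀ : M => (chartVolume n x₀).withDensity
    fun x => ENNReal.ofReal (chartPartition n M x₀ x)

end Base

/-! ### Levi-Civita connection, Hermitian bundles, Clifford modules -/

section Bundles

variable {n : ℕ} {M : Type*} [TopologicalSpace M]
  [ChartedSpace (EuclideanSpace ℝ (Fin (2 * n))) M]
  [IsManifold (𝓡 (2 * n)) ∞ M]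
  [RiemannianBundle (fun x : M => TangentSpace (𝓡 (2 * n)) x)]

/-- The Levi-Civita connection: compatible with the metric,
`d⟨X, Y⟩ = ⟨∇X, Y⟩ + ⟨X, ∇Y⟩`, and torsion-free. -/
def IsLeviCivita (nablaM : CovariantDerivative (𝓡 (2 * n)) (EuclideanSpace ℝ (Fin (2 * n)))
    (fun x : M => TangentSpace (𝓡 (2 * n)) x)) : Prop :=
  (∀ (X Y : ∀ x : M, TangentSpace (𝓡 (2 * n)) x) (x : M),
    MDifferentiableAt (𝓡 (2 * n)) ((𝓡 (2 * n)).prod 𝓘(ℝ, EuclideanSpace ℝ (Fin (2 * n))))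
      (fun y => TotalSpace.mk' (EuclideanSpace ℝ (Fin (2 * n))) y (X y)) x →
    MDifferentiableAt (𝓡 (2 * n)) ((𝓡 (2 * n)).prod 𝓘(ℝ, EuclideanSpace ℝ (Fin (2 * n))))
      (fun y => TotalSpace.mk' (EuclideanSpace ℝ (Fin (2 * n))) y (Y y)) x →
    ∀ v : TangentSpace (𝓡 (2 * n)) x,
      mvfderiv (𝓡 (2 * n)) (fun y => inner ℝ (X y) (Y y)) x v =
        inner ℝ (nablaM X x v) (Y x) + inner ℝ (X x) (nablaM Y x v)) ∧
  nablaM.torsion = 0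

variable (F : Type*) [NormedAddCommGroup F] [NormedSpace ℂ F]
  (E : M → Type*) [∀ x, NormedAddCommGroup (E x)] [∀ x, InnerProductSpace ℂ (E x)]
  [TopologicalSpace (TotalSpace F E)] [FiberBundle F E]

variable (n) in
/-- The Hermitian scalar products of the fibres depend smoothly on the base point. -/
def IsSmoothHermitian : Prop :=
  ∀ s t : ∀ x : M, E x,
    ContMDiff (𝓡 (2 * n)) ((𝓡 (2 * n)).prod 𝓘(ℝ, F)) ∞ (fun x => TotalSpace.mk' F x (s x)) →
    ContMDiff (𝓡 (2 * n)) ((𝓡 (2 * n)).prod 𝓘(ℝ, F)) ∞ (fun x => TotalSpace.mk' F x (t x)) →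
    ContMDiff (𝓡 (2 * n)) 𝓘(ℝ, ℂ) ∞ (fun x => inner ℂ (s x) (t x))

variable {F E} in
/-- A Hermitian connection: `d⟨s, t⟩ = ⟨∇s, t⟩ + ⟨s, ∇t⟩`. -/
def IsHermitianConnection (nabla : CovariantDerivative (𝓡 (2 * n)) F E) : Prop :=
  ∀ (s t : ∀ x : M, E x) (x : M),
    MDifferentiableAt (𝓡 (2 * n)) ((𝓡 (2 * n)).prod 𝓘(ℝ, F)) (fun y => TotalSpace.mk' F y (s y)) x →
    MDifferentiableAt (𝓡 (2 * n)) ((𝓡 (2 * n)).prod 𝓘(ℝ, F)) (fun y => TotalSpace.mk' F y (t y)) x →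
    ∀ v : TangentSpace (𝓡 (2 * n)) x,
      mvfderiv (𝓡 (2 * n)) (fun y => inner ℂ (s y) (t y)) x v =
        inner ℂ (nabla s x v) (t x) + inner ℂ (s x) (nabla t x v)

variable (n) in
/-- The structure of a self-adjoint Clifford module on a Hermitian vector bundle, given by the
action of the generators of the Clifford algebras: skew-adjoint operators `c ξ`, for `ξ` in the
cotangent spaces, with `(c ξ)² = -|ξ|²`, depending linearly on `ξ` and smoothly on the base
point. -/
structure CliffordAction where
  /-- Clifford multiplication by a covector. -/
  c : ∀ x : M, (TangentSpace (𝓡 (2 * n)) x →L[ℝ] ℝ) →ₗ[ℝ] (E x →ₗ[ℂ] E x)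
  c_sq : ∀ (x : M) (ξ : TangentSpace (𝓡 (2 * n)) x →L[ℝ] ℝ) (e : E x),
    c x ξ (c x ξ e) = -((‖ξ‖ ^ 2 : ℝ) : ℂ) • e
  skew : ∀ (x : M) (ξ : TangentSpace (𝓡 (2 * n)) x →L[ℝ] ℝ) (e e' : E x),
    inner ℂ (c x ξ e) e' = -inner ℂ e (c x ξ e')
  smooth : ∀ (X : ∀ x : M, TangentSpace (𝓡 (2 * n)) x) (s : ∀ x : M, E x),
    ContMDiff (𝓡 (2 * n)) ((𝓡 (2 * n)).prod 𝓘(ℝ, EuclideanSpace ℝ (Fin (2 * n)))) ∞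
      (fun x => TotalSpace.mk' (EuclideanSpace ℝ (Fin (2 * n))) x (X x)) →
    ContMDiff (𝓡 (2 * n)) ((𝓡 (2 * n)).prod 𝓘(ℝ, F)) ∞ (fun x => TotalSpace.mk' F x (s x)) →
    ContMDiff (𝓡 (2 * n)) ((𝓡 (2 * n)).prod 𝓘(ℝ, F)) ∞
      (fun x => TotalSpace.mk' F x (c x (flat (X x)) (s x)))

variable {F E}

/-- A Clifford connection: `[∇_v, c(a)] = c(∇_v a)`, where on the right `∇` is the Levi-Civita
connection. It is enough to ask this for the one-forms `a = ⟨Y, ·⟩`, which generate the Clifford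
algebras; as the metric is parallel, `∇_v a = ⟨∇_v Y, ·⟩`. -/
def IsCliffordConnection
    (nablaM : CovariantDerivative (𝓡 (2 * n)) (EuclideanSpace ℝ (Fin (2 * n)))
      (fun x : M => TangentSpace (𝓡 (2 * n)) x))
    (A : CliffordAction n F E) (nabla : CovariantDerivative (𝓡 (2 * n)) F E) : Prop :=
  ∀ (Y : ∀ x : M, TangentSpace (𝓡 (2 * n)) x) (s : ∀ x : M, E x) (x : M),
    MDifferentiableAt (𝓡 (2 * n)) ((𝓡 (2 * n)).prod 𝓘(ℝ, EuclideanSpace ℝ (Fin (2 * n))))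
      (fun y => TotalSpace.mk' (EuclideanSpace ℝ (Fin (2 * n))) y (Y y)) x →
    MDifferentiableAt (𝓡 (2 * n)) ((𝓡 (2 * n)).prod 𝓘(ℝ, F)) (fun y => TotalSpace.mk' F y (s y)) x →
    ∀ v : TangentSpace (𝓡 (2 * n)) x,
      nabla (fun y => A.c y (flat (Y y)) (s y)) x v =
        A.c x (flat (nablaM Y x v)) (s x) + A.c x (flat (Y x)) (nabla s x v)

/-- The chirality operator `iⁿ c(e¹) ⋯ c(e²ⁿ)` computed in an orthonormal basis. It is the same
for all orthonormal bases of one orientation. -/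
def chirality (A : CliffordAction n F E) (x : M)
    (b : OrthonormalBasis (Fin (2 * n)) ℝ (TangentSpace (𝓡 (2 * n)) x)) : Module.End ℂ (E x) :=
  Complex.I ^ n • (List.ofFn fun i => (A.c x (flat (b i)) : Module.End ℂ (E x))).prod

end Bundles

/-! ### A line bundle with connection and its curvature -/

section Line

variable {n : ℕ} {M : Type*} [TopologicalSpace M]
  [ChartedSpace (EuclideanSpace ℝ (Fin (2 * n))) M]
  [IsManifold (𝓡 (2 * n)) ∞ M]
  {L : M → Type*} [∀ x, NormedAddCommGroup (L x)] [∀ x, InnerProductSpace ℂ (L x)]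
  [TopologicalSpace (TotalSpace ℂ L)] [FiberBundle ℂ L] [VectorBundle ℂ ℂ L]

variable (L) in
/-- The local frame of `L` around `x₀` given by the preferred trivialization (zero outside its
base set). -/
def lineFrame (x₀ y : M) : L y := (trivializationAt ℂ L x₀).symmₗ ℂ y 1

variable (L) in
/-- The coordinate with respect to `lineFrame L x₀` (zero outside the base set). -/
def lineCoord (x₀ y : M) : L y →ₗ[ℂ] ℂ := (trivializationAt ℂ L x₀).linearMapAt ℂ y

/-- The curvature of a connection on a line bundle,
`F(v, w) ℓ = ∇_v ∇_w ℓ - ∇_w ∇_v ℓ - ∇_[v,w] ℓ`, where `v`, `w` are extended to vector fields and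
`ℓ` is a local frame around `x`. The result does not depend on these choices. -/
def curvature (nablaL : CovariantDerivative (𝓡 (2 * n)) ℂ L) (x : M)
    (v w : TangentSpace (𝓡 (2 * n)) x) : ℂ :=
  let V : ∀ y : M, TangentSpace (𝓡 (2 * n)) y :=
    FiberBundle.extend (EuclideanSpace ℝ (Fin (2 * n))) v
  let W : ∀ y : M, TangentSpace (𝓡 (2 * n)) y :=
    FiberBundle.extend (EuclideanSpace ℝ (Fin (2 * n))) w
  lineCoord L x x
    (nablaL (fun y => nablaL (lineFrame L x) y (W y)) x v
      - nablaL (fun y => nablaL (lineFrame L x) y (V y)) x w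
      - nablaL (lineFrame L x) x (VectorField.mlieBracket (𝓡 (2 * n)) V W x))

/-- The curvature is non-degenerate at every point. -/
def CurvatureNondegenerate (nablaL : CovariantDerivative (𝓡 (2 * n)) ℂ L) : Prop :=
  ∀ (x : M) (v : TangentSpace (𝓡 (2 * n)) x), (∀ w, curvature nablaL x v w = 0) → v = 0

/-- The real two-form `i F` (the curvature of a Hermitian connection is imaginary). -/
def iCurvature (nablaL : CovariantDerivative (𝓡 (2 * n)) ℂ L) (x : M)
    (v w : TangentSpace (𝓡 (2 * n)) x) : ℝ :=
  (Complex.I * curvature nablaL x v w).re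

/-- The value on `b₀, …, b_{2n-1}` of the top exterior power `(iF)ⁿ = iF ∧ ⋯ ∧ iF`, multiplied by
the positive constant `2ⁿ`. -/
def iCurvatureTopPower (nablaL : CovariantDerivative (𝓡 (2 * n)) ℂ L) (x : M)
    (b : Fin (2 * n) → TangentSpace (𝓡 (2 * n)) x) : ℝ :=
  ∑ σ : Equiv.Perm (Fin (2 * n)), ((Equiv.Perm.sign σ : ℤ) : ℝ) *
    ∏ j : Fin n, iCurvature nablaL x
      (b (σ ⟨2 * j, by omega⟩)) (b (σ ⟨2 * j + 1, by omega⟩))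

/-- The orientation defined by `i F` coincides with the given one: `(iF)ⁿ` is a positive volume
form. -/
def OrientationAgrees (nablaL : CovariantDerivative (𝓡 (2 * n)) ℂ L)
    (o : ManifoldOrientation n M) : Prop :=
  ∀ (x : M) (b : Module.Basis (Fin (2 * n)) ℝ (TangentSpace (𝓡 (2 * n)) x)),
    b.orientation = o.at' x → 0 < iCurvatureTopPower nablaL x b

/-- The orientation defined by `i F` is opposite to the given one: `(iF)ⁿ` is a negative volume
form. -/
def OrientationOpposite (nablaL : CovariantDerivative (𝓡 (2 * n)) ℂ L)
    (o : ManifoldOrientation n M) : Prop :=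
  ∀ (x : M) (b : Module.Basis (Fin (2 * n)) ℝ (TangentSpace (𝓡 (2 * n)) x)),
    b.orientation = o.at' x → iCurvatureTopPower nablaL x b < 0

variable [RiemannianBundle (fun x : M => TangentSpace (𝓡 (2 * n)) x)]

/-- The skew-symmetric endomorphism `J` of the tangent space with `i F(v, w) = ⟨v, J w⟩`: its
matrix in an orthonormal basis `e` is `i F(e_i, e_j)`. -/
def skewEndo (nablaL : CovariantDerivative (𝓡 (2 * n)) ℂ L) (x : M) :
    TangentSpace (𝓡 (2 * n)) x →ₗ[ℝ] TangentSpace (𝓡 (2 * n)) x :=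
  let e := stdOrthonormalBasis ℝ (TangentSpace (𝓡 (2 * n)) x)
  Matrix.toLin e.toBasis e.toBasis (Matrix.of fun i j => iCurvature nablaL x (e i) (e j))

/-- The complex eigenvalues of `skewEndo`, with multiplicity. -/
def skewEigenvalues (nablaL : CovariantDerivative (𝓡 (2 * n)) ℂ L) (x : M) : Multiset ℂ :=
  ((skewEndo nablaL x).charpoly.map (algebraMap ℝ ℂ)).roots

/-- `τ(x)`: the sum, with multiplicity, of the `μ > 0` such that `i μ` is an eigenvalue. -/
def tau (nablaL : CovariantDerivative (𝓡 (2 * n)) ℂ L) (x : M) : ℝ :=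
  (((skewEigenvalues nablaL x).map Complex.im).filter (fun μ => 0 < μ)).sum

/-- `m(x)`: the smallest `μ > 0` such that `i μ` is an eigenvalue. -/
def minEig (nablaL : CovariantDerivative (𝓡 (2 * n)) ℂ L) (x : M) : ℝ :=
  sInf {μ : ℝ | 0 < μ ∧ (μ : ℂ) * Complex.I ∈ skewEigenvalues nablaL x}

end Line

/-! ### The twisted bundles `E ⊗ L^k` -/

section Twist

variable {n : ℕ} {M : Type*} [TopologicalSpace M]
  [ChartedSpace (EuclideanSpace ℝ (Fin (2 * n))) M]
  [IsManifold (𝓡 (2 * n)) ∞ M]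
  {F : Type*} [NormedAddCommGroup F] [NormedSpace ℂ F]
  {E : M → Type*} [∀ x, NormedAddCommGroup (E x)] [∀ x, InnerProductSpace ℂ (E x)]
  [TopologicalSpace (TotalSpace F E)] [FiberBundle F E]
  {L : M → Type*} [∀ x, NormedAddCommGroup (L x)] [∀ x, InnerProductSpace ℂ (L x)]
  [TopologicalSpace (TotalSpace ℂ L)] [FiberBundle ℂ L] [VectorBundle ℂ ℂ L]

variable (E L) in
/-- The fibre of `E ⊗ L^k`. -/
abbrev Twist (k : ℕ) (x : M) : Type _ := E x ⊗[ℂ] (⨂[ℂ]^k (L x))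

variable (L) in
/-- The linear form on `L_y^{⊗k}` taking `ℓ₁ ⊗ ⋯ ⊗ ℓ_k` to the product of the coordinates of the
`ℓ_i` in the frame `lineFrame L x₀`. -/
def powCoord (k : ℕ) (x₀ y : M) : (⨂[ℂ]^k (L y)) →ₗ[ℂ] ℂ :=
  PiTensorProduct.lift
    ((MultilinearMap.mkPiAlgebra ℂ (Fin k) ℂ).compLinearMap fun _ => lineCoord L x₀ y)

variable (L) in
/-- The frame `ℓ^{⊗k}` of `L^k`, where `ℓ` is `lineFrame L x₀`. -/
def powFrame (k : ℕ) (x₀ y : M) : ⨂[ℂ]^k (L y) :=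
  PiTensorProduct.tprod ℂ fun _ : Fin k => lineFrame L x₀ y

/-- The coefficient `e ∈ E_y` of `a = e ⊗ ℓ^{⊗k}`, where `ℓ` is `lineFrame L x₀`. -/
def twistCoord (k : ℕ) (x₀ y : M) : Twist E L k y →ₗ[ℂ] E y :=
  (TensorProduct.rid ℂ (E y)).toLinearMap ∘ₗ LinearMap.lTensor (E y) (powCoord L k x₀ y)

variable (n F) in
/-- Smooth sections of `E ⊗ L^k`: locally `s = e ⊗ ℓ^{⊗k}` with `e` a smooth section of `E` and
`ℓ` the local frame of `L`. -/
def IsSmoothTwist (k : ℕ) (s : ∀ x : M, Twist E L k x) : Prop :=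
  ∀ x₀ : M, ContMDiffOn (𝓡 (2 * n)) ((𝓡 (2 * n)).prod 𝓘(ℝ, F)) ∞
    (fun y => TotalSpace.mk' F y (twistCoord k x₀ y (s y))) (trivializationAt ℂ L x₀).baseSet

/-- The Hermitian scalar product of the fibre of `E ⊗ L^k`, as
`⟨e ⊗ ℓ^{⊗k}, e' ⊗ ℓ^{⊗k}⟩ = ⟨e, e'⟩ |ℓ|^{2k}`. -/
def twistInner (k : ℕ) (x : M) (a b : Twist E L k x) : ℂ :=
  inner ℂ (twistCoord k x x a) (twistCoord k x x b) * ((‖lineFrame L x x‖ ^ (2 * k) : ℝ) : ℂ)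

theorem lineCoord_smul_lineFrame (x : M) (l : L x) :
    lineCoord L x x l • lineFrame L x x = l := by
  have hx : x ∈ (trivializationAt ℂ L x).baseSet := FiberBundle.mem_baseSet_trivializationAt' x
  rw [lineCoord, lineFrame, ← map_smul, smul_eq_mul, mul_one,
    Trivialization.symmₗ_linearMapAt _ hx]

/-- `twistInner` is the tensor product of the scalar products of `E` and `L`. -/
theorem twistInner_tmul (k : ℕ) (x : M) (e e' : E x) (l l' : Fin k → L x) :
    twistInner k x (e ⊗ₜ[ℂ] PiTensorProduct.tprod ℂ l) (e' ⊗ₜ[ℂ] PiTensorProduct.tprod ℂ l')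
      = inner ℂ e e' * ∏ i, inner ℂ (l i) (l' i) := by
  have h : ∀ i, inner ℂ (l i) (l' i) = (starRingEnd ℂ) (lineCoord L x x (l i)) *
      lineCoord L x x (l' i) * ((‖lineFrame L x x‖ ^ 2 : ℝ) : ℂ) := by
    intro i
    conv_lhs => rw [← lineCoord_smul_lineFrame x (l i), ← lineCoord_smul_lineFrame x (l' i)]
    rw [inner_smul_left, inner_smul_right, inner_self_eq_norm_sq_to_K]
    push_cast
    simp only [Complex.coe_algebraMap]
    ring
  simp only [h, Finset.prod_mul_distrib, Finset.prod_const, Finset.card_univ, Fintype.card_fin]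
  simp [twistInner, twistCoord, powCoord, pow_mul]
  ring

/-- The product connection on `E ⊗ L^k`: if `s = e ⊗ ℓ^{⊗k}` around `x` and `∇_v ℓ = θ(v) ℓ`,
then `∇_v s = (∇_v e + k θ(v) e) ⊗ ℓ^{⊗k}`. -/
def twistNabla (nablaE : CovariantDerivative (𝓡 (2 * n)) F E)
    (nablaL : CovariantDerivative (𝓡 (2 * n)) ℂ L) (k : ℕ) (s : ∀ x : M, Twist E L k x) (x : M) :
    TangentSpace (𝓡 (2 * n)) x →ₗ[ℝ] Twist E L k x where
  toFun v :=
    (nablaE (fun y => twistCoord k x y (s y)) x v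
      + ((k : ℂ) * lineCoord L x x (nablaL (lineFrame L x) x v)) • twistCoord k x x (s x))
    ⊗ₜ[ℂ] powFrame L k x x
  map_add' v w := by
    simp only [map_add, mul_add, add_smul, TensorProduct.add_tmul]
    abel
  map_smul' r v := by
    have h : lineCoord L x x (r • nablaL (lineFrame L x) x v)
        = (r : ℂ) * lineCoord L x x (nablaL (lineFrame L x) x v) := by
      rw [← Complex.coe_smul, map_smul, smul_eq_mul]
    simp only [map_smul, RingHom.id_apply, h]
    rw [TensorProduct.smul_tmul', ← Complex.coe_smul r, ← Complex.coe_smul r, smul_add, smul_smul]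
    congr 3
    ring

variable [RiemannianBundle (fun x : M => TangentSpace (𝓡 (2 * n)) x)]

/-- Clifford multiplication `c(ξ) ⊗ 1` on the fibre of `E ⊗ L^k`. -/
def twistClifford (A : CliffordAction n F E) (k : ℕ) (x : M)
    (ξ : TangentSpace (𝓡 (2 * n)) x →L[ℝ] ℝ) : Twist E L k x →ₗ[ℂ] Twist E L k x :=
  LinearMap.rTensor (⨂[ℂ]^k (L x)) (A.c x ξ)

/-- The Dirac operator `D_k = ∑ c(eⁱ) ∇_{e_i}` on sections of `E ⊗ L^k`. -/
def dirac (A : CliffordAction n F E) (nablaE : CovariantDerivative (𝓡 (2 * n)) F E)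
    (nablaL : CovariantDerivative (𝓡 (2 * n)) ℂ L) (k : ℕ) (s : ∀ x : M, Twist E L k x) (x : M) :
    Twist E L k x :=
  ∑ i, twistClifford A k x (flat (stdOrthonormalBasis ℝ (TangentSpace (𝓡 (2 * n)) x) i))
    (twistNabla nablaE nablaL k s x (stdOrthonormalBasis ℝ (TangentSpace (𝓡 (2 * n)) x) i))

/-- Sections of `E^ε ⊗ L^k`, where `E^ε` is the `ε`-eigenbundle (`ε = ±1`) of the chirality
operator of the oriented manifold. -/
def HasChirality (A : CliffordAction n F E) (o : ManifoldOrientation n M) (ε : ℤˣ) (k : ℕ)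
    (s : ∀ x : M, Twist E L k x) : Prop :=
  ∀ (x : M) (b : OrthonormalBasis (Fin (2 * n)) ℝ (TangentSpace (𝓡 (2 * n)) x)),
    b.toBasis.orientation = o.at' x →
      LinearMap.rTensor (⨂[ℂ]^k (L x)) (chirality A x b) (s x) = ((ε : ℤ) : ℂ) • s x

variable [MeasurableSpace M] [BorelSpace M] [CompactSpace M] [T2Space M]

variable (n) in
/-- The `L²` scalar product of sections of `E ⊗ L^k`. -/
def innerL2 (k : ℕ) (s t : ∀ x : M, Twist E L k x) : ℂ :=
  ∫ x, twistInner k x (s x) (t x) ∂(riemannianVolume n M)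

/-- The `L²` scalar product of one-forms with values in `E ⊗ L^k`. -/
def innerL2Form (k : ℕ) (α β : ∀ x : M, TangentSpace (𝓡 (2 * n)) x →ₗ[ℝ] Twist E L k x) : ℂ :=
  ∫ x, (∑ i, twistInner k x (α x (stdOrthonormalBasis ℝ (TangentSpace (𝓡 (2 * n)) x) i))
    (β x (stdOrthonormalBasis ℝ (TangentSpace (𝓡 (2 * n)) x) i))) ∂(riemannianVolume n M)

open Classical in
/-- The formal adjoint `∇^*` of the connection on `E ⊗ L^k`: `∇^* α` is the smooth section with
`⟨∇^* α, t⟩ = ⟨α, ∇ t⟩` for all smooth sections `t`. -/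
def nablaStar (nablaE : CovariantDerivative (𝓡 (2 * n)) F E)
    (nablaL : CovariantDerivative (𝓡 (2 * n)) ℂ L) (k : ℕ)
    (α : ∀ x : M, TangentSpace (𝓡 (2 * n)) x →ₗ[ℝ] Twist E L k x) : ∀ x : M, Twist E L k x :=
  if h : ∃ u : ∀ x : M, Twist E L k x, IsSmoothTwist n F k u ∧
      ∀ t : ∀ x : M, Twist E L k x, IsSmoothTwist n F k t →
        innerL2 n k u t = innerL2Form k α (twistNabla nablaE nablaL k t)
  then h.choose else 0

/-- The metric Laplacian `Δ_k = ∇^* ∇` on sections of `E ⊗ L^k`. -/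
def metricLaplacian (nablaE : CovariantDerivative (𝓡 (2 * n)) F E)
    (nablaL : CovariantDerivative (𝓡 (2 * n)) ℂ L) (k : ℕ) (s : ∀ x : M, Twist E L k x) :
    ∀ x : M, Twist E L k x :=
  nablaStar nablaE nablaL k (twistNabla nablaE nablaL k s)

/-- The estimate
`⟨(D_k² - Δ_k) s, s⟩ ≥ -k ⟨(τ - 2m) s, s⟩ - C ‖s‖²` for one section `s` of `E ⊗ L^k`. -/
def DiracLaplacianEstimate (A : CliffordAction n F E)
    (nablaE : CovariantDerivative (𝓡 (2 * n)) F E)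
    (nablaL : CovariantDerivative (𝓡 (2 * n)) ℂ L) (k : ℕ) (C : ℝ)
    (s : ∀ x : M, Twist E L k x) : Prop :=
  -(k : ℝ) * (innerL2 n k (fun x => ((tau nablaL x - 2 * minEig nablaL x : ℝ) : ℂ) • s x) s).re
      - C * (innerL2 n k s s).re
    ≤ (innerL2 n k
        (dirac A nablaE nablaL k (dirac A nablaE nablaL k s) - metricLaplacian nablaE nablaL k s)
        s).re

end Twist

end DiracTwist

end

/-! The Weitzenböck formula for the twisted Dirac operator reads D_k² = Δ_k + R + k c(F). Here R = ½
∑ c(eᵢ) c(eⱼ) R^E(eᵢ, eⱼ) is of order zero and does not involve k, and c(F) = ½ ∑ F(eᵢ, eⱼ) c(eᵢ)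
c(eⱼ) is Clifford multiplication by the curvature of L. On a compact manifold R is bounded, and its
bound is the constant C. What remains is the pointwise inequality ⟨c(F) u, u⟩ ≥ -(τ - 2m) |u|² for u
of the prescribed chirality.

That inequality is linear algebra (`clifford_twoForm_lower_bound`). In a suitable orthonormal basis
the form iF is a sum of n planar blocks of sizes a_l > 0 (`exists_skew_normalForm`), with τ = ∑ a_l
and m = min a_l. Then c(F) = -∑ a_l Γ_l, where Γ_l = ± i c(b) c(b') over the two basis vectors of
the l-th plane. The Γ_l are commuting self-adjoint involutions, and their product is the chirality
operator up to the sign δ of (iF)ⁿ. On spinors of chirality -δ the product is therefore -1: on each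
joint eigenspace at least one Γ_l equals -1, so ∑ a_l Γ_l ≤ τ - 2m (`sum_involution_le`).

The analysis consists of proving the formula in integrated form (`innerL2_dirac_sub_laplacian`).
Over a trivializing set of L a section of E ⊗ L^k is e ⊗ ℓ^k; the connection becomes ∇^E + kθ on E,
and the metric is multiplied by |ℓ|^{2k}. In this gauge `localDirac_localDirac` gives D² as the
curvature term minus the trace of the second covariant derivative. That minus the trace represents
∇*∇ weakly follows from the divergence theorem (`integral_divergence`), which is proved from the
definition of the Riemannian volume by charts.

To integrate the pointwise bound, (τ - 2m)|s|² has to be integrable. Hence τ and m are shown to be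
continuous: τ by polynomial approximation of the square root applied to traces, m by its description
as the minimum of |Jv| on the unit sphere. Both orientation cases are one statement with a sign δ =
±1 (`exists_diracLaplacianEstimate`). -/

noncomputable section
set_option linter.unusedSectionVars false
namespace DiracTwist

/-! ### Commuting involutions -/

section Involutions

variable {H : Type*} [NormedAddCommGroup H] [InnerProductSpace ℂ H]

/-- A self-adjoint involution of a Hermitian space. -/
structure IsInvolution (T : Module.End ℂ H) : Prop where
  sq : ∀ u, T (T u) = u
  symm : ∀ u v, inner ℂ (T u) v = inner ℂ u (T v)

theorem IsInvolution.one : IsInvolution (1 : Module.End ℂ H) := ⟨fun _ => rfl, fun _ _ => rfl⟩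

theorem IsInvolution.mul {S T : Module.End ℂ H} (hS : IsInvolution S) (hT : IsInvolution T)
    (h : Commute S T) : IsInvolution (S * T) := by
  have hc : ∀ u, S (T u) = T (S u) := fun u => congrArg (fun A : Module.End ℂ H => A u) h.eq
  refine ⟨fun u => ?_, fun u v => ?_⟩
  · simp only [Module.End.mul_apply]
    rw [hc u, hT.sq, hS.sq]
  · simp only [Module.End.mul_apply]
    rw [hS.symm, hT.symm, hc]

/-- This is positivity of (1 - S)(1 - T), a product of commuting multiples of projections: with w =
(1 - S)(1 - T)u one has |w|² = 4⟨w, u⟩, and expanding w turns ⟨w, u⟩ ≥ 0 into the claim. -/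
theorem IsInvolution.one_sub_mul_le {S T : Module.End ℂ H} (hS : IsInvolution S)
    (hT : IsInvolution T) (h : Commute S T) (u : H) :
    (inner ℂ (u - (S * T) u) u).re ≤ (inner ℂ (u - S u) u).re + (inner ℂ (u - T u) u).re := by
  have hc : ∀ u, S (T u) = T (S u) := fun u => congrArg (fun A : Module.End ℂ H => A u) h.eq
  set w := u - S u - T u + S (T u) with hw
  have hww : inner ℂ w w = 4 * inner ℂ w u := by
    have e1 : inner ℂ w (S u) = -inner ℂ w u := by
      rw [← hS.symm]
      have : S w = -w := by
        simp only [hw, map_sub, map_add, hS.sq]; abel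
      rw [this, inner_neg_left]
    have e2 : inner ℂ w (T u) = -inner ℂ w u := by
      rw [← hT.symm]
      have : T w = -w := by
        simp only [hw, map_sub, map_add, hT.sq, hc]; abel
      rw [this, inner_neg_left]
    have e3 : inner ℂ w (S (T u)) = inner ℂ w u := by
      rw [← hS.symm, ← hT.symm]
      have : T (S w) = w := by
        simp only [hw, map_sub, map_add, hT.sq, hc, hS.sq]; abel
      rw [this]
    conv_lhs => rw [hw]
    rw [inner_add_right, inner_sub_right, inner_sub_right, e1, e2, e3]
    ring
  have h4 : 0 ≤ (inner ℂ w u).re := by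
    have := congrArg Complex.re hww
    have h0 : 0 ≤ (inner ℂ w w).re := inner_self_nonneg (𝕜 := ℂ)
    rw [this] at h0
    simp at h0
    exact h0
  have h5 : inner ℂ w u = inner ℂ (u - S u) u + inner ℂ (u - T u) u - inner ℂ (u - (S * T) u) u := by
    simp only [hw, inner_add_left, inner_sub_left, Module.End.mul_apply]
    ring
  rw [h5] at h4
  simp only [Complex.sub_re, Complex.add_re] at h4
  linarith

/-- Iterating the two-factor inequality gives 1 - ∏ T ≤ ∑ (1 - T) as forms. It replaces a
simultaneous diagonalization: where the product is -1, at least one factor must contribute 2 on the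
right. -/
theorem list_prod_involution (l : List (Module.End ℂ H)) (hl : ∀ T ∈ l, IsInvolution T)
    (hc : ∀ S ∈ l, ∀ T ∈ l, Commute S T) (u : H) :
    IsInvolution l.prod ∧
      (inner ℂ (u - l.prod u) u).re ≤ (l.map fun T => (inner ℂ (u - T u) u).re).sum := by
  induction l with
  | nil => simpa using IsInvolution.one
  | cons S l ih =>
    obtain ⟨h1, h2⟩ := ih (fun T hT => hl T (List.mem_cons_of_mem _ hT))
      (fun S hS T hT => hc S (List.mem_cons_of_mem _ hS) T (List.mem_cons_of_mem _ hT))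
    have hcm : Commute S l.prod :=
      Commute.list_prod_right _ _ fun T hT => hc S List.mem_cons_self T (List.mem_cons_of_mem _ hT)
    have hS := hl S List.mem_cons_self
    refine ⟨by rw [List.prod_cons]; exact hS.mul h1 hcm, ?_⟩
    rw [List.prod_cons, List.map_cons, List.sum_cons]
    exact (hS.one_sub_mul_le h1 hcm u).trans (by linarith)

/-- If the product of the commuting self-adjoint involutions `Γ_l` is `-1` on `u`, then
`⟨∑ a_l Γ_l u, u⟩ ≤ (∑ a_l - 2 min a_l) |u|²`. -/
theorem sum_involution_le {n : ℕ} (Γ : Fin n → Module.End ℂ H) (hΓ : ∀ l, IsInvolution (Γ l))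
    (hc : ∀ l m, Commute (Γ l) (Γ m)) (a : Fin n → ℝ) (m : ℝ) (hm : 0 ≤ m)
    (ham : ∀ l, m ≤ a l) (u : H) (hu : (List.ofFn Γ).prod u = -u) :
    (∑ l, a l * (inner ℂ (Γ l u) u).re) ≤ ((∑ l, a l) - 2 * m) * ‖u‖ ^ 2 := by
  have hn : (inner ℂ u u).re = ‖u‖ ^ 2 := inner_self_eq_norm_sq (𝕜 := ℂ) u
  have h1 := (list_prod_involution (List.ofFn Γ)
    (by intro T hT; obtain ⟨l, rfl⟩ := (List.mem_ofFn' _ _).1 hT; exact hΓ l)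
    (by
      intro S hS T hT
      obtain ⟨l, rfl⟩ := (List.mem_ofFn' _ _).1 hS
      obtain ⟨m, rfl⟩ := (List.mem_ofFn' _ _).1 hT
      exact hc l m) u).2
  rw [hu, List.map_ofFn, List.sum_ofFn] at h1
  have h2 : (inner ℂ (u - -u) u).re = 2 * ‖u‖ ^ 2 := by
    rw [sub_neg_eq_add, inner_add_left, Complex.add_re, hn]; ring
  rw [h2] at h1
  -- Each 1 - Γ_l is twice an orthogonal projection, so its square is 2(1 - Γ_l).
  have hnn : ∀ l, 0 ≤ (inner ℂ (u - Γ l u) u).re := by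
    intro l
    have hw : inner ℂ (u - Γ l u) (u - Γ l u) = 2 * inner ℂ (u - Γ l u) u := by
      conv_lhs => rw [inner_sub_right, ← (hΓ l).symm, map_sub, (hΓ l).sq, ← neg_sub u (Γ l u),
        inner_neg_left]
      ring
    have h0 : 0 ≤ (inner ℂ (u - Γ l u) (u - Γ l u)).re := inner_self_nonneg (𝕜 := ℂ)
    rw [hw] at h0
    simpa using h0
  -- Since ∏ Γ_l u = -u, `h1` says 2|u|² ≤ ∑ ⟨(1 - Γ_l)u, u⟩. The terms are nonnegative, so they may
  -- be weighted by a_l ≥ m.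
  have h3 : m * (2 * ‖u‖ ^ 2) ≤ ∑ l, a l * (inner ℂ (u - Γ l u) u).re := by
    calc m * (2 * ‖u‖ ^ 2) ≤ m * ∑ l, (inner ℂ (u - Γ l u) u).re :=
          mul_le_mul_of_nonneg_left h1 hm
      _ = ∑ l, m * (inner ℂ (u - Γ l u) u).re := Finset.mul_sum _ _ _
      _ ≤ _ := Finset.sum_le_sum fun l _ => mul_le_mul_of_nonneg_right (ham l) (hnn l)
  have h4 : ∑ l, a l * (inner ℂ (u - Γ l u) u).re
      = (∑ l, a l) * ‖u‖ ^ 2 - ∑ l, a l * (inner ℂ (Γ l u) u).re := by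
    rw [Finset.sum_mul, ← Finset.sum_sub_distrib]
    refine Finset.sum_congr rfl fun l _ => ?_
    rw [inner_sub_left, Complex.sub_re, hn]; ring
  rw [h4] at h3
  linarith

end Involutions

/-! ### Normal form of skew-symmetric endomorphisms -/

section NormalForm

/-- J² is symmetric, so it has a unit eigenvector v, and J²v = -a²v with a = |Jv|. Then v and w =
-Jv/a span an invariant plane, its complement is invariant because J is skew, and induction on the
dimension applies. The signs are chosen so that ⟨b(0,l), J b(1,l)⟩ = a_l is positive. -/
theorem exists_skew_normalForm (n : ℕ) : ∀ (V : Type*) [NormedAddCommGroup V]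
    [InnerProductSpace ℝ V] [FiniteDimensional ℝ V] (_ : Module.finrank ℝ V = 2 * n)
    (J : V →ₗ[ℝ] V) (_ : ∀ v w, inner ℝ (J v) w = -inner ℝ v (J w))
    (_ : Function.Injective J),
    ∃ (b : OrthonormalBasis (Fin 2 × Fin n) ℝ V) (a : Fin n → ℝ), (∀ l, 0 < a l) ∧
      (∀ l, J (b (0, l)) = -a l • b (1, l)) ∧ (∀ l, J (b (1, l)) = a l • b (0, l)) := by
  induction n with
  | zero =>
    intro V _ _ _ hV J _ _
    have : Module.finrank ℝ V = Fintype.card (Fin 2 × Fin 0) := by simp [hV]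
    refine ⟨(stdOrthonormalBasis ℝ V).reindex (Fintype.equivOfCardEq (by simp [hV])), Fin.elim0, ?_⟩
    exact ⟨fun l => l.elim0, fun l => l.elim0, fun l => l.elim0⟩
  | succ n ih =>
    intro V _ _ _ hV J hJ hinj
    have : Nontrivial V := Module.nontrivial_of_finrank_pos (R := ℝ) (by omega)
    have hS : (J * J : Module.End ℝ V).IsSymmetric := by
      intro v w
      simp only [Module.End.mul_apply]
      rw [hJ, hJ, neg_neg]
    obtain ⟨μ, hμ⟩ : ∃ μ, Module.End.HasEigenvalue (J * J : Module.End ℝ V) μ := by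
      have := hS.hasEigenvalue_iSup_of_finiteDimensional
      exact ⟨_, this⟩
    obtain ⟨v₀, hv₀⟩ := hμ.exists_hasEigenvector
    set v : V := (‖v₀‖⁻¹ : ℝ) • v₀ with hvdef
    have hv₀n : ‖v₀‖ ≠ 0 := norm_ne_zero_iff.2 hv₀.2
    have hv1 : ‖v‖ = 1 := by rw [hvdef, norm_smul]; simp [hv₀n]
    have hJJ : J (J v) = μ • v := by
      have := hv₀.apply_eq_smul
      simp only [Module.End.mul_apply] at this
      rw [hvdef, map_smul, map_smul, this, smul_comm]
    set a := ‖J v‖ with ha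
    have hv0 : v ≠ 0 := by intro h; simp [h] at hv1
    have hapos : 0 < a := norm_pos_iff.2 fun h => hv0 (hinj (by rw [h, map_zero]))
    have hμa : μ = -a ^ 2 := by
      have h1 : inner ℝ (J v) (J v) = -(μ * 1) := by
        rw [hJ, hJJ, inner_smul_right, real_inner_self_eq_norm_sq, hv1]; simp
      rw [real_inner_self_eq_norm_sq] at h1
      linarith
    set w : V := -(a⁻¹ : ℝ) • J v with hw
    have hw1 : ‖w‖ = 1 := by rw [hw, norm_smul]; simp [← ha, hapos.ne', abs_of_pos hapos]
    have hJv : J v = -a • w := by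
      rw [hw, smul_smul]; simp [hapos.ne']
    have hJw : J w = a • v := by
      rw [hw, map_smul, hJJ, hμa, smul_smul]
      congr 1
      field_simp
    have hvJv : inner ℝ v (J v) = 0 := by
      have := hJ v v
      rw [real_inner_comm] at this
      linarith
    have hvw : inner ℝ v w = 0 := by rw [hw, inner_smul_right, hvJv, mul_zero]
    clear_value w a v
    set W : Submodule ℝ V := (Submodule.span ℝ {v, w})ᗮ with hW
    have memW : ∀ x, x ∈ W ↔ inner ℝ v x = 0 ∧ inner ℝ w x = 0 := by
      intro x
      rw [hW, Submodule.mem_orthogonal]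
      constructor
      · intro h
        exact ⟨h v (Submodule.subset_span (by simp)), h w (Submodule.subset_span (by simp))⟩
      · rintro ⟨h1, h2⟩ u hu
        obtain ⟨s, t, rfl⟩ := Submodule.mem_span_pair.1 hu
        rw [inner_add_left, inner_smul_left, inner_smul_left, h1, h2]; simp
    have hvw2 : Orthonormal ℝ ![v, w] := by
      rw [orthonormal_iff_ite]
      intro i j
      fin_cases i <;> fin_cases j <;>
        simp [hv1, hw1, hvw, real_inner_comm]
    have hWd : Module.finrank ℝ W = 2 * n := by
      have h1 : Module.finrank ℝ (Submodule.span ℝ {v, w}) = 2 := by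
        have := finrank_span_eq_card hvw2.linearIndependent
        rwa [Matrix.range_cons, Matrix.range_cons, Matrix.range_empty, Set.union_empty,
          Set.singleton_union, Fintype.card_fin] at this
      have := Submodule.finrank_add_finrank_orthogonal (Submodule.span ℝ {v, w})
      rw [h1, hV] at this
      rw [hW]; omega
    have hJW : ∀ x ∈ W, J x ∈ W := by
      intro x hx
      obtain ⟨h1, h2⟩ := (memW x).1 hx
      refine (memW _).2 ⟨?_, ?_⟩
      · have := hJ v x
        rw [hJv, inner_smul_left, h2] at this
        simp at this; linarith
      · have := hJ w x
        rw [hJw, inner_smul_left, h1] at this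
        simp at this; linarith
    obtain ⟨b', a', ha', hb0, hb1⟩ := ih W hWd (J.restrict hJW)
      (fun x y => hJ x y)
      (fun x y h => Subtype.ext (hinj (congrArg Subtype.val h)))
    -- The new plane gets index 0; the planes of the complement are shifted by one.
    let f : Fin 2 × Fin (n + 1) → V := fun p =>
      Fin.cases (![v, w] p.1) (fun l => ((b' (p.1, l) : W) : V)) p.2
    have f0 : ∀ t, f (t, 0) = ![v, w] t := fun t => rfl
    have fs : ∀ t l, f (t, Fin.succ l) = b' (t, l) := fun t l => rfl
    have hvwW : ∀ (t : Fin 2) (x : W), inner ℝ (![v, w] t) (x : V) = 0 := by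
      intro t x
      have := (memW x).1 x.2
      fin_cases t
      · exact this.1
      · exact this.2
    have hf : Orthonormal ℝ f := by
      rw [orthonormal_iff_ite]
      rintro ⟨t, l⟩ ⟨t', l'⟩
      refine Fin.cases ?_ (fun l => ?_) l <;> refine Fin.cases ?_ (fun l' => ?_) l'
      · rw [f0, f0, (orthonormal_iff_ite.1 hvw2)]
        simp
      · rw [f0, fs, hvwW, if_neg]
        simp [Ne.symm (Fin.succ_ne_zero _)]
      · rw [f0, fs, real_inner_comm, hvwW, if_neg]
        simp [Fin.succ_ne_zero]
      · rw [fs, fs, ← Submodule.coe_inner, (orthonormal_iff_ite.1 b'.orthonormal)]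
        simp
    let B : Module.Basis (Fin 2 × Fin (n + 1)) ℝ V :=
      basisOfOrthonormalOfCardEqFinrank hf (by simp [hV])
    have hB : ⇑B = f := coe_basisOfOrthonormalOfCardEqFinrank hf _
    refine ⟨B.toOrthonormalBasis (by rw [hB]; exact hf), Fin.cases a a', ?_, ?_, ?_⟩
    · intro l; refine Fin.cases ?_ (fun l => ?_) l
      · exact hapos
      · exact ha' l
    · intro l
      rw [Module.Basis.coe_toOrthonormalBasis, hB]
      refine Fin.cases ?_ (fun l => ?_) l
      · simpa [f0] using hJv
      · simpa [fs] using congrArg Subtype.val (hb0 l)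
    · intro l
      rw [Module.Basis.coe_toOrthonormalBasis, hB]
      refine Fin.cases ?_ (fun l => ?_) l
      · simpa [f0] using hJw
      · simpa [fs] using congrArg Subtype.val (hb1 l)

end NormalForm

/-! ### Orthonormal bases and eigenvalues -/

section OrthonormalSums

variable {V W : Type*} [NormedAddCommGroup V] [InnerProductSpace ℝ V] [AddCommGroup W] [Module ℝ W]
  {ι κ : Type*} [Fintype ι] [Fintype κ]

/-- The trace `∑ Φ(bᵢ, bᵢ)` of a bilinear map does not depend on the orthonormal basis. -/
theorem sum_orthonormalBasis_eq (Φ : V →ₗ[ℝ] V →ₗ[ℝ] W) (b : OrthonormalBasis ι ℝ V)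
    (b' : OrthonormalBasis κ ℝ V) : ∑ i, Φ (b i) (b i) = ∑ j, Φ (b' j) (b' j) := by
  classical
  have h1 : ∀ i, Φ (b i) (b i)
      = ∑ j, ∑ k, (inner ℝ (b' j) (b i) * inner ℝ (b i) (b' k)) • Φ (b' j) (b' k) := by
    intro i
    conv_lhs => rw [← b'.sum_repr' (b i)]
    simp only [map_sum, LinearMap.sum_apply, map_smul, LinearMap.smul_apply, Finset.smul_sum,
      smul_smul]
    rw [Finset.sum_comm]
    refine Finset.sum_congr rfl fun j _ => Finset.sum_congr rfl fun k _ => ?_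
    rw [real_inner_comm (b i) (b' k), mul_comm]
  simp only [h1]
  rw [Finset.sum_comm]
  refine Finset.sum_congr rfl fun j _ => ?_
  rw [Finset.sum_comm]
  have h2 : ∀ k, ∑ i, (inner ℝ (b' j) (b i) * inner ℝ (b i) (b' k)) • Φ (b' j) (b' k)
      = (if j = k then (1 : ℝ) else 0) • Φ (b' j) (b' k) := by
    intro k
    rw [← Finset.sum_smul, b.sum_inner_mul_inner, orthonormal_iff_ite.1 b'.orthonormal]
  simp [h2]

end OrthonormalSums

/-! ### Reading off τ and m from the characteristic polynomial. -/

section Eigenvalues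

/-- The sum of the positive `μ` such that `iμ` is a root of a real polynomial. -/
def posRootSum (p : Polynomial ℝ) : ℝ :=
  (((p.map (algebraMap ℝ ℂ)).roots.map Complex.im).filter (fun μ => 0 < μ)).sum

/-- The smallest positive `μ` such that `iμ` is a root of a real polynomial. -/
def minPosRoot (p : Polynomial ℝ) : ℝ :=
  sInf {μ : ℝ | 0 < μ ∧ (μ : ℂ) * Complex.I ∈ (p.map (algebraMap ℝ ℂ)).roots}

open Polynomial in
theorem roots_prod_sq_add {n : ℕ} (a : Fin n → ℝ) :
    ((∏ l, (X ^ 2 + C (a l ^ 2)) : ℝ[X]).map (algebraMap ℝ ℂ)).roots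
      = (Finset.univ.val.bind fun l => {(a l : ℂ) * Complex.I, -((a l : ℂ) * Complex.I)}) := by
  have h : ∀ l, (X ^ 2 + C (a l ^ 2) : ℝ[X]).map (algebraMap ℝ ℂ)
      = (X - C ((a l : ℂ) * Complex.I)) * (X - C (-((a l : ℂ) * Complex.I))) := by
    intro l
    simp only [Polynomial.map_add, Polynomial.map_pow, map_X, map_C, map_neg, map_pow,
      Complex.coe_algebraMap]
    have : (C Complex.I : ℂ[X]) ^ 2 = -1 := by rw [← C_pow, Complex.I_sq]; simp
    simp only [C_mul]
    linear_combination ((C (a l : ℂ)) ^ 2) * this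
  rw [Polynomial.map_prod, Finset.prod_congr rfl fun l _ => h l, roots_prod]
  · congr 1
    funext l
    rw [roots_mul (mul_ne_zero (X_sub_C_ne_zero _) (X_sub_C_ne_zero _)), roots_X_sub_C,
      roots_X_sub_C]
    rfl
  · exact Finset.prod_ne_zero_iff.2 fun l _ => mul_ne_zero (X_sub_C_ne_zero _) (X_sub_C_ne_zero _)

open Polynomial in
theorem posRootSum_prod {n : ℕ} (a : Fin n → ℝ) (ha : ∀ l, 0 < a l) :
    posRootSum (∏ l, (X ^ 2 + C (a l ^ 2))) = ∑ l, a l := by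
  rw [posRootSum, roots_prod_sq_add, Multiset.map_bind, Multiset.filter_bind, Multiset.sum_bind]
  rw [Finset.sum]
  congr 1
  refine Multiset.map_congr rfl fun l _ => ?_
  have h1 : Complex.im ((a l : ℂ) * Complex.I) = a l := by simp
  have h2 : Complex.im (-((a l : ℂ) * Complex.I)) = -a l := by simp
  rw [Multiset.insert_eq_cons, Multiset.map_cons, Multiset.map_singleton, h1, h2,
    Multiset.filter_cons_of_pos _ (ha l), Multiset.filter_singleton,
    if_neg (by linarith [ha l])]
  simp

open Polynomial in
theorem mem_roots_prod {n : ℕ} (a : Fin n → ℝ) (ha : ∀ l, 0 < a l) :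
    {μ : ℝ | 0 < μ ∧ (μ : ℂ) * Complex.I ∈
      ((∏ l, (X ^ 2 + C (a l ^ 2)) : ℝ[X]).map (algebraMap ℝ ℂ)).roots} = Set.range a := by
  ext μ
  rw [roots_prod_sq_add]
  simp only [Set.mem_ofPred_eq, Multiset.mem_bind, Finset.mem_val, Finset.mem_univ, true_and,
    Multiset.insert_eq_cons, Multiset.mem_cons, Multiset.mem_singleton, Set.mem_range]
  constructor
  · rintro ⟨h0, l, h | h⟩
    · exact ⟨l, by simpa using (mul_right_cancel₀ Complex.I_ne_zero h).symm⟩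
    · rw [← neg_mul] at h
      have := mul_right_cancel₀ Complex.I_ne_zero h
      have h' : μ = -a l := by exact_mod_cast this
      linarith [ha l]
  · rintro ⟨l, rfl⟩
    exact ⟨ha l, l, Or.inl rfl⟩

open Polynomial in
theorem minPosRoot_prod {n : ℕ} (a : Fin n → ℝ) (ha : ∀ l, 0 < a l) :
    minPosRoot (∏ l, (X ^ 2 + C (a l ^ 2))) = sInf (Set.range a) := by
  rw [minPosRoot, mem_roots_prod a ha]

-- In the adapted basis the matrix is block diagonal with blocks (0, a; -a, 0), each contributing X²
-- + a². Combined with the two root computations above this identifies τ with ∑ a_l and m with the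
-- least a_l.
open Polynomial in
theorem charpoly_of_normalForm {n : ℕ} {V : Type*} [NormedAddCommGroup V] [InnerProductSpace ℝ V]
    [FiniteDimensional ℝ V] (J : V →ₗ[ℝ] V) (b : OrthonormalBasis (Fin 2 × Fin n) ℝ V)
    (a : Fin n → ℝ) (h0 : ∀ l, J (b (0, l)) = -a l • b (1, l))
    (h1 : ∀ l, J (b (1, l)) = a l • b (0, l)) :
    J.charpoly = ∏ l, (X ^ 2 + C (a l ^ 2)) := by
  rw [← LinearMap.charpoly_toMatrix J b.toBasis]
  have hM : LinearMap.toMatrix b.toBasis b.toBasis J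
      = Matrix.blockDiagonal fun l => !![0, a l; -a l, 0] := by
    ext ⟨t, l⟩ ⟨t', l'⟩
    rw [LinearMap.toMatrix_apply, Matrix.blockDiagonal_apply, OrthonormalBasis.coe_toBasis,
      OrthonormalBasis.coe_toBasis_repr_apply, OrthonormalBasis.repr_apply_apply]
    fin_cases t' <;> fin_cases t <;>
      simp [h0, h1, inner_smul_right, orthonormal_iff_ite.1 b.orthonormal]
    all_goals split_ifs with h <;> simp [h]
  rw [hM, Matrix.charpoly]
  have hC : (Matrix.blockDiagonal fun l => !![0, a l; -a l, 0]).charmatrix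
      = Matrix.blockDiagonal fun l => (!![0, a l; -a l, 0] : Matrix (Fin 2) (Fin 2) ℝ).charmatrix := by
    ext1 ⟨t, l⟩ ⟨t', l'⟩
    simp only [Matrix.charmatrix_apply, Matrix.blockDiagonal_apply, Matrix.diagonal_apply,
      Prod.mk.injEq]
    by_cases h : l = l' <;> by_cases h' : t = t' <;> simp [h, h']
  rw [hC, Matrix.det_blockDiagonal]
  refine Finset.prod_congr rfl fun l _ => ?_
  rw [Matrix.det_fin_two]
  simp
  ring

end Eigenvalues

/-! ### The sign of the top power of a two-form in normal form -/

section TopPower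

theorem perm_fin_two_sign (f : Equiv.Perm (Fin 2)) (η : Fin 2 → Fin 2 → ℝ)
    (hη : ∀ s t, η s t = -η t s) :
    ((Equiv.Perm.sign f : ℤ) : ℝ) * η (f 0) (f 1) = η 0 1 := by
  have : f = 1 ∨ f = Equiv.swap 0 1 := by revert f; decide
  rcases this with rfl | rfl
  · simp
  · rw [Equiv.swap_apply_left, Equiv.swap_apply_right, hη 1 0,
      Equiv.Perm.sign_swap (by decide)]
    simp

/-- If no factor vanishes, σ maps each pair {(0,j), (1,j)} onto a pair, so it is a permutation R of
the pairs composed with flips inside them. Permuting whole pairs is even, because R acts on both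
members, and the sign of each flip is absorbed by the antisymmetry of η. -/
theorem topPower_term {n : ℕ} (η : Fin 2 × Fin n → Fin 2 × Fin n → ℝ)
    (hη : ∀ p q, η p q = -η q p) (h0 : ∀ p q, p.2 ≠ q.2 → η p q = 0)
    (σ : Equiv.Perm (Fin 2 × Fin n)) :
    ((Equiv.Perm.sign σ : ℤ) : ℝ) * ∏ j, η (σ (0, j)) (σ (1, j)) = 0 ∨
    ((Equiv.Perm.sign σ : ℤ) : ℝ) * ∏ j, η (σ (0, j)) (σ (1, j)) = ∏ l, η (0, l) (1, l) := by
  by_cases hz : ∏ j, η (σ (0, j)) (σ (1, j)) = 0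
  · left; rw [hz, mul_zero]
  right
  have hne : ∀ j, η (σ (0, j)) (σ (1, j)) ≠ 0 := fun j =>
    Finset.prod_ne_zero_iff.1 hz j (Finset.mem_univ j)
  have h2 : ∀ j, (σ (0, j)).2 = (σ (1, j)).2 := fun j => by
    by_contra h; exact hne j (h0 _ _ h)
  let ρ : Fin n → Fin n := fun j => (σ (0, j)).2
  have hρ : ∀ t j, (σ (t, j)).2 = ρ j := by
    intro t j; fin_cases t
    · rfl
    · exact (h2 j).symm
  have hinj : ∀ j, Function.Injective fun t => (σ (t, j)).1 := by
    intro j s t hst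
    have : σ (s, j) = σ (t, j) := Prod.ext hst (by rw [hρ, hρ])
    simpa using σ.injective this
  have hbij : ∀ j, Function.Bijective fun t => (σ (t, j)).1 := fun j =>
    Finite.injective_iff_bijective.1 (hinj j)
  have hρinj : Function.Injective ρ := by
    intro j j' h
    obtain ⟨t, ht⟩ := (hbij j).2 (σ (0, j')).1
    have : σ (t, j) = σ (0, j') := Prod.ext ht (by rw [hρ, hρ, h])
    exact congrArg Prod.snd (σ.injective this)
  let R : Equiv.Perm (Fin n) := Equiv.ofBijective ρ (Finite.injective_iff_bijective.1 hρinj)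
  let f : Fin n → Equiv.Perm (Fin 2) := fun j => Equiv.ofBijective _ (hbij j)
  have hσ : σ = Equiv.prodCongrRight (fun _ : Fin 2 => R) * Equiv.prodCongrLeft f := by
    ext1 ⟨t, j⟩
    exact Prod.ext rfl (hρ t j)
  have hsign : Equiv.Perm.sign σ = ∏ j, Equiv.Perm.sign (f j) := by
    rw [hσ, Equiv.Perm.sign_mul, Equiv.Perm.sign_prodCongrRight, Equiv.Perm.sign_prodCongrLeft]
    simp
  have hval : ∀ t j, σ (t, j) = (f j t, R j) := fun t j => Prod.ext rfl (hρ t j)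
  rw [hsign]
  push_cast
  rw [← Finset.prod_mul_distrib, ← Equiv.prod_comp R fun l => η (0, l) (1, l)]
  refine Finset.prod_congr rfl fun j _ => ?_
  rw [hval, hval]
  exact perm_fin_two_sign (f j) (fun s t => η (s, R j) (t, R j)) fun s t => hη _ _

/-- All nonzero terms are equal, and N counts them. Its value is irrelevant: N ≥ 0 is enough to read
the sign of the top power from the product of the diagonal blocks. -/
theorem topPower_eq_card_mul {n : ℕ} (η : Fin 2 × Fin n → Fin 2 × Fin n → ℝ)
    (hη : ∀ p q, η p q = -η q p) (h0 : ∀ p q, p.2 ≠ q.2 → η p q = 0) :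
    ∃ N : ℕ, ∑ σ : Equiv.Perm (Fin 2 × Fin n), ((Equiv.Perm.sign σ : ℤ) : ℝ) *
      ∏ j, η (σ (0, j)) (σ (1, j)) = N * ∏ l, η (0, l) (1, l) := by
  classical
  refine ⟨(Finset.univ.filter fun σ : Equiv.Perm (Fin 2 × Fin n) =>
    ((Equiv.Perm.sign σ : ℤ) : ℝ) * ∏ j, η (σ (0, j)) (σ (1, j)) ≠ 0).card, ?_⟩
  rw [← Finset.sum_filter_ne_zero, Finset.card_eq_sum_ones, Nat.cast_sum, Finset.sum_mul]
  refine Finset.sum_congr rfl fun σ hσ => ?_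
  rcases topPower_term η hη h0 σ with h | h
  · exact absurd h (Finset.mem_filter.1 hσ).2
  · rw [h]; simp

/-- The numbering `(t, l) ↦ 2 l + t`. -/
def pairIndex (n : ℕ) : Fin 2 × Fin n ≃ Fin (2 * n) :=
  ((Equiv.prodComm _ _).trans finProdFinEquiv).trans (finCongr (mul_comm n 2))

theorem pairIndex_apply (n : ℕ) (t : Fin 2) (l : Fin n) :
    (pairIndex n (t, l) : ℕ) = 2 * l + t := by
  simp [pairIndex, add_comm]

theorem pairIndex_zero (n : ℕ) (l : Fin n) :
    pairIndex n (0, l) = ⟨2 * l, by omega⟩ := by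
  ext; rw [pairIndex_apply]; simp

theorem pairIndex_one (n : ℕ) (l : Fin n) :
    pairIndex n (1, l) = ⟨2 * l + 1, by omega⟩ := by
  ext; rw [pairIndex_apply]; simp

/-- The top power of a two-form, as in `iCurvatureTopPower`. -/
def topPower {n : ℕ} {V : Type*} (η : V → V → ℝ) (b : Fin (2 * n) → V) : ℝ :=
  ∑ σ : Equiv.Perm (Fin (2 * n)), ((Equiv.Perm.sign σ : ℤ) : ℝ) *
    ∏ j : Fin n, η (b (σ ⟨2 * j, by omega⟩)) (b (σ ⟨2 * j + 1, by omega⟩))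

theorem topPower_eq_pairIndex {n : ℕ} {V : Type*} (η : V → V → ℝ) (b : Fin (2 * n) → V) :
    topPower η b = ∑ σ : Equiv.Perm (Fin 2 × Fin n), ((Equiv.Perm.sign σ : ℤ) : ℝ) *
      ∏ j, η (b (pairIndex n (σ (0, j)))) (b (pairIndex n (σ (1, j)))) := by
  rw [topPower, ← Equiv.sum_comp (pairIndex n).permCongr]
  refine Finset.sum_congr rfl fun σ _ => ?_
  rw [Equiv.Perm.sign_permCongr]
  simp only [← pairIndex_zero, ← pairIndex_one, Equiv.permCongr_apply, Equiv.symm_apply_apply]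

/-- Every permutation places the index i in some pair, so each product has a vanishing factor. -/
theorem topPower_eq_zero {n : ℕ} {V : Type*} (η : V → V → ℝ) (b : Fin (2 * n) → V)
    (i : Fin (2 * n)) (h : ∀ v, η (b i) v = 0) (h' : ∀ v, η v (b i) = 0) : topPower η b = 0 := by
  rw [topPower_eq_pairIndex]
  refine Finset.sum_eq_zero fun σ _ => ?_
  obtain ⟨⟨t, j⟩, hp⟩ := σ.surjective ((pairIndex n).symm i)
  refine mul_eq_zero_of_right _ (Finset.prod_eq_zero (Finset.mem_univ j) ?_)
  fin_cases t
  · simp only [Fin.zero_eta] at hp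
    rw [hp, Equiv.apply_symm_apply, h]
  · simp only [Fin.mk_one] at hp
    rw [hp, Equiv.apply_symm_apply, h']

end TopPower

/-! ### Clifford multiplication by a two-form -/

section Clifford

variable {n : ℕ} {V H : Type*} [NormedAddCommGroup V] [InnerProductSpace ℝ V]
  [NormedAddCommGroup H] [InnerProductSpace ℂ H]

/-- Skew-adjoint Clifford multiplication by the vectors of a Euclidean space. -/
structure IsClifford (c : V →ₗ[ℝ] Module.End ℂ H) : Prop where
  sq : ∀ v e, c v (c v e) = -((‖v‖ ^ 2 : ℝ) : ℂ) • e
  skew : ∀ v e e', inner ℂ (c v e) e' = -inner ℂ e (c v e')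

variable {c : V →ₗ[ℝ] Module.End ℂ H}

theorem IsClifford.anticomm (hc : IsClifford c) (v w : V) (e : H) :
    c v (c w e) + c w (c v e) = -((2 * inner ℝ v w : ℝ) : ℂ) • e := by
  have h := hc.sq (v + w) e
  simp only [map_add, LinearMap.add_apply] at h
  rw [hc.sq, hc.sq, norm_add_sq_real] at h
  push_cast at h ⊢
  rw [← sub_eq_zero] at h ⊢
  rw [← h]
  module

theorem IsClifford.anticomm_of_inner_eq_zero (hc : IsClifford c) {v w : V} (h : inner ℝ v w = 0)
    (e : H) : c v (c w e) = -c w (c v e) := by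
  have := hc.anticomm v w e
  rw [h] at this
  rw [eq_neg_iff_add_eq_zero, this]; simp

/-- For orthonormal v, w the product c(v)c(w) is skew-adjoint with square -1, so i times it is a
self-adjoint involution. The real sign r leaves room for either orientation of the plane. -/
theorem IsClifford.isInvolution (hc : IsClifford c) {v w : V} (hv : ‖v‖ = 1) (hw : ‖w‖ = 1)
    (h : inner ℝ v w = 0) (r : ℝ) (hr : r * r = 1) :
    IsInvolution (((r : ℂ) * Complex.I) • (c v * c w)) := by
  have h1 : ∀ e, c v (c v e) = -e := fun e => by rw [hc.sq, hv]; simp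
  have h2 : ∀ e, c w (c w e) = -e := fun e => by rw [hc.sq, hw]; simp
  have hr' : (r : ℂ) * r = 1 := by exact_mod_cast hr
  refine ⟨fun u => ?_, fun u u' => ?_⟩
  · simp only [LinearMap.smul_apply, Module.End.mul_apply, map_smul, smul_smul]
    rw [hc.anticomm_of_inner_eq_zero (by rw [real_inner_comm]; exact h) (c w u), h2, map_neg,
      map_neg, map_neg, neg_neg, h1, show (r : ℂ) * Complex.I * (r * Complex.I) = -1 by
        linear_combination (r : ℂ) * r * Complex.I_mul_I - hr']
    simp
  · simp only [LinearMap.smul_apply, Module.End.mul_apply]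
    rw [inner_smul_left, inner_smul_right, hc.skew, hc.skew, neg_neg,
      hc.anticomm_of_inner_eq_zero (by rw [real_inner_comm]; exact h), inner_neg_right]
    simp

/-- Moving c(v)c(w) past c(v')c(w') takes four anticommutations, an even number. -/
theorem IsClifford.commute (hc : IsClifford c) {v w v' w' : V} (h1 : inner ℝ v v' = 0)
    (h2 : inner ℝ v w' = 0) (h3 : inner ℝ w v' = 0) (h4 : inner ℝ w w' = 0) (r r' : ℂ) :
    Commute (r • (c v * c w)) (r' • (c v' * c w')) := by
  have hs : ∀ {x y : V}, inner ℝ x y = 0 → c x * c y = -(c y * c x) := fun hxy => by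
    ext e; exact hc.anticomm_of_inner_eq_zero hxy e
  have : Commute (c v * c w) (c v' * c w') := by
    change c v * c w * (c v' * c w') = c v' * c w' * (c v * c w)
    calc c v * c w * (c v' * c w') = c v * (c w * c v') * c w' := by noncomm_ring
      _ = -(c v * c v' * (c w * c w')) := by rw [hs h3]; noncomm_ring
      _ = -(c v' * (c v * c w') * c w) := by rw [hs h1, hs h4]; noncomm_ring
      _ = _ := by rw [hs h2]; noncomm_ring
  exact (this.smul_left r).smul_right r'

theorem list_prod_smul {n : ℕ} (r : Fin n → ℂ) (T : Fin n → Module.End ℂ H) :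
    (List.ofFn fun l => r l • T l).prod = (∏ l, r l) • (List.ofFn T).prod := by
  induction n with
  | zero => simp
  | succ n ih =>
    rw [List.ofFn_succ, List.prod_cons, ih (fun l => r l.succ) fun l => T l.succ, List.ofFn_succ,
      List.prod_cons, Fin.prod_univ_succ, smul_mul_smul_comm]

/-- Grouping the 2n Clifford factors into consecutive pairs displays the chirality operator as a
product of the planar operators i c(b) c(b'). -/
theorem list_prod_pairs {n : ℕ} (T : Fin (2 * n) → Module.End ℂ H) :
    (List.ofFn T).prod
      = (List.ofFn fun l => T (pairIndex n (0, l)) * T (pairIndex n (1, l))).prod := by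
  rw [List.ofFn_mul', List.prod_flatten, List.map_ofFn]
  congr 2
  funext l
  simp only [Function.comp, pairIndex_zero, pairIndex_one]
  simp [List.ofFn_succ]

/-- The sum `∑ η(bᵢ, bⱼ) c(bᵢ) c(bⱼ)` does not depend on the orthonormal basis. -/
theorem sum_twoForm_clifford_eq {ι κ : Type*} [Fintype ι] [Fintype κ] (c : V →ₗ[ℝ] Module.End ℂ H)
    (η : V →ₗ[ℝ] V →ₗ[ℝ] ℝ) (b : OrthonormalBasis ι ℝ V) (b' : OrthonormalBasis κ ℝ V) :
    ∑ i, ∑ j, η (b i) (b j) • (c (b i) * c (b j))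
      = ∑ i, ∑ j, η (b' i) (b' j) • (c (b' i) * c (b' j)) := by
  have key : ∀ {ι : Type _} {κ : Type _} [Fintype ι] [Fintype κ] (b : OrthonormalBasis ι ℝ V)
      (b' : OrthonormalBasis κ ℝ V) (v : V),
      ∑ j, η v (b j) • (c v * c (b j)) = ∑ j, η v (b' j) • (c v * c (b' j)) := by
    intro ι κ _ _ b b' v
    exact sum_orthonormalBasis_eq
      (LinearMap.mk₂ ℝ (fun x y => η v x • (c v * c y)) (by intros; simp [add_smul])
        (by intros; simp [mul_smul]) (by intros; simp [mul_add])
        (fun r x y => by rw [map_smul, mul_smul_comm, smul_comm])) b b'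
  rw [Finset.sum_congr rfl fun i _ => key b b' (b i), Finset.sum_comm,
    Finset.sum_comm (f := fun i j => η (b' i) (b' j) • (c (b' i) * c (b' j)))]
  refine Finset.sum_congr rfl fun j _ => ?_
  exact sum_orthonormalBasis_eq
    (LinearMap.mk₂ ℝ (fun x y => η x (b' j) • (c y * c (b' j))) (by intros; simp [add_smul])
      (by intros; simp [mul_smul]) (by intros; simp [add_mul])
      (fun r x y => by rw [map_smul, smul_mul_assoc, smul_comm])) b b'

variable [FiniteDimensional ℝ V]

/-- A nonzero kernel vector of J, once normalized, is a member of some orthonormal basis. Correcting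
the orientation changes it at most by a sign, and it annihilates every term of the top power.
Non-degeneracy is thus drawn from the orientation hypothesis. -/
theorem injective_of_topPower_ne_zero (hn : 0 < n) (hV : Module.finrank ℝ V = 2 * n)
    (o : Orientation ℝ V (Fin (2 * n)))
    (η : V →ₗ[ℝ] V →ₗ[ℝ] ℝ) (hη : ∀ v w, η v w = -η w v)
    (J : V →ₗ[ℝ] V) (hJ : ∀ v w, η v w = inner ℝ v (J w))
    (htop : ∀ B : Module.Basis (Fin (2 * n)) ℝ V, B.orientation = o →
      topPower (fun v w => η v w) B ≠ 0) : Function.Injective J := by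
  have : Nonempty (Fin (2 * n)) := ⟨⟨0, by omega⟩⟩
  rw [← LinearMap.ker_eq_bot, LinearMap.ker_eq_bot']
  intro w hw
  by_contra hw0
  let i : Fin (2 * n) := ⟨0, by omega⟩
  obtain ⟨b, hb⟩ := Orthonormal.exists_orthonormalBasis_extension_of_card_eq
    (ι := Fin (2 * n)) (𝕜 := ℝ) (E := V) (by simp [hV]) (v := fun _ => (‖w‖⁻¹ : ℝ) • w) (s := {i})
    (by
      refine ⟨fun _ => ?_, fun a b hab => ?_⟩
      · simp [norm_smul, hw0]
      · exact absurd (Subtype.ext (a.2.trans b.2.symm)) hab)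
  have h1 : ∀ v, η v w = 0 := fun v => by rw [hJ, hw, inner_zero_right]
  have h2 : ∀ v, η v (b i) = 0 := fun v => by rw [hb i rfl, map_smul, h1, smul_zero]
  have h3 : ∀ v, η v (b.adjustToOrientation o i) = 0 := fun v => by
    rcases b.adjustToOrientation_apply_eq_or_eq_neg o i with h | h <;> rw [h]
    · exact h2 v
    · rw [map_neg, h2, neg_zero]
  refine htop (b.adjustToOrientation o).toBasis (b.orientation_adjustToOrientation o) ?_
  refine topPower_eq_zero _ _ i (fun v => ?_) fun v => ?_
  · rw [hη, OrthonormalBasis.coe_toBasis, h3, neg_zero]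
  · rw [OrthonormalBasis.coe_toBasis, h3]

/-- Clifford multiplication by `-i η`, for a non-degenerate two-form `η` with eigenvalues `± i μ`,
is bounded below by `-(τ - 2m)` on the spinors whose chirality is opposite to the sign of `ηⁿ`. -/
theorem clifford_twoForm_lower_bound (hn : 0 < n) (hV : Module.finrank ℝ V = 2 * n)
    (o : Orientation ℝ V (Fin (2 * n))) (hc : IsClifford c)
    (η : V →ₗ[ℝ] V →ₗ[ℝ] ℝ) (hη : ∀ v w, η v w = -η w v)
    (J : V →ₗ[ℝ] V) (hJ : ∀ v w, η v w = inner ℝ v (J w)) (δ : ℤˣ)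
    (htop : ∀ B : Module.Basis (Fin (2 * n)) ℝ V, B.orientation = o →
      0 < ((δ : ℤ) : ℝ) * topPower (fun v w => η v w) B)
    (u : H) (hu : ∀ b : OrthonormalBasis (Fin (2 * n)) ℝ V, b.toBasis.orientation = o →
      Complex.I ^ n • (List.ofFn fun i => c (b i)).prod u = ((-δ : ℤˣ) : ℤ) • u)
    {ι : Type*} [Fintype ι] (e : OrthonormalBasis ι ℝ V) :
    -(posRootSum J.charpoly - 2 * minPosRoot J.charpoly) * ‖u‖ ^ 2 ≤
      (inner ℂ ((-(Complex.I / 2)) • (∑ i, ∑ j, η (e i) (e j) • (c (e i) * c (e j))) u) u).re := by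
  have : Nonempty (Fin (2 * n)) := ⟨⟨0, by omega⟩⟩
  have : Nonempty (Fin n) := ⟨⟨0, hn⟩⟩
  have hinj := injective_of_topPower_ne_zero hn hV o η hη J hJ fun B hB h => by
    have := htop B hB
    rw [h, mul_zero] at this
    exact lt_irrefl _ this
  have hskew : ∀ v w, inner ℝ (J v) w = -inner ℝ v (J w) := fun v w => by
    rw [← hJ, real_inner_comm, ← hJ, hη]
  obtain ⟨b₀, a, ha, hb0, hb1⟩ := exists_skew_normalForm n V hV J hskew hinj
  have hchar := charpoly_of_normalForm J b₀ a hb0 hb1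
  rw [hchar, posRootSum_prod a ha, minPosRoot_prod a ha]
  set m := sInf (Set.range a) with hm
  have hm0 : 0 ≤ m := Real.sInf_nonneg (by rintro _ ⟨l, rfl⟩; exact (ha l).le)
  have hma : ∀ l, m ≤ a l := fun l =>
    csInf_le ⟨0, by rintro _ ⟨l, rfl⟩; exact (ha l).le⟩ ⟨l, rfl⟩
  let b₁ := b₀.reindex (pairIndex n)
  -- The adapted basis may have the wrong orientation, and correcting it changes signs of vectors.
  -- Only b = ±b₀ is used below; the signs r_l record the effect on the planes.
  let b := b₁.adjustToOrientation o
  have hbo : b.toBasis.orientation = o := b₁.orientation_adjustToOrientation o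
  have hbs : ∀ p, b (pairIndex n p) = b₀ p ∨ b (pairIndex n p) = -b₀ p := fun p => by
    have := b₁.adjustToOrientation_apply_eq_or_eq_neg o (pairIndex n p)
    simpa [b₁] using this
  have hη0 : ∀ p q : Fin 2 × Fin n, p.2 ≠ q.2 → η (b₀ p) (b₀ q) = 0 := by
    rintro ⟨t, l⟩ ⟨t', l'⟩ h
    rw [hJ]
    fin_cases t'
    · have := hb0 l'
      simp only [Fin.zero_eta] at *
      rw [this, inner_smul_right, orthonormal_iff_ite.1 b₀.orthonormal, if_neg, mul_zero]
      intro h'; exact h (congrArg Prod.snd h')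
    · have := hb1 l'
      simp only [Fin.mk_one] at *
      rw [this, inner_smul_right, orthonormal_iff_ite.1 b₀.orthonormal, if_neg, mul_zero]
      intro h'; exact h (congrArg Prod.snd h')
  have hη1 : ∀ l, η (b₀ (0, l)) (b₀ (1, l)) = a l := fun l => by
    rw [hJ, hb1, inner_smul_right, orthonormal_iff_ite.1 b₀.orthonormal, if_pos rfl, mul_one]
  let β : Fin 2 × Fin n → Fin 2 × Fin n → ℝ := fun p q => η (b (pairIndex n p)) (b (pairIndex n q))
  have hβ : ∀ p q, β p q = -β q p := fun p q => hη _ _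
  have hβ0 : ∀ p q, p.2 ≠ q.2 → β p q = 0 := fun p q h => by
    have := hη0 p q h
    rcases hbs p with h1 | h1 <;> rcases hbs q with h2 | h2 <;> simp [β, h1, h2, this]
  obtain ⟨r, hr, hrα⟩ : ∃ r : Fin n → ℝ, (∀ l, r l = 1 ∨ r l = -1) ∧
      ∀ l, β (0, l) (1, l) = r l * a l := by
    have : ∀ l, ∃ r : ℝ, (r = 1 ∨ r = -1) ∧ β (0, l) (1, l) = r * a l := fun l => by
      have h := hη1 l
      rcases hbs (0, l) with h1 | h1 <;> rcases hbs (1, l) with h2 | h2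
      · exact ⟨1, Or.inl rfl, by simp [β, h1, h2, h]⟩
      · exact ⟨-1, Or.inr rfl, by simp [β, h1, h2, h]⟩
      · exact ⟨-1, Or.inr rfl, by simp [β, h1, h2, h]⟩
      · exact ⟨1, Or.inl rfl, by simp [β, h1, h2, h]⟩
    choose r hr using this
    exact ⟨r, fun l => (hr l).1, fun l => (hr l).2⟩
  have hrr : ∀ l, r l * r l = 1 := fun l => by rcases hr l with h | h <;> rw [h] <;> norm_num
  -- The top power is N ∏ r_l a_l with N ≥ 0 and a_l > 0, so its sign δ must be the sign ∏ r_l.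
  have hprod : ∏ l, r l = ((δ : ℤ) : ℝ) := by
    have h1 := htop b.toBasis hbo
    rw [topPower_eq_pairIndex, OrthonormalBasis.coe_toBasis] at h1
    obtain ⟨N, hN⟩ := topPower_eq_card_mul β hβ hβ0
    rw [hN, Finset.prod_congr rfl fun l _ => hrα l, Finset.prod_mul_distrib] at h1
    have h2 : 0 < ∏ l, a l := Finset.prod_pos fun l _ => ha l
    have h3 : ∏ l, r l = 1 ∨ ∏ l, r l = -1 := by
      refine Finset.prod_induction r (fun x => x = 1 ∨ x = -1) ?_ (Or.inl rfl) fun l _ => hr l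
      rintro x y (rfl | rfl) (rfl | rfl) <;> simp
    have h4 : (0 : ℝ) ≤ N * ∏ l, a l := by positivity
    have h5 : 0 < (((δ : ℤ) : ℝ) * ∏ l, r l) * (N * ∏ l, a l) := by
      calc _ < _ := h1
        _ = _ := by ring
    rcases Int.units_eq_one_or δ with rfl | rfl <;> rcases h3 with h3 | h3 <;> rw [h3] at h5 ⊢ <;>
      simp at h5 ⊢ <;> linarith
  have hbn : ∀ p, ‖b p‖ = 1 := fun p => b.orthonormal.1 p
  have hbi : ∀ p q, p ≠ q → inner ℝ (b (pairIndex n p)) (b (pairIndex n q)) = 0 := fun p q h =>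
    b.orthonormal.2 fun h' => h ((pairIndex n).injective h')
  let Γ : Fin n → Module.End ℂ H := fun l =>
    ((r l : ℂ) * Complex.I) • (c (b (pairIndex n (0, l))) * c (b (pairIndex n (1, l))))
  have hΓ : ∀ l, IsInvolution (Γ l) := fun l =>
    hc.isInvolution (hbn _) (hbn _) (hbi _ _ (by simp)) _ (hrr l)
  have hΓc : ∀ l l', Commute (Γ l) (Γ l') := fun l l' => by
    by_cases h : l = l'
    · rw [h]
    · exact hc.commute (hbi _ _ (by simp [h])) (hbi _ _ (by simp)) (hbi _ _ (by simp))
        (hbi _ _ (by simp [h])) _ _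
  -- ∏ Γ_l equals ∏ r_l = δ times the chirality operator, which acts on u as -δ.
  have hΓu : (List.ofFn Γ).prod u = -u := by
    have h1 := hu b hbo
    rw [list_prod_pairs fun i => c (b i)] at h1
    rw [list_prod_smul, Finset.prod_mul_distrib, Finset.prod_const, Finset.card_univ,
      Fintype.card_fin, mul_smul, LinearMap.smul_apply]
    rw [LinearMap.smul_apply]
    rw [h1, ← Complex.ofReal_prod, hprod]
    rcases Int.units_eq_one_or δ with rfl | rfl <;> simp
  have hmain := sum_involution_le Γ hΓ hΓc a m hm0 hma u hΓu
  rw [sum_twoForm_clifford_eq c η e b,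
    ← (pairIndex n).sum_comp fun i => ∑ j, η (b i) (b j) • (c (b i) * c (b j))]
  -- Only entries inside one plane survive. The orders (0,l),(1,l) and (1,l),(0,l) contribute
  -- equally, since η and the Clifford product both change sign; hence the factor 2.
  have hsum : ∑ p, ∑ j, η (b (pairIndex n p)) (b j) • (c (b (pairIndex n p)) * c (b j))
      = ∑ l, (2 * β (0, l) (1, l)) •
        (c (b (pairIndex n (0, l))) * c (b (pairIndex n (1, l)))) := by
    have h1 : ∀ p, ∑ j, η (b (pairIndex n p)) (b j) • (c (b (pairIndex n p)) * c (b j))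
        = ∑ t, β p (t, p.2) • (c (b (pairIndex n p)) * c (b (pairIndex n (t, p.2)))) := fun p => by
      rw [← (pairIndex n).sum_comp, Fintype.sum_prod_type]
      refine Finset.sum_congr rfl fun t _ => ?_
      rw [Finset.sum_eq_single p.2]
      · intro l _ hl
        have := hβ0 p (t, l) hl.symm
        simp only [β] at this
        rw [this, zero_smul]
      · simp
    rw [Finset.sum_congr rfl fun p _ => h1 p, Fintype.sum_prod_type_right]
    refine Finset.sum_congr rfl fun l _ => ?_
    have h00 : ∀ p, β p p = 0 := fun p => by linarith [hβ p p]
    have hcc : c (b (pairIndex n (1, l))) * c (b (pairIndex n (0, l)))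
        = -(c (b (pairIndex n (0, l))) * c (b (pairIndex n (1, l)))) := by
      ext e; exact hc.anticomm_of_inner_eq_zero (hbi _ _ (by simp)) e
    simp only [Fin.sum_univ_two, h00, zero_smul, zero_add, add_zero]
    rw [hcc, hβ (1, l) (0, l)]
    module
  rw [hsum]
  -- By `hrα`, -(i/2) · 2 r_l a_l c(b)c(b') is exactly -a_l Γ_l.
  have hfin : (-(Complex.I / 2)) • (∑ l, (2 * β (0, l) (1, l)) •
        (c (b (pairIndex n (0, l))) * c (b (pairIndex n (1, l))))) u
      = -∑ l, ((a l : ℝ) : ℂ) • Γ l u := by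
    rw [LinearMap.sum_apply, Finset.smul_sum, ← Finset.sum_neg_distrib]
    refine Finset.sum_congr rfl fun l _ => ?_
    rw [hrα]
    simp only [Γ, LinearMap.smul_apply]
    rw [← Complex.coe_smul, smul_smul, smul_smul, ← neg_smul]
    congr 1
    push_cast
    ring
  rw [hfin, inner_neg_left, sum_inner, Complex.neg_re, Complex.re_sum]
  simp only [inner_smul_left, Complex.conj_ofReal, Complex.re_ofReal_mul]
  linarith

end Clifford

/-! ### Continuity of the eigenvalues of skew-symmetric matrices -/

section Continuity

variable {n : ℕ}

/-- -J² acts as a_l² on both vectors of the l-th plane. Symmetric expressions in the a_l² thereby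
become traces of polynomials in J, which visibly depend continuously on J. -/
theorem trace_aeval_of_normalForm {V : Type*} [NormedAddCommGroup V] [InnerProductSpace ℝ V]
    [FiniteDimensional ℝ V] (J : V →ₗ[ℝ] V) (b : OrthonormalBasis (Fin 2 × Fin n) ℝ V)
    (a : Fin n → ℝ) (h0 : ∀ l, J (b (0, l)) = -a l • b (1, l))
    (h1 : ∀ l, J (b (1, l)) = a l • b (0, l)) (q : Polynomial ℝ) :
    LinearMap.trace ℝ V (Polynomial.aeval (-(J * J) : Module.End ℝ V) q)
      = 2 * ∑ l, q.eval (a l ^ 2) := by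
  have hT : ∀ p, (-(J * J) : Module.End ℝ V) (b p) = (a p.2 ^ 2) • b p := by
    rintro ⟨t, l⟩
    simp only [LinearMap.neg_apply, Module.End.mul_apply]
    fin_cases t
    · simp only [Fin.zero_eta, h0, map_smul, h1]; module
    · simp only [Fin.mk_one, h0, map_smul, h1]; module
  have hq : ∀ p, Polynomial.aeval (-(J * J) : Module.End ℝ V) q (b p)
      = q.eval (a p.2 ^ 2) • b p := by
    intro p
    exact Module.End.aeval_apply_of_hasEigenvector
      ⟨Module.End.mem_eigenspace_iff.2 (hT p), b.orthonormal.ne_zero p⟩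
  rw [LinearMap.trace_eq_sum_inner _ b]
  simp only [hq, inner_smul_right, real_inner_self_eq_norm_sq, b.orthonormal.1, one_pow, mul_one]
  rw [Fintype.sum_prod_type]
  simp [two_mul]

theorem exists_eigenvalues_of_skew {A : Matrix (Fin (2 * n)) (Fin (2 * n)) ℝ}
    (hA : A.transpose = -A) (hinj : Function.Injective (Matrix.toEuclideanLin A)) :
    ∃ (b : OrthonormalBasis (Fin 2 × Fin n) ℝ (EuclideanSpace ℝ (Fin (2 * n)))) (a : Fin n → ℝ),
      (∀ l, 0 < a l) ∧ (∀ l, Matrix.toEuclideanLin A (b (0, l)) = -a l • b (1, l)) ∧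
      (∀ l, Matrix.toEuclideanLin A (b (1, l)) = a l • b (0, l)) ∧
      posRootSum A.charpoly = ∑ l, a l ∧ minPosRoot A.charpoly = sInf (Set.range a) ∧
      ∀ q : Polynomial ℝ, (Polynomial.aeval (-(A * A)) q).trace = 2 * ∑ l, q.eval (a l ^ 2) := by
  have hskew : ∀ v w, inner ℝ (Matrix.toEuclideanLin A v) w
      = -inner ℝ v (Matrix.toEuclideanLin A w) := by
    intro v w
    have h := LinearMap.adjoint_inner_left (Matrix.toEuclideanLin A) w v
    rw [← Matrix.toEuclideanLin_conjTranspose_eq_adjoint, Matrix.conjTranspose_eq_transpose_of_trivial,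
      hA, map_neg, LinearMap.neg_apply, inner_neg_left] at h
    rw [← h, neg_neg]
  obtain ⟨b, a, ha, h0, h1⟩ := exists_skew_normalForm n (EuclideanSpace ℝ (Fin (2 * n))) (by simp)
    (Matrix.toEuclideanLin A) hskew hinj
  have hlin : Matrix.toEuclideanLin A =
      Matrix.toLin (EuclideanSpace.basisFun (Fin (2 * n)) ℝ).toBasis
      (EuclideanSpace.basisFun (Fin (2 * n)) ℝ).toBasis A := by
    rw [Matrix.toEuclideanLin_eq_toLin_orthonormal]
  have hch : A.charpoly = (Matrix.toEuclideanLin A).charpoly := by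
    rw [hlin, Matrix.charpoly_toLin]
  have hc := charpoly_of_normalForm _ b a h0 h1
  refine ⟨b, a, ha, h0, h1, ?_, ?_, fun q => ?_⟩
  · rw [hch, hc, posRootSum_prod a ha]
  · rw [hch, hc, minPosRoot_prod a ha]
  · rw [← trace_aeval_of_normalForm _ b a h0 h1 q, hlin]
    have := Matrix.trace_toLin_eq (Polynomial.aeval (-(A * A)) q) (EuclideanSpace.basisFun (Fin (2 * n)) ℝ).toBasis
    rw [← this]
    congr 1
    change Matrix.toLinAlgEquiv (EuclideanSpace.basisFun (Fin (2 * n)) ℝ).toBasis _ = _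
    rw [← Polynomial.aeval_algHom_apply (Matrix.toLinAlgEquiv (EuclideanSpace.basisFun (Fin (2 * n)) ℝ).toBasis)]
    congr 1
    rw [map_neg, map_mul]
    rfl

variable {X : Type*} [TopologicalSpace X] {U : Set X}
  {A : X → Matrix (Fin (2 * n)) (Fin (2 * n)) ℝ}

/-- ∑ a_l = ∑ √(a_l²) is not a polynomial trace, but on a bounded interval √ is a uniform limit of
polynomials q. So the function is a locally uniform limit of the continuous functions ½ tr q(-A²).
-/
theorem continuousOn_posRootSum (hA : ContinuousOn A U) (hskew : ∀ x ∈ U, (A x).transpose = -A x)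
    (hinj : ∀ x ∈ U, Function.Injective (Matrix.toEuclideanLin (A x))) :
    ContinuousOn (fun x => posRootSum (A x).charpoly) U := by
  have hcont : ∀ q : Polynomial ℝ,
      ContinuousOn (fun x => (Polynomial.aeval (-(A x * A x)) q).trace) U := by
    intro q
    have h1 : Continuous fun B : Matrix (Fin (2 * n)) (Fin (2 * n)) ℝ =>
        (Polynomial.aeval (-(B * B)) q).trace :=
      Continuous.matrix_trace ((Polynomial.continuous_aeval q).comp (by fun_prop))
    exact h1.comp_continuousOn hA
  refine continuousOn_of_locally_uniform_approx_of_continuousWithinAt fun x hx u hu => ?_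
  obtain ⟨ε, hε, hεu⟩ := Metric.mem_uniformity_dist.1 hu
  -- tr(-A²) = 2 ∑ a_l² stays below R near x, so every a_l² lies in [0, R] there.
  set R := (Polynomial.aeval (-(A x * A x)) (Polynomial.X : Polynomial ℝ)).trace + 1 with hR
  have hev : ∀ᶠ y in 𝓝[U] x,
      (Polynomial.aeval (-(A y * A y)) (Polynomial.X : Polynomial ℝ)).trace < R :=
    (hcont Polynomial.X x hx).eventually_lt_const (by rw [hR]; linarith)
  -- The tolerance ε/(n+1) keeps the sum of n errors strictly below ε.
  obtain ⟨q, hq⟩ := exists_polynomial_near_of_continuousOn 0 R (fun t => √t)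
    Real.continuous_sqrt.continuousOn (ε / (n + 1)) (by positivity)
  refine ⟨_, Filter.inter_mem hev self_mem_nhdsWithin,
    fun y => (Polynomial.aeval (-(A y * A y)) q).trace / 2, (hcont q x hx).div_const 2, ?_⟩
  rintro y ⟨hyR, hyU⟩
  apply hεu
  obtain ⟨b, a, ha, -, -, h1, -, h2⟩ := exists_eigenvalues_of_skew (hskew y hyU) (hinj y hyU)
  have hyR' : 2 * ∑ l, a l ^ 2 < R := by
    have := h2 Polynomial.X
    simp only [Polynomial.eval_X] at this
    rw [← this]; exact hyR
  beta_reduce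
  rw [h1, h2 q, Real.dist_eq, mul_div_cancel_left₀ _ two_ne_zero, ← Finset.sum_sub_distrib]
  have hb : ∀ l, |a l - q.eval (a l ^ 2)| ≤ ε / (n + 1) := by
    intro l
    have hle : a l ^ 2 ≤ ∑ l, a l ^ 2 :=
      Finset.single_le_sum (f := fun l => a l ^ 2) (fun i _ => sq_nonneg _) (Finset.mem_univ l)
    have h0 : 0 ≤ ∑ l, a l ^ 2 := Finset.sum_nonneg fun i _ => sq_nonneg _
    have := hq (a l ^ 2) ⟨sq_nonneg _, by linarith⟩
    rw [Real.sqrt_sq (ha l).le, abs_sub_comm] at this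
    exact this.le
  calc |∑ l, (a l - q.eval (a l ^ 2))| ≤ ∑ l, |a l - q.eval (a l ^ 2)| :=
        Finset.abs_sum_le_sum_abs _ _
    _ ≤ ∑ _l : Fin n, ε / (n + 1) := Finset.sum_le_sum fun l _ => hb l
    _ = n * (ε / (n + 1)) := by simp
    _ < ε := by
      rw [← mul_div_assoc, div_lt_iff₀ (by positivity)]
      nlinarith

/-- In adapted coordinates |Av|² is the sum of the a_l² v_p² over the coordinates v_p of the l-th
planes, hence at least m² on the unit sphere, with equality on the plane of the least a_l. -/
theorem minPosRoot_isLeast (hn : 0 < n) {A : Matrix (Fin (2 * n)) (Fin (2 * n)) ℝ}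
    (hA : A.transpose = -A) (hinj : Function.Injective (Matrix.toEuclideanLin A)) :
    IsLeast {r | ∃ v : EuclideanSpace ℝ (Fin (2 * n)), ‖v‖ = 1 ∧ r = ‖Matrix.toEuclideanLin A v‖}
      (minPosRoot A.charpoly) := by
  have : Nonempty (Fin n) := ⟨⟨0, hn⟩⟩
  obtain ⟨b, a, ha, h0, h1, -, hm, -⟩ := exists_eigenvalues_of_skew hA hinj
  rw [hm]
  have hfin : (Set.range a).Finite := Set.finite_range a
  obtain ⟨l, hl⟩ := (Set.range_nonempty a).csInf_mem hfin
  have hle : ∀ l, sInf (Set.range a) ≤ a l := fun l => csInf_le hfin.bddBelow ⟨l, rfl⟩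
  have hpos : 0 < sInf (Set.range a) := hl ▸ ha l
  refine ⟨⟨b (0, l), b.orthonormal.1 _, ?_⟩, ?_⟩
  · rw [h0, norm_smul, b.orthonormal.1, mul_one, norm_neg, Real.norm_of_nonneg (ha l).le, hl]
  · rintro _ ⟨v, hv, rfl⟩
    set m := sInf (Set.range a)
    have hv2 : ∑ p, (b.repr v p) ^ 2 = 1 := by
      have := EuclideanSpace.real_norm_sq_eq (b.repr v)
      rw [LinearIsometryEquiv.norm_map, hv] at this
      rw [← this]; norm_num
    have hAv : Matrix.toEuclideanLin A v = ∑ l, ((b.repr v (1, l) * a l) • b (0, l)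
        + (-(b.repr v (0, l) * a l)) • b (1, l)) := by
      conv_lhs => rw [← b.sum_repr v]
      rw [map_sum, Fintype.sum_prod_type_right]
      refine Finset.sum_congr rfl fun l _ => ?_
      rw [Fin.sum_univ_two, map_smul, map_smul, h0, h1]
      module
    have hnorm : ‖Matrix.toEuclideanLin A v‖ ^ 2 = ∑ p, (a p.2 * b.repr v p) ^ 2 := by
      rw [← b.repr.norm_map, EuclideanSpace.real_norm_sq_eq, Fintype.sum_prod_type_right,
        Fintype.sum_prod_type_right]
      refine Finset.sum_congr rfl fun l _ => ?_
      have hc : ∀ t, b.repr (Matrix.toEuclideanLin A v) (t, l)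
          = if t = 0 then b.repr v (1, l) * a l else -(b.repr v (0, l) * a l) := by
        intro t
        rw [OrthonormalBasis.repr_apply_apply, hAv, inner_sum, Finset.sum_eq_single l]
        · fin_cases t <;>
            simp [inner_add_right, inner_smul_right, orthonormal_iff_ite.1 b.orthonormal]
        · intro l' _ hl'
          simp [inner_add_right, inner_smul_right, orthonormal_iff_ite.1 b.orthonormal, hl'.symm]
        · simp
      rw [Fin.sum_univ_two, Fin.sum_univ_two, hc, hc]
      simp
      ring
    refine le_of_sq_le_sq ?_ (norm_nonneg _)
    rw [hnorm]
    calc m ^ 2 = ∑ p, (m * b.repr v p) ^ 2 := by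
          simp only [mul_pow]; rw [← Finset.mul_sum, hv2, mul_one]
      _ ≤ _ := Finset.sum_le_sum fun p _ => by
        rw [mul_pow, mul_pow]
        exact mul_le_mul_of_nonneg_right (pow_le_pow_left₀ hpos.le (hle _) 2) (sq_nonneg _)

/-- A minimum of |Av| over the unit sphere is 1-Lipschitz in the operator norm: the minimizer for
one matrix is a competitor for the other. -/
theorem continuousOn_minPosRoot (hn : 0 < n) (hA : ContinuousOn A U)
    (hskew : ∀ x ∈ U, (A x).transpose = -A x)
    (hinj : ∀ x ∈ U, Function.Injective (Matrix.toEuclideanLin (A x))) :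
    ContinuousOn (fun x => minPosRoot (A x).charpoly) U := by
  let T : Matrix (Fin (2 * n)) (Fin (2 * n)) ℝ →ₗ[ℝ]
      (EuclideanSpace ℝ (Fin (2 * n)) →L[ℝ] EuclideanSpace ℝ (Fin (2 * n))) :=
    LinearMap.toContinuousLinearMap.toLinearMap ∘ₗ (Matrix.toEuclideanLin).toLinearMap
  have hT : Continuous T := LinearMap.continuous_of_finiteDimensional T
  have key : ∀ x ∈ U, ∀ y ∈ U,
      minPosRoot (A x).charpoly ≤ minPosRoot (A y).charpoly + ‖T (A x) - T (A y)‖ := by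
    intro x hx y hy
    obtain ⟨v, hv, hvy⟩ := (minPosRoot_isLeast hn (hskew y hy) (hinj y hy)).1
    have h1 := (minPosRoot_isLeast hn (hskew x hx) (hinj x hx)).2 ⟨v, hv, rfl⟩
    have h2 := (T (A x) - T (A y)).le_opNorm v
    rw [hv, mul_one] at h2
    have h3 : Matrix.toEuclideanLin (A x) v
        = Matrix.toEuclideanLin (A y) v + (T (A x) - T (A y)) v := by
      simp [T]
    calc _ ≤ _ := h1
      _ ≤ ‖Matrix.toEuclideanLin (A y) v‖ + ‖(T (A x) - T (A y)) v‖ := by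
        rw [h3]; exact norm_add_le _ _
      _ ≤ _ := by rw [hvy]; linarith
  intro x hx
  rw [ContinuousWithinAt, tendsto_iff_dist_tendsto_zero]
  have hlim : Filter.Tendsto (fun y => dist (T (A y)) (T (A x))) (𝓝[U] x) (𝓝 0) :=
    tendsto_iff_dist_tendsto_zero.1 ((hT.comp_continuousOn hA) x hx)
  refine squeeze_zero' (Filter.Eventually.of_forall fun y => dist_nonneg) ?_ hlim
  filter_upwards [self_mem_nhdsWithin] with y hy
  rw [Real.dist_eq, dist_eq_norm, abs_le]
  have h1 := key x hx y hy
  have h2 := key y hy x hx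
  rw [norm_sub_rev] at h1
  constructor <;> linarith

end Continuity

/-! ### Instances for the real structure of the bundles -/

section Instances

variable {n : ℕ} {M : Type*} [TopologicalSpace M]
  [ChartedSpace (EuclideanSpace ℝ (Fin (2 * n))) M] [IsManifold (𝓡 (2 * n)) ∞ M]

variable (n M) in
/-- The topology of the tangent bundle, as a shortcut for the instance search. -/
abbrev tangentTotalSpaceTopology : TopologicalSpace (TotalSpace (EuclideanSpace ℝ (Fin (2 * n)))
    fun x : M => TangentSpace (𝓡 (2 * n)) x) := inferInstance

theorem continuousSMul_real_fiber {E : M → Type*} [∀ x, NormedAddCommGroup (E x)]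
    [∀ x, InnerProductSpace ℂ (E x)] (x : M) : ContinuousSMul ℝ (E x) := inferInstance

theorem continuousSMul_tangentSpace (x : M) : ContinuousSMul ℝ (TangentSpace (𝓡 (2 * n)) x) :=
  inferInstance

end Instances

attribute [local instance] tangentTotalSpaceTopology continuousSMul_real_fiber
  continuousSMul_tangentSpace

/-! ### Smooth local sections of vector bundles -/

section RealBundle

variable (n : ℕ) {M : Type*} [TopologicalSpace M]
  [ChartedSpace (EuclideanSpace ℝ (Fin (2 * n))) M]
  (F : Type*) [NormedAddCommGroup F] [NormedSpace ℝ F]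
  {V : M → Type*} [TopologicalSpace (TotalSpace F V)]
  [∀ x, AddCommGroup (V x)] [∀ x, Module ℝ (V x)] [∀ x : M, TopologicalSpace (V x)]
  [FiberBundle F V]

/-- The section `s` is smooth on `U`. -/
abbrev SmoothOn (s : ∀ x, V x) (U : Set M) : Prop :=
  ContMDiffOn (𝓡 (2 * n)) ((𝓡 (2 * n)).prod 𝓘(ℝ, F)) ∞ (fun x => TotalSpace.mk' F x (s x)) U

/-- The section `s` is differentiable at `x`. -/
abbrev DiffAt (s : ∀ x, V x) (x : M) : Prop :=
  MDifferentiableAt (𝓡 (2 * n)) ((𝓡 (2 * n)).prod 𝓘(ℝ, F)) (fun x => TotalSpace.mk' F x (s x)) x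

/-- The function `f` is smooth on `U`. -/
abbrev SmoothFun {G : Type*} [NormedAddCommGroup G] [NormedSpace ℝ G] (f : M → G) (U : Set M) :
    Prop :=
  ContMDiffOn (𝓡 (2 * n)) 𝓘(ℝ, G) ∞ f U

variable {n F}

theorem SmoothOn.diffAt {s : ∀ x, V x} {U : Set M} (hs : SmoothOn n F s U) (hU : IsOpen U) {x : M}
    (hx : x ∈ U) : DiffAt n F s x :=
  (hs.contMDiffAt (hU.mem_nhds hx)).mdifferentiableAt (by simp)

theorem SmoothFun.diffAt {G : Type*} [NormedAddCommGroup G] [NormedSpace ℝ G] {f : M → G}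
    {U : Set M} (hf : SmoothFun n f U) (hU : IsOpen U) {x : M} (hx : x ∈ U) :
    MDifferentiableAt (𝓡 (2 * n)) 𝓘(ℝ, G) f x :=
  (hf.contMDiffAt (hU.mem_nhds hx)).mdifferentiableAt (by simp)

theorem SmoothOn.congr_eqOn {s t : ∀ x, V x} {U : Set M} (hs : SmoothOn n F s U)
    (h : ∀ x ∈ U, t x = s x) : SmoothOn n F t U :=
  ContMDiffOn.congr hs fun x hx => by simp only [h x hx]

theorem smoothOn_of_locally {s : ∀ x, V x} {U : Set M}
    (h : ∀ x ∈ U, ∃ t : ∀ x, V x, ∃ W, IsOpen W ∧ x ∈ W ∧ SmoothOn n F t W ∧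
      ∀ y ∈ W, s y = t y) : SmoothOn n F s U := by
  intro x hx
  obtain ⟨t, W, hW, hxW, ht, hst⟩ := h x hx
  exact ((ht.congr_eqOn hst).contMDiffAt (hW.mem_nhds hxW)).contMDiffWithinAt

theorem smoothFun_of_locally {G : Type*} [NormedAddCommGroup G] [NormedSpace ℝ G] {f : M → G}
    {U : Set M} (h : ∀ x ∈ U, ∃ W, IsOpen W ∧ x ∈ W ∧ SmoothFun n f W) : SmoothFun n f U := by
  intro x hx
  obtain ⟨W, hW, hxW, ht⟩ := h x hx
  exact (ht.contMDiffAt (hW.mem_nhds hxW)).contMDiffWithinAt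

variable [VectorBundle ℝ F V]

/-- The cut-off by a bump function transfers hypotheses stated for global smooth sections (smooth
metric, Clifford action, connection) to sections over open sets. -/
theorem SmoothOn.exists_extension [IsManifold (𝓡 (2 * n)) ∞ M] [T2Space M] {s : ∀ x, V x}
    {U : Set M} (hs : SmoothOn n F s U) (hU : IsOpen U) {x : M} (hx : x ∈ U) :
    ∃ t : ∀ x, V x, SmoothOn n F t Set.univ ∧ ∃ W, IsOpen W ∧ x ∈ W ∧ W ⊆ U ∧
      ∀ y ∈ W, t y = s y := by
  obtain ⟨f, -, hf⟩ := (SmoothBumpFunction.nhds_basis_tsupport (I := 𝓡 (2 * n)) x).mem_iff.1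
    (hU.mem_nhds hx)
  have hsm := ContMDiffOn.smul_section_of_tsupport (f.contMDiff.contMDiffOn (s := U)) hU hf hs
  refine ⟨_, contMDiffOn_univ.2 hsm, ?_⟩
  have h1 : {y | f y = 1} ∈ 𝓝 x := f.eventuallyEq_one
  obtain ⟨W, hW, hWo, hxW⟩ := mem_nhds_iff.1 (Filter.inter_mem h1 (hU.mem_nhds hx))
  refine ⟨W, hWo, hxW, fun y hy => (hW hy).2, fun y hy => ?_⟩
  have : f y = 1 := (hW hy).1
  simp [this]

/-- A combination of a local frame with constant coefficients takes the value v at x; cutting it off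
makes it global. Such sections serve as test sections and as extensions of tangent vectors. -/
theorem exists_smooth_section [IsManifold (𝓡 (2 * n)) ∞ M] [T2Space M] [FiniteDimensional ℝ F]
    [ContMDiffVectorBundle ∞ F V (𝓡 (2 * n))] {x : M} (v : V x) :
    ∃ t : ∀ x, V x, SmoothOn n F t Set.univ ∧ t x = v := by
  let e := trivializationAt F V x
  let b := Module.finBasis ℝ F
  have hx : x ∈ e.baseSet := FiberBundle.mem_baseSet_trivializationAt' x
  have h1 : ∀ i, SmoothOn n F (e.localFrame b i) e.baseSet := fun i =>
    e.contMDiffOn_localFrame_baseSet (I := 𝓡 (2 * n)) ∞ b i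
  have h2 : SmoothOn n F (fun y => ∑ i, (e.localFrameCoeff (𝓡 (2 * n)) b i x v) • e.localFrame b i y)
      e.baseSet :=
    ContMDiffOn.sum_section fun i _ => (h1 i).const_smul_section
  obtain ⟨t, ht, W, -, hxW, -, hW⟩ := h2.exists_extension e.open_baseSet hx
  refine ⟨t, ht, ?_⟩
  rw [hW x hxW]
  classical
  let s : ∀ y, V y := Function.update 0 x v
  have := e.eq_sum_localFrameCoeff_smul (I := 𝓡 (2 * n)) (b := b) (s := s) hx
  simpa [s] using this.symm

end RealBundle

/-! ### Derivatives of vector-valued functions, computed in a chart. -/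

section Derivative

variable {n : ℕ} {M : Type*} [TopologicalSpace M]
  [ChartedSpace (EuclideanSpace ℝ (Fin (2 * n))) M]
  {G : Type*} [NormedAddCommGroup G] [NormedSpace ℝ G]
  {G' : Type*} [NormedAddCommGroup G'] [NormedSpace ℝ G']

/-- The derivative of a function, in the preferred chart at the point. -/
def chartDeriv (f : M → G) (x : M) : EuclideanSpace ℝ (Fin (2 * n)) →L[ℝ] G :=
  mvfderiv (𝓡 (2 * n)) f x

theorem hasFDerivAt_chart {f : M → G} {x : M} (hf : MDifferentiableAt (𝓡 (2 * n)) 𝓘(ℝ, G) f x) :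
    HasFDerivAt (f ∘ (extChartAt (𝓡 (2 * n)) x).symm) (chartDeriv f x)
      (extChartAt (𝓡 (2 * n)) x x) := by
  have h : HasFDerivWithinAt (f ∘ (extChartAt (𝓡 (2 * n)) x).symm) (chartDeriv f x)
      (Set.range (𝓡 (2 * n))) (extChartAt (𝓡 (2 * n)) x x) := hf.hasMFDerivAt.2
  rw [ModelWithCorners.Boundaryless.range_eq_univ, hasFDerivWithinAt_univ] at h
  exact h

theorem mvfderiv_eq_of_hasFDerivAt {f : M → G} {x : M}
    (hf : MDifferentiableAt (𝓡 (2 * n)) 𝓘(ℝ, G) f x)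
    {f' : EuclideanSpace ℝ (Fin (2 * n)) →L[ℝ] G}
    (h : HasFDerivAt (f ∘ (extChartAt (𝓡 (2 * n)) x).symm) f' (extChartAt (𝓡 (2 * n)) x x))
    (v : TangentSpace (𝓡 (2 * n)) x) : mvfderiv (𝓡 (2 * n)) f x v = f' v := by
  have h' := (hasFDerivAt_chart hf).unique h
  exact DFunLike.congr_fun h' v

theorem mvfderiv_clm_comp {f : M → G} {x : M} (hf : MDifferentiableAt (𝓡 (2 * n)) 𝓘(ℝ, G) f x)
    (T : G →L[ℝ] G') (v : TangentSpace (𝓡 (2 * n)) x) :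
    mvfderiv (𝓡 (2 * n)) (fun y => T (f y)) x v = T (mvfderiv (𝓡 (2 * n)) f x v) :=
  mvfderiv_eq_of_hasFDerivAt
    ((T.contMDiff.mdifferentiable (n := 1) (by simp) _).comp x hf)
    (T.hasFDerivAt.comp _ (hasFDerivAt_chart hf)) v

theorem mvfderiv_bilin {f : M → G} {g : M → G'} {G'' : Type*} [NormedAddCommGroup G'']
    [NormedSpace ℝ G''] {x : M} (B : G →L[ℝ] G' →L[ℝ] G'')
    (hf : MDifferentiableAt (𝓡 (2 * n)) 𝓘(ℝ, G) f x)
    (hg : MDifferentiableAt (𝓡 (2 * n)) 𝓘(ℝ, G') g x) (v : TangentSpace (𝓡 (2 * n)) x) :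
    mvfderiv (𝓡 (2 * n)) (fun y => B (f y) (g y)) x v
      = B (f x) (mvfderiv (𝓡 (2 * n)) g x v) + B (mvfderiv (𝓡 (2 * n)) f x v) (g x) := by
  have hx : (extChartAt (𝓡 (2 * n)) x).symm (extChartAt (𝓡 (2 * n)) x x) = x :=
    (extChartAt (𝓡 (2 * n)) x).left_inv (mem_extChartAt_source x)
  have := mvfderiv_eq_of_hasFDerivAt
    (MDifferentiableAt.clm_apply
      ((B.contMDiff.mdifferentiable (n := 1) (by simp) _).comp x hf) hg)
    (B.hasFDerivAt_of_bilinear (hasFDerivAt_chart hf) (hasFDerivAt_chart hg)) v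
  rw [show (fun y => B (f y) (g y)) = fun y => (⇑B ∘ f) y (g y) from rfl, this, hx]
  rfl

theorem mvfderiv_complex_mul {f g : M → ℂ} {x : M}
    (hf : MDifferentiableAt (𝓡 (2 * n)) 𝓘(ℝ, ℂ) f x)
    (hg : MDifferentiableAt (𝓡 (2 * n)) 𝓘(ℝ, ℂ) g x) (v : TangentSpace (𝓡 (2 * n)) x) :
    mvfderiv (𝓡 (2 * n)) (fun y => f y * g y) x v
      = f x * mvfderiv (𝓡 (2 * n)) g x v + mvfderiv (𝓡 (2 * n)) f x v * g x :=
  mvfderiv_bilin (ContinuousLinearMap.mul ℝ ℂ) hf hg v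

theorem mvfderiv_real_mul {f g : M → ℝ} {x : M}
    (hf : MDifferentiableAt (𝓡 (2 * n)) 𝓘(ℝ, ℝ) f x)
    (hg : MDifferentiableAt (𝓡 (2 * n)) 𝓘(ℝ, ℝ) g x) (v : TangentSpace (𝓡 (2 * n)) x) :
    mvfderiv (𝓡 (2 * n)) (fun y => f y * g y) x v
      = f x * mvfderiv (𝓡 (2 * n)) g x v + mvfderiv (𝓡 (2 * n)) f x v * g x :=
  mvfderiv_bilin (ContinuousLinearMap.mul ℝ ℝ) hf hg v

theorem mvfderiv_congr {f g : M → G} {x : M} (h : ∀ᶠ y in 𝓝 x, f y = g y)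
    (v : TangentSpace (𝓡 (2 * n)) x) :
    mvfderiv (𝓡 (2 * n)) f x v = mvfderiv (𝓡 (2 * n)) g x v := by
  have := Filter.EventuallyEq.mfderiv_eq (I := 𝓡 (2 * n)) (I' := 𝓘(ℝ, G)) (f := f) (f₁ := g)
    (h.mono fun y hy => hy.symm)
  exact congrArg (fun T : EuclideanSpace ℝ (Fin (2 * n)) →L[ℝ] G => T v) this.symm

theorem SmoothFun.mvfderiv_apply [IsManifold (𝓡 (2 * n)) ∞ M] {f : M → G} {U : Set M} (hU : IsOpen U)
    (hf : SmoothFun n f U) {X : ∀ x : M, TangentSpace (𝓡 (2 * n)) x}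
    (hX : SmoothOn n (EuclideanSpace ℝ (Fin (2 * n))) X U) :
    SmoothFun n (fun x => mvfderiv (𝓡 (2 * n)) f x (X x)) U := by
  have h1 := ContMDiffOn.contMDiffOn_tangentMapWithin hf (m := ∞) (by simp) hU.uniqueMDiffOn
  have h2 : ContMDiffOn (𝓡 (2 * n)) (𝓘(ℝ, G).prod 𝓘(ℝ, G)) ∞
      (fun x => tangentMapWithin (𝓡 (2 * n)) 𝓘(ℝ, G) f U ⟨x, X x⟩) U :=
    h1.comp hX fun x hx => hx
  have h3 := (contMDiff_snd_tangentBundle_modelSpace G 𝓘(ℝ, G) (n := ∞)).comp_contMDiffOn h2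
  refine h3.congr fun x hx => ?_
  simp only [Function.comp, tangentMapWithin]
  rw [mfderivWithin_of_isOpen hU hx]
  rfl

end Derivative

/-! ### Hermitian bundles: complex multiples of sections and covariant derivatives. -/

section ComplexBundle

variable {n : ℕ} {M : Type*} [TopologicalSpace M]
  [ChartedSpace (EuclideanSpace ℝ (Fin (2 * n))) M]
  {F : Type*} [NormedAddCommGroup F] [NormedSpace ℂ F]
  {E : M → Type*} [∀ x, NormedAddCommGroup (E x)] [∀ x, InnerProductSpace ℂ (E x)]
  [TopologicalSpace (TotalSpace F E)] [FiberBundle F E] [VectorBundle ℂ F E]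
  [VectorBundle ℝ F E]

theorem eventually_trivialization_smul (s : ∀ x, E x) (x : M) (z : ℂ) :
    ∀ᶠ y in 𝓝 x, ((trivializationAt F E x) ⟨y, z • s y⟩).2
      = z • ((trivializationAt F E x) ⟨y, s y⟩).2 := by
  filter_upwards [(trivializationAt F E x).open_baseSet.mem_nhds
    (FiberBundle.mem_baseSet_trivializationAt' x)] with y hy
  exact ((trivializationAt F E x).linear ℂ hy).map_smul z (s y)

theorem SmoothOn.complex_const_smul {s : ∀ x, E x} {U : Set M} (z : ℂ)
    (hs : SmoothOn n F s U) : SmoothOn n F (fun x => z • s x) U := by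
  intro x hx
  have hs' := hs x hx
  rw [contMDiffWithinAt_section] at hs' ⊢
  have h1 : ContMDiffWithinAt (𝓡 (2 * n)) 𝓘(ℝ, F) ∞
      (fun y => z • ((trivializationAt F E x) ⟨y, s y⟩).2) U x :=
    ((z • ContinuousLinearMap.id ℝ F).contMDiff.contMDiffAt).comp_contMDiffWithinAt x hs'
  have h2 := eventually_trivialization_smul (F := F) s x z
  exact h1.congr_of_eventuallyEq (h2.filter_mono nhdsWithin_le_nhds) h2.self_of_nhds

theorem DiffAt.complex_const_smul {s : ∀ x, E x} {x : M} (z : ℂ)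
    (hs : DiffAt n F s x) : DiffAt n F (fun x => z • s x) x := by
  unfold DiffAt at hs ⊢
  rw [mdifferentiableAt_section] at hs ⊢
  have h1 : MDifferentiableAt (𝓡 (2 * n)) 𝓘(ℝ, F)
      (fun y => z • ((trivializationAt F E x) ⟨y, s y⟩).2) x :=
    ((z • ContinuousLinearMap.id ℝ F).contMDiff.mdifferentiable (n := 1) (by simp) _).comp x hs
  exact h1.congr_of_eventuallyEq (eventually_trivialization_smul (F := F) s x z)

theorem complex_smul_eq (g : M → ℂ) (s : ∀ x, E x) :
    (fun x => g x • s x) = (fun x => (g x).re) • s + (fun x => (g x).im) • (fun x => Complex.I • s x) := by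
  funext x
  simp only [Pi.add_apply, Pi.smul_apply', ← Complex.coe_smul, smul_smul]
  rw [← add_smul, Complex.re_add_im]

theorem SmoothFun.re {g : M → ℂ} {U : Set M} (hg : SmoothFun n g U) :
    SmoothFun n (fun x => (g x).re) U :=
  Complex.reCLM.contMDiff.comp_contMDiffOn hg

theorem SmoothFun.im {g : M → ℂ} {U : Set M} (hg : SmoothFun n g U) :
    SmoothFun n (fun x => (g x).im) U :=
  Complex.imCLM.contMDiff.comp_contMDiffOn hg

theorem SmoothFun.ofReal {g : M → ℝ} {U : Set M} (hg : SmoothFun n g U) :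
    SmoothFun n (fun x => (g x : ℂ)) U :=
  Complex.ofRealCLM.contMDiff.comp_contMDiffOn hg

theorem SmoothOn.complex_smul {g : M → ℂ} {s : ∀ x, E x} {U : Set M} (hg : SmoothFun n g U)
    (hs : SmoothOn n F s U) : SmoothOn n F (fun x => g x • s x) U := by
  rw [complex_smul_eq]
  exact (hg.re.smul_section hs).add_section (hg.im.smul_section (hs.complex_const_smul _))

section Nabla

variable [IsManifold (𝓡 (2 * n)) ∞ M] [T2Space M] [FiniteDimensional ℂ F]
  [ContMDiffVectorBundle ∞ F E (𝓡 (2 * n))]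

variable (nabla : CovariantDerivative (𝓡 (2 * n)) F E)

theorem nabla_congr {s t : ∀ x, E x} {x : M} (hs : DiffAt n F s x)
    (h : ∀ᶠ y in 𝓝 x, t y = s y) : nabla t x = nabla s x := by
  have ht : DiffAt n F t x := hs.congr_of_eventuallyEq (h.mono fun y hy => by simp only [hy])
  exact nabla.isCovariantDerivativeOn.congr_of_eventuallyEq (s := Set.univ) ht hs Filter.univ_mem h

theorem nabla_add {s t : ∀ x, E x} {x : M} (hs : DiffAt n F s x) (ht : DiffAt n F t x) :
    nabla (fun y => s y + t y) x = nabla s x + nabla t x :=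
  nabla.isCovariantDerivativeOnUniv.add hs ht

theorem nabla_real_smul {s : ∀ x, E x} {g : M → ℝ} {x : M} (hs : DiffAt n F s x)
    (hg : MDifferentiableAt (𝓡 (2 * n)) 𝓘(ℝ, ℝ) g x) (v : TangentSpace (𝓡 (2 * n)) x) :
    nabla (fun y => g y • s y) x v
      = g x • nabla s x v + (mvfderiv (𝓡 (2 * n)) g x v) • s x := by
  have := nabla.isCovariantDerivativeOnUniv.leibniz hs hg
  exact congrArg (fun T => T v) this

theorem SmoothFun.inner_section (hE : IsSmoothHermitian n F E) {s t : ∀ x, E x} {U : Set M}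
    (hU : IsOpen U) (hs : SmoothOn n F s U) (ht : SmoothOn n F t U) :
    SmoothFun n (fun x => inner ℂ (s x) (t x)) U := by
  refine smoothFun_of_locally fun x hx => ?_
  obtain ⟨s', hs', W, hW, hxW, -, hsW⟩ := hs.exists_extension hU hx
  obtain ⟨t', ht', W', hW', hxW', -, htW⟩ := ht.exists_extension hU hx
  refine ⟨W ∩ W', hW.inter hW', ⟨hxW, hxW'⟩, ?_⟩
  refine ((hE s' t' (contMDiffOn_univ.1 hs') (contMDiffOn_univ.1 ht')).contMDiffOn).congr ?_
  intro y hy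
  rw [hsW y hy.1, htW y hy.2]

variable {nabla}

/-- A covariant derivative is a priori only real linear. Complex linearity is forced by the
Hermitian property: compare the derivatives of ⟨is, t⟩ = -i⟨s, t⟩ and ⟨s, t⟩ for test sections t
with arbitrary value at x. -/
theorem nabla_I_smul (hherm : IsHermitianConnection nabla) (hE : IsSmoothHermitian n F E)
    {s : ∀ x, E x} {U : Set M} (hU : IsOpen U) (hs : SmoothOn n F s U) {x : M} (hx : x ∈ U)
    (v : TangentSpace (𝓡 (2 * n)) x) :
    nabla (fun y => Complex.I • s y) x v = Complex.I • nabla s x v := by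
  refine ext_inner_right ℂ fun w => ?_
  have : FiniteDimensional ℝ F := FiniteDimensional.complexToReal F
  obtain ⟨t, ht, rfl⟩ := exists_smooth_section (n := n) (F := F) w
  have ht' := ht.diffAt isOpen_univ (Set.mem_univ x)
  have hs' := hs.diffAt hU hx
  have h1 := hherm _ t x hs' ht' v
  have h2 := hherm _ t x (hs'.complex_const_smul Complex.I) ht' v
  have hf := ((SmoothFun.inner_section hE hU hs (ht.mono (Set.subset_univ _)))).diffAt hU hx
  have h3 := mvfderiv_clm_comp hf (ContinuousLinearMap.mul ℝ ℂ (-Complex.I)) v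
  simp only [ContinuousLinearMap.mul_apply'] at h3
  simp only [inner_smul_left, Complex.conj_I] at h2 ⊢
  rw [h3, h1] at h2
  linear_combination -h2

/-- Split g into real and imaginary parts and use the real Leibniz rule together with ∇(is) = i∇s.
-/
theorem nabla_complex_smul (hherm : IsHermitianConnection nabla) (hE : IsSmoothHermitian n F E)
    {g : M → ℂ} {s : ∀ x, E x} {U : Set M} (hU : IsOpen U) (hg : SmoothFun n g U)
    (hs : SmoothOn n F s U) {x : M} (hx : x ∈ U) (v : TangentSpace (𝓡 (2 * n)) x) :
    nabla (fun y => g y • s y) x v = g x • nabla s x v + (mvfderiv (𝓡 (2 * n)) g x v) • s x := by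
  have hg' := hg.diffAt hU hx
  have h1 : DiffAt n F (fun y => (g y).re • s y) x :=
    SmoothOn.diffAt (hg.re.smul_section hs) hU hx
  have h2 : DiffAt n F (fun y => (g y).im • Complex.I • s y) x :=
    SmoothOn.diffAt (hg.im.smul_section (hs.complex_const_smul _)) hU hx
  have hre := mvfderiv_clm_comp hg' Complex.reCLM v
  have him := mvfderiv_clm_comp hg' Complex.imCLM v
  simp only [Complex.reCLM_apply, Complex.imCLM_apply] at hre him
  rw [complex_smul_eq]
  change nabla (fun y => (g y).re • s y + (g y).im • Complex.I • s y) x v = _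
  rw [nabla_add nabla h1 h2, add_apply,
    nabla_real_smul nabla (hs.diffAt hU hx) (hg.re.diffAt hU hx),
    nabla_real_smul nabla ((hs.complex_const_smul _).diffAt hU hx) (hg.im.diffAt hU hx),
    nabla_I_smul hherm hE hU hs hx, hre, him]
  simp only [← Complex.coe_smul]
  conv_rhs => rw [← Complex.re_add_im (g x), ← Complex.re_add_im (mvfderiv (𝓡 (2 * n)) g x v)]
  module

theorem SmoothOn.nabla_apply (hsm : nabla.ContMDiffCovariantDerivative ∞) {s : ∀ x, E x}
    {X : ∀ x : M, TangentSpace (𝓡 (2 * n)) x} {U : Set M} (hU : IsOpen U)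
    (hs : SmoothOn n F s U) (hX : SmoothOn n (EuclideanSpace ℝ (Fin (2 * n))) X U) :
    SmoothOn n F (fun x => nabla s x (X x)) U := by
  refine smoothOn_of_locally fun x hx => ?_
  obtain ⟨s', hs', W, hW, hxW, hWU, hsW⟩ := hs.exists_extension hU hx
  refine ⟨fun x => nabla s' x (X x), W, hW, hxW, ?_, fun y hy => ?_⟩
  · have h1 := hsm.contMDiff.contMDiff (σ := s') (by simpa using hs')
    exact ContMDiffOn.clm_bundle_apply (h1.mono (Set.subset_univ W)) (hX.mono hWU)
  · rw [nabla_congr nabla (hs'.diffAt isOpen_univ (Set.mem_univ y))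
      (Filter.mem_of_superset (hW.mem_nhds hy) fun z hz => (hsW z hz).symm)]

theorem SmoothOn.clifford [RiemannianBundle (fun x : M => TangentSpace (𝓡 (2 * n)) x)]
    (A : CliffordAction n F E) {s : ∀ x, E x}
    {X : ∀ x : M, TangentSpace (𝓡 (2 * n)) x} {U : Set M} (hU : IsOpen U)
    (hX : SmoothOn n (EuclideanSpace ℝ (Fin (2 * n))) X U) (hs : SmoothOn n F s U) :
    SmoothOn n F (fun x => A.c x (flat (X x)) (s x)) U := by
  refine smoothOn_of_locally fun x hx => ?_
  obtain ⟨s', hs', W, hW, hxW, -, hsW⟩ := hs.exists_extension hU hx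
  obtain ⟨X', hX', W', hW', hxW', -, hXW⟩ := hX.exists_extension hU hx
  refine ⟨_, W ∩ W', hW.inter hW', ⟨hxW, hxW'⟩,
    (A.smooth X' s' (contMDiffOn_univ.1 hX') (contMDiffOn_univ.1 hs')).contMDiffOn, ?_⟩
  intro y hy
  rw [hsW y hy.1, hXW y hy.2]

end Nabla

end ComplexBundle

/-! ### Smooth local orthonormal frames by the Gram–Schmidt process. -/

section Frames

variable {n : ℕ} {M : Type*} [TopologicalSpace M]
  [ChartedSpace (EuclideanSpace ℝ (Fin (2 * n))) M]
  {F : Type*} [NormedAddCommGroup F] [NormedSpace ℝ F]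
  {V : M → Type*} [TopologicalSpace (TotalSpace F V)]
  [∀ x, NormedAddCommGroup (V x)] [∀ x, InnerProductSpace ℝ (V x)]
  [FiberBundle F V] [VectorBundle ℝ F V]

theorem SmoothFun.sqrt {f : M → ℝ} {U : Set M} (hf : SmoothFun n f U) (h0 : ∀ x ∈ U, f x ≠ 0) :
    SmoothFun n (fun x => √(f x)) U := fun x hx =>
  (Real.contDiffAt_sqrt (h0 x hx)).contMDiffAt.comp_contMDiffWithinAt x (hf x hx)

theorem SmoothOn.gramSchmidt {ι : Type*} [LinearOrder ι] [LocallyFiniteOrderBot ι]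
    [WellFoundedLT ι] {U : Set M}
    (hinner : ∀ s t : ∀ x, V x, SmoothOn n F s U → SmoothOn n F t U →
      SmoothFun n (fun x => inner ℝ (s x) (t x)) U)
    {f : ι → ∀ x, V x} (hf : ∀ i, SmoothOn n F (f i) U)
    (hli : ∀ x ∈ U, LinearIndependent ℝ fun i => f i x) (i : ι) :
    SmoothOn n F (fun x => InnerProductSpace.gramSchmidt ℝ (fun j => f j x) i) U := by
  induction i using WellFoundedLT.induction with
  | ind i ih =>
    have hdef : (fun x => InnerProductSpace.gramSchmidt ℝ (fun j => f j x) i) = fun x => f i x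
        - ∑ j ∈ Finset.Iio i, (inner ℝ (InnerProductSpace.gramSchmidt ℝ (fun j => f j x) j) (f i x)
          / ‖InnerProductSpace.gramSchmidt ℝ (fun j => f j x) j‖ ^ 2)
            • InnerProductSpace.gramSchmidt ℝ (fun j => f j x) j := by
      funext x
      rw [InnerProductSpace.gramSchmidt_def]
      simp only [Submodule.starProjection_singleton]
      rfl
    rw [hdef]
    refine ContMDiffOn.sub_section (hf i) (ContMDiffOn.sum_section fun j hj => ?_)
    have hj' := ih j (Finset.mem_Iio.1 hj)
    refine ContMDiffOn.smul_section ?_ hj'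
    have h1 : SmoothFun n (fun x => ‖InnerProductSpace.gramSchmidt ℝ (fun j => f j x) j‖ ^ 2) U := by
      have := hinner _ _ hj' hj'
      simp only [real_inner_self_eq_norm_sq] at this
      exact this
    refine ContMDiffOn.div₀ (hinner _ _ hj' (hf i)) h1 fun x hx => ?_
    have := InnerProductSpace.gramSchmidt_ne_zero j (hli x hx)
    positivity

theorem SmoothOn.gramSchmidtNormed {ι : Type*} [LinearOrder ι] [LocallyFiniteOrderBot ι]
    [WellFoundedLT ι] {U : Set M}
    (hinner : ∀ s t : ∀ x, V x, SmoothOn n F s U → SmoothOn n F t U →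
      SmoothFun n (fun x => inner ℝ (s x) (t x)) U)
    {f : ι → ∀ x, V x} (hf : ∀ i, SmoothOn n F (f i) U)
    (hli : ∀ x ∈ U, LinearIndependent ℝ fun i => f i x) (i : ι) :
    SmoothOn n F (fun x => InnerProductSpace.gramSchmidtNormed ℝ (fun j => f j x) i) U := by
  have h := SmoothOn.gramSchmidt hinner hf hli i
  have h1 := hinner _ _ h h
  have h0 : ∀ x ∈ U, inner ℝ (InnerProductSpace.gramSchmidt ℝ (fun j => f j x) i)
      (InnerProductSpace.gramSchmidt ℝ (fun j => f j x) i) ≠ 0 := fun x hx => by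
    rw [Ne, inner_self_eq_zero]
    exact InnerProductSpace.gramSchmidt_ne_zero i (hli x hx)
  refine ContMDiffOn.smul_section ?_ h
  have h2 : SmoothFun n (fun x => √(inner ℝ (InnerProductSpace.gramSchmidt ℝ (fun j => f j x) i)
      (InnerProductSpace.gramSchmidt ℝ (fun j => f j x) i))) U := h1.sqrt h0
  have h3 : SmoothFun n (fun x => ‖InnerProductSpace.gramSchmidt ℝ (fun j => f j x) i‖) U := by
    simpa only [real_inner_self_eq_norm_sq, Real.sqrt_sq (norm_nonneg _)] using h2
  refine ContMDiffOn.inv₀ h3 fun x hx => ?_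
  simpa using InnerProductSpace.gramSchmidt_ne_zero i (hli x hx)

theorem exists_orthonormal_frame [IsManifold (𝓡 (2 * n)) ∞ M]
    [ContMDiffVectorBundle ∞ F V (𝓡 (2 * n))] {d : ℕ} (b : Module.Basis (Fin d) ℝ F)
    (hinner : ∀ (U : Set M) (s t : ∀ x, V x), IsOpen U → SmoothOn n F s U → SmoothOn n F t U →
      SmoothFun n (fun x => inner ℝ (s x) (t x)) U) (x₀ : M) :
    ∃ (U : Set M) (X : Fin d → ∀ x, V x) (B : ∀ x ∈ U, OrthonormalBasis (Fin d) ℝ (V x)),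
      IsOpen U ∧ x₀ ∈ U ∧
      (∀ i, SmoothOn n F (X i) U) ∧ ∀ x hx i, B x hx i = X i x := by
  let e := trivializationAt F V x₀
  have hfr := e.isLocalFrameOn_localFrame_baseSet (𝓡 (2 * n)) ∞ b
  have hli : ∀ x ∈ e.baseSet, LinearIndependent ℝ fun i => e.localFrame b i x := fun x hx =>
    hfr.linearIndependent hx
  have hON : ∀ x ∈ e.baseSet, Orthonormal ℝ (InnerProductSpace.gramSchmidtNormed ℝ
      (fun j => e.localFrame b j x)) := fun x hx =>
    InnerProductSpace.gramSchmidtNormed_orthonormal (hli x hx)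
  refine ⟨e.baseSet, fun i x => InnerProductSpace.gramSchmidtNormed ℝ
    (fun j => e.localFrame b j x) i, fun x hx => OrthonormalBasis.mk (hON x hx) ?_,
    e.open_baseSet, FiberBundle.mem_baseSet_trivializationAt' x₀, fun i => ?_, fun x hx i => ?_⟩
  · rw [InnerProductSpace.span_gramSchmidtNormed_range, InnerProductSpace.span_gramSchmidt]
    exact hfr.generating hx
  · exact SmoothOn.gramSchmidtNormed (hinner _ · · e.open_baseSet)
      (fun i => hfr.contMDiffOn i) hli i
  · simp

end Frames

/-! ### Tangent frames, Lie brackets and the torsion-free condition. -/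

section Tangent
variable {n : ℕ} {M : Type*} [TopologicalSpace M]
  [ChartedSpace (EuclideanSpace ℝ (Fin (2 * n))) M]
  [IsManifold (𝓡 (2 * n)) ∞ M]

theorem exists_tangent_orthonormal_frame
    [RiemannianBundle (fun x : M => TangentSpace (𝓡 (2 * n)) x)]
    [IsContMDiffRiemannianBundle (𝓡 (2 * n)) ∞ (EuclideanSpace ℝ (Fin (2 * n)))
      (fun x : M => TangentSpace (𝓡 (2 * n)) x)] (x₀ : M) :
    ∃ (U : Set M) (X : Fin (2 * n) → ∀ x : M, TangentSpace (𝓡 (2 * n)) x)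
      (B : ∀ x ∈ U, OrthonormalBasis (Fin (2 * n)) ℝ (TangentSpace (𝓡 (2 * n)) x)),
      IsOpen U ∧ x₀ ∈ U ∧
      (∀ i, SmoothOn n (EuclideanSpace ℝ (Fin (2 * n))) (X i) U) ∧ ∀ x hx i, B x hx i = X i x := by
  exact exists_orthonormal_frame (F := EuclideanSpace ℝ (Fin (2 * n)))
    (V := fun x : M => TangentSpace (𝓡 (2 * n)) x)
    (EuclideanSpace.basisFun (Fin (2 * n)) ℝ).toBasis
    (fun U s t hU hs ht => ContMDiffOn.inner_bundle hs ht) x₀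

theorem SmoothOn.mlieBracket {V W : ∀ x : M, TangentSpace (𝓡 (2 * n)) x} {U : Set M}
    (hU : IsOpen U) (hV : SmoothOn n (EuclideanSpace ℝ (Fin (2 * n))) V U)
    (hW : SmoothOn n (EuclideanSpace ℝ (Fin (2 * n))) W U) :
    SmoothOn n (EuclideanSpace ℝ (Fin (2 * n))) (VectorField.mlieBracket (𝓡 (2 * n)) V W) U := by
  intro x hx
  have : IsManifold (𝓡 (2 * n)) ((⊤ : ℕ∞) + 1) M := ‹_›
  have : IsManifold (𝓡 (2 * n)) (minSmoothness ℝ 2) M :=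
    IsManifold.of_le (n := ∞) (by simpa using WithTop.coe_le_coe.2 (le_top : (2 : ℕ∞) ≤ ⊤))
  exact (ContMDiffAt.mlieBracket_vectorField (m := ⊤) (n := ⊤) (hV.contMDiffAt (hU.mem_nhds hx))
    (hW.contMDiffAt (hU.mem_nhds hx)) (by simp)).contMDiffWithinAt

/-- The commutator formula [V,W]f = VWf - WVf is extracted from the Jacobi identity for V, W and fX,
minus f times the one for V, W, X: what is left is a multiple of X. Here X is a field with X(x) ≠ 0,
available since the dimension is positive. -/
theorem mvfderiv_mlieBracket (hn : 0 < n) [T2Space M] {V W : ∀ x : M, TangentSpace (𝓡 (2 * n)) x}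
    {f : M → ℝ} {U : Set M}
    (hU : IsOpen U) (hV : SmoothOn n (EuclideanSpace ℝ (Fin (2 * n))) V U)
    (hW : SmoothOn n (EuclideanSpace ℝ (Fin (2 * n))) W U) (hf : SmoothFun n f U) {x : M}
    (hx : x ∈ U) :
    mvfderiv (𝓡 (2 * n)) f x (VectorField.mlieBracket (𝓡 (2 * n)) V W x)
      = mvfderiv (𝓡 (2 * n)) (fun y => mvfderiv (𝓡 (2 * n)) f y (W y)) x (V x)
        - mvfderiv (𝓡 (2 * n)) (fun y => mvfderiv (𝓡 (2 * n)) f y (V y)) x (W x) := by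
  have hnt : Nontrivial (TangentSpace (𝓡 (2 * n)) x) := by
    have : Nonempty (Fin (2 * n)) := ⟨⟨0, by omega⟩⟩
    exact inferInstanceAs (Nontrivial (EuclideanSpace ℝ (Fin (2 * n))))
  obtain ⟨w, hw⟩ := exists_ne (0 : TangentSpace (𝓡 (2 * n)) x)
  obtain ⟨X, hX, rfl⟩ := exists_smooth_section (n := n) (F := EuclideanSpace ℝ (Fin (2 * n)))
    (V := fun x : M => TangentSpace (𝓡 (2 * n)) x) w
  replace hX : SmoothOn n (EuclideanSpace ℝ (Fin (2 * n))) X U := hX.mono (Set.subset_univ U)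
  have hms : minSmoothness ℝ 2 ≤ (∞ : WithTop ℕ∞) := by simpa using WithTop.coe_le_coe.2 (le_top : (2 : ℕ∞) ≤ ⊤)
  have : IsManifold (𝓡 (2 * n)) (minSmoothness ℝ 3) M :=
    IsManifold.of_le (n := ∞) (by simpa using WithTop.coe_le_coe.2 (le_top : (3 : ℕ∞) ≤ ⊤))
  have : IsManifold (𝓡 (2 * n)) (minSmoothness ℝ 2) M :=
    IsManifold.of_le (n := ∞) (by simpa using WithTop.coe_le_coe.2 (le_top : (2 : ℕ∞) ≤ ⊤))
  have at2 : ∀ {Y : ∀ x : M, TangentSpace (𝓡 (2 * n)) x},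
      SmoothOn n (EuclideanSpace ℝ (Fin (2 * n))) Y U →
      ContMDiffAt (𝓡 (2 * n)) ((𝓡 (2 * n)).prod 𝓘(ℝ, EuclideanSpace ℝ (Fin (2 * n))))
        (minSmoothness ℝ 2) (fun x => TotalSpace.mk' (EuclideanSpace ℝ (Fin (2 * n))) x (Y x)) x :=
    fun hY => (ContMDiffOn.contMDiffAt hY (hU.mem_nhds hx)).of_le hms
  have hJ := VectorField.leibniz_identity_mlieBracket_apply (at2 hV) (at2 hW)
    (at2 (hf.smul_section hX))
  have hJ0 := VectorField.leibniz_identity_mlieBracket_apply (at2 hV) (at2 hW) (at2 hX)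
  have hbr : ∀ {A : ∀ x : M, TangentSpace (𝓡 (2 * n)) x},
      SmoothOn n (EuclideanSpace ℝ (Fin (2 * n))) A U →
      ∀ y ∈ U, VectorField.mlieBracket (𝓡 (2 * n)) A (f • X) y
        = ((fun y => mvfderiv (𝓡 (2 * n)) f y (A y)) • X + f • VectorField.mlieBracket (𝓡 (2 * n)) A X) y :=
    fun hA y hy => VectorField.mlieBracket_smul_right (hf.diffAt hU hy) (hX.diffAt hU hy)
  have hcongr : ∀ {A B : ∀ x : M, TangentSpace (𝓡 (2 * n)) x},
      SmoothOn n (EuclideanSpace ℝ (Fin (2 * n))) A U →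
      SmoothOn n (EuclideanSpace ℝ (Fin (2 * n))) B U →
      VectorField.mlieBracket (𝓡 (2 * n)) A (VectorField.mlieBracket (𝓡 (2 * n)) B (f • X)) x
       = (mvfderiv (𝓡 (2 * n)) (fun y => mvfderiv (𝓡 (2 * n)) f y (B y)) x (A x) • X x
          + mvfderiv (𝓡 (2 * n)) f x (B x) • VectorField.mlieBracket (𝓡 (2 * n)) A X x)
        + (mvfderiv (𝓡 (2 * n)) f x (A x) • VectorField.mlieBracket (𝓡 (2 * n)) B X x
          + f x • VectorField.mlieBracket (𝓡 (2 * n)) A (VectorField.mlieBracket (𝓡 (2 * n)) B X) x) := by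
    intro A B hA hB
    have hfB := hf.mvfderiv_apply hU hB
    have hBX := SmoothOn.mlieBracket hU hB hX
    rw [Filter.EventuallyEq.mlieBracket_vectorField_eq (Filter.EventuallyEq.refl _ A)
      (Filter.mem_of_superset (hU.mem_nhds hx) (hbr hB)),
      VectorField.mlieBracket_add_right (SmoothOn.diffAt (hfB.smul_section hX) hU hx)
      (SmoothOn.diffAt (hf.smul_section hBX) hU hx),
      VectorField.mlieBracket_smul_right (hfB.diffAt hU hx) (hX.diffAt hU hx),
      VectorField.mlieBracket_smul_right (hf.diffAt hU hx) (hBX.diffAt hU hx)]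
  rw [hcongr hV hW, hcongr hW hV, hbr (SmoothOn.mlieBracket hU hV hW) x hx, hJ0] at hJ
  simp only [Pi.add_apply, Pi.smul_apply'] at hJ
  refine smul_left_injective ℝ hw ?_
  simp only [sub_smul]
  rw [← sub_eq_zero] at hJ ⊢
  rw [← neg_eq_zero, ← hJ]
  module

theorem nablaM_torsionFree [RiemannianBundle (fun x : M => TangentSpace (𝓡 (2 * n)) x)]
    {nablaM : CovariantDerivative (𝓡 (2 * n)) (EuclideanSpace ℝ (Fin (2 * n)))
      (fun x : M => TangentSpace (𝓡 (2 * n)) x)} (hM : IsLeviCivita nablaM)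
    {V W : ∀ x : M, TangentSpace (𝓡 (2 * n)) x} {x : M}
    (hV : DiffAt n (EuclideanSpace ℝ (Fin (2 * n))) V x)
    (hW : DiffAt n (EuclideanSpace ℝ (Fin (2 * n))) W x) :
    nablaM W x (V x) - nablaM V x (W x) = VectorField.mlieBracket (𝓡 (2 * n)) V W x :=
  (nablaM.torsion_eq_zero_iff.1 hM.2) hV hW

end Tangent

/-! ### Connections over open sets, second covariant derivatives and Dirac operators -/

section LocalConnection

variable {n : ℕ} {M : Type*} [TopologicalSpace M]
  [ChartedSpace (EuclideanSpace ℝ (Fin (2 * n))) M] [IsManifold (𝓡 (2 * n)) ∞ M]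
  {F : Type*} [NormedAddCommGroup F] [NormedSpace ℂ F]
  {E : M → Type*} [∀ x, NormedAddCommGroup (E x)] [∀ x, InnerProductSpace ℂ (E x)]
  [TopologicalSpace (TotalSpace F E)] [FiberBundle F E] [VectorBundle ℂ F E]
  [VectorBundle ℝ F E]

/-- The vector field `X` is smooth on `U`. -/
abbrev SmoothField (X : ∀ x : M, TangentSpace (𝓡 (2 * n)) x) (U : Set M) : Prop :=
  SmoothOn n (EuclideanSpace ℝ (Fin (2 * n))) X U

variable (F) in
/-- The operator `D` restricts to a smooth connection over the open set `U`. -/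
structure IsConnectionOn (D : (∀ x : M, E x) → ∀ x : M, TangentSpace (𝓡 (2 * n)) x →ₗ[ℝ] E x)
    (U : Set M) : Prop where
  smooth : ∀ {W : Set M} {s : ∀ x, E x} {X : ∀ x : M, TangentSpace (𝓡 (2 * n)) x}, IsOpen W →
    W ⊆ U → SmoothOn n F s W → SmoothField X W → SmoothOn n F (fun x => D s x (X x)) W
  congr : ∀ {W : Set M} {s t : ∀ x, E x} {x : M}, IsOpen W → W ⊆ U → SmoothOn n F s W →
    (∀ y ∈ W, t y = s y) → x ∈ W → D t x = D s x
  add : ∀ {W : Set M} {s t : ∀ x, E x} {x : M}, IsOpen W → W ⊆ U → SmoothOn n F s W →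
    SmoothOn n F t W → x ∈ W → D (fun y => s y + t y) x = D s x + D t x
  smul : ∀ {W : Set M} {f : M → ℝ} {s : ∀ x, E x} {x : M}, IsOpen W → W ⊆ U → SmoothFun n f W →
    SmoothOn n F s W → x ∈ W → ∀ v, D (fun y => f y • s y) x v
      = f x • D s x v + mvfderiv (𝓡 (2 * n)) f x v • s x

variable {D : (∀ x : M, E x) → ∀ x : M, TangentSpace (𝓡 (2 * n)) x →ₗ[ℝ] E x} {U : Set M}

theorem IsConnectionOn.sum (hD : IsConnectionOn F D U) {ι : Type*} (u : Finset ι)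
    {s : ι → ∀ x, E x} {W : Set M} (hW : IsOpen W) (hWU : W ⊆ U)
    (hs : ∀ i ∈ u, SmoothOn n F (s i) W) {x : M} (hx : x ∈ W) :
    D (fun y => ∑ i ∈ u, s i y) x = ∑ i ∈ u, D (s i) x := by
  classical
  induction u using Finset.induction_on with
  | empty =>
    ext v
    have h0 : SmoothOn n F (fun _ => 0 : ∀ x : M, E x) W := (contMDiff_zeroSection ℝ E).contMDiffOn
    have := hD.smul (f := fun _ => 0) hW hWU contMDiffOn_const h0 hx v
    have h1 : mvfderiv (𝓡 (2 * n)) (fun _ : M => (0 : ℝ)) x v = 0 := by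
      simp [mvfderiv]
    simpa [h1] using this
  | insert a u ha ih =>
    simp only [Finset.sum_insert ha]
    rw [hD.add hW hWU (hs a (Finset.mem_insert_self _ _))
      (ContMDiffOn.sum_section fun i hi => hs i (Finset.mem_insert_of_mem hi)) hx,
      ih fun i hi => hs i (Finset.mem_insert_of_mem hi)]

variable [T2Space M]
  [RiemannianBundle (fun x : M => TangentSpace (𝓡 (2 * n)) x)]
  [IsContMDiffRiemannianBundle (𝓡 (2 * n)) ∞ (EuclideanSpace ℝ (Fin (2 * n)))
      (fun x : M => TangentSpace (𝓡 (2 * n)) x)]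
  (nablaM : CovariantDerivative (𝓡 (2 * n)) (EuclideanSpace ℝ (Fin (2 * n)))
      (fun x : M => TangentSpace (𝓡 (2 * n)) x))

theorem nablaM_sum_smul {ι : Type*} (u : Finset ι)
    {f : ι → M → ℝ} {X : ι → ∀ x : M, TangentSpace (𝓡 (2 * n)) x} {W : Set M} (hW : IsOpen W)
    (hf : ∀ i ∈ u, SmoothFun n (f i) W) (hX : ∀ i ∈ u, SmoothField (X i) W) {x : M} (hx : x ∈ W)
    (v : TangentSpace (𝓡 (2 * n)) x) :
    nablaM (fun y => ∑ i ∈ u, f i y • X i y) x v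
      = ∑ i ∈ u, (f i x • nablaM (X i) x v + mvfderiv (𝓡 (2 * n)) (f i) x v • X i x) := by
  classical
  induction u using Finset.induction_on with
  | empty => exact congrArg (fun T => T v) (congrFun nablaM.zero x)
  | insert a u ha ih =>
    have h1 : SmoothField (fun y => f a y • X a y) W :=
      (hf a (Finset.mem_insert_self _ _)).smul_section (hX a (Finset.mem_insert_self _ _))
    have h2 : SmoothField (fun y => ∑ i ∈ u, f i y • X i y) W :=
      ContMDiffOn.sum_section fun i hi => (hf i (Finset.mem_insert_of_mem hi)).smul_section
        (hX i (Finset.mem_insert_of_mem hi))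
    have h3 := congrArg (fun T => T v)
      (nablaM.isCovariantDerivativeOnUniv.add (h1.diffAt hW hx) (h2.diffAt hW hx))
    have h4 := congrArg (fun T => T v) (nablaM.isCovariantDerivativeOnUniv.leibniz
      ((hX a (Finset.mem_insert_self _ _)).diffAt hW hx)
      ((hf a (Finset.mem_insert_self _ _)).diffAt hW hx))
    simp only [Finset.sum_insert ha]
    rw [← ih (fun i hi => hf i (Finset.mem_insert_of_mem hi))
      fun i hi => hX i (Finset.mem_insert_of_mem hi)]
    refine h3.trans ?_
    rw [add_apply]
    congr 1

theorem nablaM_congr {X Y : ∀ x : M, TangentSpace (𝓡 (2 * n)) x} {W : Set M} (hW : IsOpen W)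
    (hX : SmoothField X W) (h : ∀ y ∈ W, Y y = X y) {x : M} (hx : x ∈ W) :
    nablaM Y x = nablaM X x :=
  nablaM.isCovariantDerivativeOn.congr_of_eventuallyEq (s := Set.univ)
    ((hX.congr_eqOn h).diffAt hW hx) (hX.diffAt hW hx) Filter.univ_mem
    (Filter.mem_of_superset (hW.mem_nhds hx) h)

/-- The second covariant derivative `∇_v ∇_W s - ∇_{∇_v W} s`. -/
def fieldHessian (D : (∀ x : M, E x) → ∀ x : M, TangentSpace (𝓡 (2 * n)) x →ₗ[ℝ] E x)
    (s : ∀ x, E x) (W : ∀ x : M, TangentSpace (𝓡 (2 * n)) x) (x : M)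
    (v : TangentSpace (𝓡 (2 * n)) x) : E x :=
  D (fun y => D s y (W y)) x v - D s x (nablaM W x v)

variable {nablaM}

/-- The derivatives of the coefficients fᵢ produced by the two terms of the second covariant
derivative cancel, so it is linear over functions in the field. -/
theorem fieldHessian_sum_smul (hD : IsConnectionOn F D U) {W : Set M} (hW : IsOpen W) (hWU : W ⊆ U)
    {s : ∀ x, E x} (hs : SmoothOn n F s W) {ι : Type*} (u : Finset ι)
    {f : ι → M → ℝ} {X : ι → ∀ x : M, TangentSpace (𝓡 (2 * n)) x}
    (hf : ∀ i ∈ u, SmoothFun n (f i) W) (hX : ∀ i ∈ u, SmoothField (X i) W)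
    {Y : ∀ x : M, TangentSpace (𝓡 (2 * n)) x} (hY : ∀ y ∈ W, Y y = ∑ i ∈ u, f i y • X i y)
    {x : M} (hx : x ∈ W) (v : TangentSpace (𝓡 (2 * n)) x) :
    fieldHessian nablaM D s Y x v = ∑ i ∈ u, f i x • fieldHessian nablaM D s (X i) x v := by
  have h1 : ∀ i ∈ u, SmoothOn n F (fun y => D s y (X i y)) W := fun i hi =>
    hD.smooth hW hWU hs (hX i hi)
  have h2 : ∀ i ∈ u, SmoothOn n F (fun y => f i y • D s y (X i y)) W := fun i hi =>
    (hf i hi).smul_section (h1 i hi)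
  have h3 : SmoothField (fun y => ∑ i ∈ u, f i y • X i y) W :=
    ContMDiffOn.sum_section fun i hi => (hf i hi).smul_section (hX i hi)
  have h4 : D (fun y => D s y (Y y)) x = D (fun y => ∑ i ∈ u, f i y • D s y (X i y)) x :=
    hD.congr hW hWU (ContMDiffOn.sum_section h2) (fun y hy => by rw [hY y hy]; simp) hx
  unfold fieldHessian
  rw [h4, hD.sum u hW hWU h2 hx, nablaM_congr nablaM hW h3 hY hx,
    nablaM_sum_smul nablaM u hW hf hX hx v, LinearMap.sum_apply, map_sum, ← Finset.sum_sub_distrib]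
  refine Finset.sum_congr rfl fun i hi => ?_
  rw [hD.smul hW hWU (hf i hi) (h1 i hi) hx, map_add, map_smul, map_smul, smul_sub]
  abel

/-- Expanding both fields in an orthonormal frame and using linearity over functions, only their
values at x enter. -/
theorem fieldHessian_congr (hD : IsConnectionOn F D U) {W : Set M} (hW : IsOpen W) (hWU : W ⊆ U)
    {s : ∀ x, E x} (hs : SmoothOn n F s W) {Y Z : ∀ x : M, TangentSpace (𝓡 (2 * n)) x}
    (hY : SmoothField Y W) (hZ : SmoothField Z W) {x : M} (hx : x ∈ W) (h : Y x = Z x)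
    (v : TangentSpace (𝓡 (2 * n)) x) :
    fieldHessian nablaM D s Y x v = fieldHessian nablaM D s Z x v := by
  obtain ⟨O, X, B, hO, hxO, hX, hB⟩ := exists_tangent_orthonormal_frame (n := n) x
  have key : ∀ {Y : ∀ x : M, TangentSpace (𝓡 (2 * n)) x}, SmoothField Y W →
      fieldHessian nablaM D s Y x v
        = ∑ i, (inner ℝ (X i x) (Y x)) • fieldHessian nablaM D s (X i) x v := by
    intro Y hY
    have hX' : ∀ i ∈ Finset.univ, SmoothField (X i) (W ∩ O) := fun i _ =>
      (hX i).mono Set.inter_subset_right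
    refine fieldHessian_sum_smul hD (hW.inter hO) (fun y hy => hWU hy.1)
      (hs.mono Set.inter_subset_left) Finset.univ (f := fun i y => inner ℝ (X i y) (Y y))
      (fun i hi => ContMDiffOn.inner_bundle (hX' i hi) (hY.mono Set.inter_subset_left)) hX' ?_
      ⟨hx, hxO⟩ v
    intro y hy
    conv_lhs => rw [← (B y hy.2).sum_repr' (Y y)]
    simp only [hB]
  rw [key hY, key hZ, h]

/-- A smooth vector field with given value at `x`. -/
def fieldExtension {x : M} (v : TangentSpace (𝓡 (2 * n)) x) (y : M) : TangentSpace (𝓡 (2 * n)) y :=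
  (exists_smooth_section (n := n) (F := EuclideanSpace ℝ (Fin (2 * n)))
    (V := fun x : M => TangentSpace (𝓡 (2 * n)) x) v).choose y

theorem smoothField_fieldExtension {x : M} (v : TangentSpace (𝓡 (2 * n)) x) (W : Set M) :
    SmoothField (fieldExtension v) W :=
  ContMDiffOn.mono (exists_smooth_section (n := n) (F := EuclideanSpace ℝ (Fin (2 * n)))
    (V := fun x : M => TangentSpace (𝓡 (2 * n)) x) v).choose_spec.1 (Set.subset_univ W)

theorem fieldExtension_self {x : M} (v : TangentSpace (𝓡 (2 * n)) x) : fieldExtension v x = v :=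
  (exists_smooth_section (n := n) (F := EuclideanSpace ℝ (Fin (2 * n)))
    (V := fun x : M => TangentSpace (𝓡 (2 * n)) x) v).choose_spec.2

variable (nablaM) in
/-- The second covariant derivative of a section as a bilinear map on the tangent space. -/
def hessian (D : (∀ x : M, E x) → ∀ x : M, TangentSpace (𝓡 (2 * n)) x →ₗ[ℝ] E x)
    (s : ∀ x, E x) (x : M) :
    TangentSpace (𝓡 (2 * n)) x →ₗ[ℝ] TangentSpace (𝓡 (2 * n)) x →ₗ[ℝ] E x :=
  LinearMap.mk₂ ℝ (fun v w => ∑ i,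
      inner ℝ (stdOrthonormalBasis ℝ (TangentSpace (𝓡 (2 * n)) x) i) w
        • fieldHessian nablaM D s
          (fieldExtension (stdOrthonormalBasis ℝ (TangentSpace (𝓡 (2 * n)) x) i)) x v)
    (fun v v' w => by
      rw [← Finset.sum_add_distrib]
      refine Finset.sum_congr rfl fun i _ => ?_
      simp only [fieldHessian, map_add, ← smul_add]
      congr 1
      abel)
    (fun r v w => by
      rw [Finset.smul_sum]
      refine Finset.sum_congr rfl fun i _ => ?_
      simp only [fieldHessian, map_smul, ← smul_sub]
      rw [smul_comm])
    (fun v w w' => by simp only [inner_add_right, add_smul, Finset.sum_add_distrib])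
    (fun r v w => by simp only [inner_smul_right, Finset.smul_sum, mul_smul])

theorem hessian_apply (hD : IsConnectionOn F D U) {W : Set M} (hW : IsOpen W) (hWU : W ⊆ U)
    {s : ∀ x, E x} (hs : SmoothOn n F s W) {Y : ∀ x : M, TangentSpace (𝓡 (2 * n)) x}
    (hY : SmoothField Y W) {x : M} (hx : x ∈ W) (v : TangentSpace (𝓡 (2 * n)) x) :
    hessian nablaM D s x v (Y x) = D (fun y => D s y (Y y)) x v - D s x (nablaM Y x v) := by
  let b := stdOrthonormalBasis ℝ (TangentSpace (𝓡 (2 * n)) x)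
  have h2 : SmoothField (fun y => ∑ i, inner ℝ (b i) (Y x) • fieldExtension (b i) y) W :=
    ContMDiffOn.sum_section fun i _ => (smoothField_fieldExtension _ W).const_smul_section
  have h1 := fieldHessian_congr (nablaM := nablaM) hD hW hWU hs hY h2 hx (by
    simp only [fieldExtension_self]
    exact (b.sum_repr' (Y x)).symm) v
  refine Eq.trans ?_ h1.symm
  rw [fieldHessian_sum_smul hD hW hWU hs Finset.univ (f := fun i _ => inner ℝ (b i) (Y x))
    (X := fun i => fieldExtension (b i)) (fun i _ => contMDiffOn_const)
    (fun i _ => smoothField_fieldExtension _ W) (fun y _ => rfl) hx v]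
  rfl

/-- Absence of torsion turns the correction terms ∇_Y Z - ∇_Z Y into the bracket, so the
antisymmetric part of the Hessian is the curvature. -/
theorem hessian_sub_swap (hM : IsLeviCivita nablaM) (hD : IsConnectionOn F D U) {W : Set M}
    (hW : IsOpen W) (hWU : W ⊆ U) {s : ∀ x, E x} (hs : SmoothOn n F s W)
    {Y Z : ∀ x : M, TangentSpace (𝓡 (2 * n)) x}
    (hY : SmoothField Y W) (hZ : SmoothField Z W) {x : M} (hx : x ∈ W) :
    hessian nablaM D s x (Y x) (Z x) - hessian nablaM D s x (Z x) (Y x)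
      = D (fun y => D s y (Z y)) x (Y x) - D (fun y => D s y (Y y)) x (Z x)
        - D s x (VectorField.mlieBracket (𝓡 (2 * n)) Y Z x) := by
  rw [hessian_apply hD hW hWU hs hY hx, hessian_apply hD hW hWU hs hZ hx,
    ← nablaM_torsionFree hM (hY.diffAt hW hx) (hZ.diffAt hW hx), map_sub]
  abel

end LocalConnection

/-! ### The algebraic core of the Weitzenböck formula. -/

section CliffordAlgebra

variable {V H : Type*} [NormedAddCommGroup V] [InnerProductSpace ℝ V]
  [NormedAddCommGroup H] [InnerProductSpace ℂ H] {c : V →ₗ[ℝ] Module.End ℂ H}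

/-- Split T into antisymmetric and symmetric parts: by the Clifford relation c(bᵢ)c(bⱼ) + c(bⱼ)c(bᵢ)
= -2δᵢⱼ the symmetric part contributes only minus its trace. -/
theorem IsClifford.sum_sum_apply (hc : IsClifford c) {ι : Type*} [Fintype ι]
    (b : OrthonormalBasis ι ℝ V) (T : ι → ι → H) :
    ∑ i, ∑ j, c (b i) (c (b j) (T i j))
      = (1 / 2 : ℂ) • ∑ i, ∑ j, c (b i) (c (b j) (T i j - T j i)) - ∑ i, T i i := by
  classical
  have h1 : ∑ i, ∑ j, c (b i) (c (b j) (T j i))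
      = - ∑ i, ∑ j, c (b i) (c (b j) (T i j)) - (2 : ℂ) • ∑ i, T i i := by
    have : ∀ i j, c (b i) (c (b j) (T j i))
        = - c (b j) (c (b i) (T j i)) - (if i = j then (2 : ℂ) • T i i else 0) := by
      intro i j
      rw [eq_sub_iff_add_eq, eq_neg_iff_add_eq_zero, add_right_comm, hc.anticomm,
        orthonormal_iff_ite.1 b.orthonormal i j]
      by_cases h : i = j
      · subst h; simp
      · simp [h]
    simp only [this, Finset.sum_sub_distrib, Finset.sum_neg_distrib, Finset.sum_ite_eq,
      Finset.mem_univ, if_true, ← Finset.smul_sum]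
    rw [Finset.sum_comm]
  simp only [map_sub, Finset.sum_sub_distrib]
  rw [h1]
  module

end CliffordAlgebra

/-! ### Dirac operators of local connections and their squares. -/

section LocalDirac

variable {n : ℕ} {M : Type*} [TopologicalSpace M]
  [ChartedSpace (EuclideanSpace ℝ (Fin (2 * n))) M] [IsManifold (𝓡 (2 * n)) ∞ M]
  [RiemannianBundle (fun x : M => TangentSpace (𝓡 (2 * n)) x)]
  {F : Type*} [NormedAddCommGroup F] [NormedSpace ℂ F]
  {E : M → Type*} [∀ x, NormedAddCommGroup (E x)] [∀ x, InnerProductSpace ℂ (E x)]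
  [TopologicalSpace (TotalSpace F E)] [FiberBundle F E] [VectorBundle ℂ F E]
  [VectorBundle ℝ F E]

/-- Clifford multiplication by tangent vectors. -/
def tangentClifford (A : CliffordAction n F E) (x : M) :
    TangentSpace (𝓡 (2 * n)) x →ₗ[ℝ] Module.End ℂ (E x) where
  toFun v := A.c x (flat v)
  map_add' v w := by simp only [flat, map_add]
  map_smul' r v := by simp only [flat, map_smul, RingHom.id_apply]

theorem tangentClifford_apply (A : CliffordAction n F E) (x : M) (v : TangentSpace (𝓡 (2 * n)) x) :
    tangentClifford A x v = A.c x (flat v) := rfl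

theorem isClifford_tangentClifford (A : CliffordAction n F E) (x : M) :
    IsClifford (tangentClifford A x) where
  sq v e := by
    simp only [tangentClifford_apply, A.c_sq]
    rw [show ‖(flat v : TangentSpace (𝓡 (2 * n)) x →L[ℝ] ℝ)‖ = ‖v‖ from innerSL_apply_norm ℝ v]
  skew v e e' := A.skew x _ e e'

/-- The Dirac operator of a connection. -/
def localDirac (A : CliffordAction n F E)
    (D : (∀ x : M, E x) → ∀ x : M, TangentSpace (𝓡 (2 * n)) x →ₗ[ℝ] E x) (s : ∀ x, E x) (x : M) :
    E x :=
  ∑ i, tangentClifford A x (stdOrthonormalBasis ℝ (TangentSpace (𝓡 (2 * n)) x) i)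
    (D s x (stdOrthonormalBasis ℝ (TangentSpace (𝓡 (2 * n)) x) i))

/-- The bilinear map `(v, w) ↦ c(v) T(w)`. -/
def cliffordBilin (A : CliffordAction n F E) (x : M) (T : TangentSpace (𝓡 (2 * n)) x →ₗ[ℝ] E x) :
    TangentSpace (𝓡 (2 * n)) x →ₗ[ℝ] TangentSpace (𝓡 (2 * n)) x →ₗ[ℝ] E x :=
  LinearMap.mk₂ ℝ (fun v w => tangentClifford A x v (T w)) (by simp) (by simp) (by simp)
    (fun r v w => by
      rw [map_smul, ← Complex.coe_smul, ← Complex.coe_smul, map_smul])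

theorem cliffordBilin_apply (A : CliffordAction n F E) (x : M)
    (T : TangentSpace (𝓡 (2 * n)) x →ₗ[ℝ] E x) (v w : TangentSpace (𝓡 (2 * n)) x) :
    cliffordBilin A x T v w = tangentClifford A x v (T w) := rfl

variable {A : CliffordAction n F E}
  {D : (∀ x : M, E x) → ∀ x : M, TangentSpace (𝓡 (2 * n)) x →ₗ[ℝ] E x} {U : Set M}

theorem localDirac_eq {ι : Type*} [Fintype ι] (s : ∀ x, E x) (x : M)
    (b : OrthonormalBasis ι ℝ (TangentSpace (𝓡 (2 * n)) x)) :
    localDirac A D s x = ∑ i, tangentClifford A x (b i) (D s x (b i)) :=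
  sum_orthonormalBasis_eq (cliffordBilin A x (D s x)) _ b

variable [T2Space M] [FiniteDimensional ℂ F] [ContMDiffVectorBundle ∞ F E (𝓡 (2 * n))]
  [IsContMDiffRiemannianBundle (𝓡 (2 * n)) ∞ (EuclideanSpace ℝ (Fin (2 * n)))
      (fun x : M => TangentSpace (𝓡 (2 * n)) x)]
  {nablaM : CovariantDerivative (𝓡 (2 * n)) (EuclideanSpace ℝ (Fin (2 * n)))
      (fun x : M => TangentSpace (𝓡 (2 * n)) x)}

theorem IsConnectionOn.smoothOn_localDirac (hD : IsConnectionOn F D U) {W : Set M} (hW : IsOpen W)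
    (hWU : W ⊆ U) {s : ∀ x, E x} (hs : SmoothOn n F s W) : SmoothOn n F (localDirac A D s) W := by
  refine smoothOn_of_locally fun x hx => ?_
  obtain ⟨O, X, B, hO, hxO, hX, hB⟩ := exists_tangent_orthonormal_frame (n := n) x
  refine ⟨fun y => ∑ i, tangentClifford A y (X i y) (D s y (X i y)), W ∩ O, hW.inter hO, ⟨hx, hxO⟩,
    ?_, fun y hy => ?_⟩
  · refine ContMDiffOn.sum_section fun i _ => ?_
    have h1 : SmoothField (X i) (W ∩ O) := (hX i).mono Set.inter_subset_right
    exact SmoothOn.clifford A (hW.inter hO) h1 (hD.smooth (hW.inter hO) (fun y hy => hWU hy.1)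
      (hs.mono Set.inter_subset_left) h1)
  · rw [localDirac_eq s y (B y hy.2)]
    simp only [hB]

/-- The connection `D` over `U` is compatible with Clifford multiplication. -/
def CliffordCompatible (nablaM : CovariantDerivative (𝓡 (2 * n)) (EuclideanSpace ℝ (Fin (2 * n)))
      (fun x : M => TangentSpace (𝓡 (2 * n)) x)) (A : CliffordAction n F E)
    (D : (∀ x : M, E x) → ∀ x : M, TangentSpace (𝓡 (2 * n)) x →ₗ[ℝ] E x) (U : Set M) : Prop :=
  ∀ {W : Set M} {Y : ∀ x : M, TangentSpace (𝓡 (2 * n)) x} {s : ∀ x, E x} {x : M}, IsOpen W →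
    W ⊆ U → SmoothField Y W → SmoothOn n F s W → x ∈ W → ∀ v,
    D (fun y => tangentClifford A y (Y y) (s y)) x v
      = tangentClifford A x (nablaM Y x v) (s x) + tangentClifford A x (Y x) (D s x v)

/-- The scalar products of the frame fields are constant, so the connection matrix is skew. -/
theorem inner_nablaM_frame (hM : IsLeviCivita nablaM) {W : Set M} (hW : IsOpen W)
    {X : Fin (2 * n) → ∀ x : M, TangentSpace (𝓡 (2 * n)) x} (hX : ∀ i, SmoothField (X i) W)
    (B : ∀ x ∈ W, OrthonormalBasis (Fin (2 * n)) ℝ (TangentSpace (𝓡 (2 * n)) x))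
    (hB : ∀ x hx i, B x hx i = X i x) {x : M} (hx : x ∈ W) (v : TangentSpace (𝓡 (2 * n)) x)
    (j k : Fin (2 * n)) :
    inner ℝ (nablaM (X j) x v) (X k x) = -inner ℝ (X j x) (nablaM (X k) x v) := by
  have h := hM.1 (X j) (X k) x ((hX j).diffAt hW hx) ((hX k).diffAt hW hx) v
  have h1 : mvfderiv (𝓡 (2 * n)) (fun y => inner ℝ (X j y) (X k y)) x v
      = mvfderiv (𝓡 (2 * n)) (fun _ => if j = k then (1 : ℝ) else 0) x v := by
    refine mvfderiv_congr (Filter.mem_of_superset (hW.mem_nhds hx) fun y hy => ?_) v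
    have := orthonormal_iff_ite.1 (B y hy).orthonormal j k
    simp only [hB] at this
    exact this
  have h2 : mvfderiv (𝓡 (2 * n)) (fun _ : M => if j = k then (1 : ℝ) else 0) x v = 0 := by
    simp [mvfderiv]
  rw [h1, h2] at h
  linarith

/-- Differentiating ∑ c(Xⱼ) D_{Xⱼ} s in an orthonormal frame gives ∑ c(bᵢ) c(Xⱼ) Hess(bᵢ, Xⱼ) plus
terms containing ∇Xⱼ. The latter cancel because the connection matrix is skew, so no frame parallel
at x is required. Clifford algebra then separates curvature from trace. -/
theorem localDirac_localDirac (hM : IsLeviCivita nablaM) (hD : IsConnectionOn F D U)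
    (hA : CliffordCompatible nablaM A D U) (hU : IsOpen U) {s : ∀ x, E x}
    (hs : SmoothOn n F s U) {x : M} (hx : x ∈ U) {ι : Type*} [Fintype ι]
    (b : OrthonormalBasis ι ℝ (TangentSpace (𝓡 (2 * n)) x)) :
    localDirac A D (localDirac A D s) x
      = (1 / 2 : ℂ) • ∑ i, ∑ j, tangentClifford A x (b i) (tangentClifford A x (b j)
          (hessian nablaM D s x (b i) (b j) - hessian nablaM D s x (b j) (b i)))
        - ∑ i, hessian nablaM D s x (b i) (b i) := by
  obtain ⟨O, X, B, hO, hxO, hX, hB⟩ := exists_tangent_orthonormal_frame (n := n) x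
  rw [← (isClifford_tangentClifford A x).sum_sum_apply b]
  have hin : ∀ i, ∑ j, tangentClifford A x (b i) (tangentClifford A x (b j)
      (hessian nablaM D s x (b i) (b j))) = tangentClifford A x (b i)
      (∑ j, cliffordBilin A x (hessian nablaM D s x (b i)) (X j x) (X j x)) := by
    intro i
    rw [← map_sum]
    have := sum_orthonormalBasis_eq (cliffordBilin A x (hessian nablaM D s x (b i))) b (B x hxO)
    simp only [hB] at this
    rw [← this]
    rfl
  rw [Finset.sum_congr rfl fun i _ => hin i, localDirac_eq _ x b]
  refine Finset.sum_congr rfl fun i _ => congrArg _ ?_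
  have hW := hU.inter hO
  have hWU : U ∩ O ⊆ U := Set.inter_subset_left
  have hX' : ∀ i, SmoothField (X i) (U ∩ O) := fun i => (hX i).mono Set.inter_subset_right
  have hs' : SmoothOn n F s (U ∩ O) := hs.mono hWU
  have hxW : x ∈ U ∩ O := ⟨hx, hxO⟩
  have h1 : ∀ i, SmoothOn n F (fun y => D s y (X i y)) (U ∩ O) := fun i =>
    hD.smooth hW hWU hs' (hX' i)
  have h2 : ∀ i ∈ Finset.univ, SmoothOn n F (fun y => tangentClifford A y (X i y) (D s y (X i y)))
      (U ∩ O) := fun i _ => SmoothOn.clifford A hW (hX' i) (h1 i)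
  rw [hD.congr hW hWU (ContMDiffOn.sum_section h2) (fun y hy => by
    rw [localDirac_eq s y (B y hy.2)]; simp only [hB]) hxW, hD.sum _ hW hWU h2 hxW,
    LinearMap.sum_apply]
  simp only [cliffordBilin_apply, hA hW hWU (hX' _) (h1 _) hxW,
    hessian_apply hD hW hWU hs' (hX' _) hxW, map_sub, Finset.sum_add_distrib,
    Finset.sum_sub_distrib]
  -- Both sides are expanded in the frame; exchanging the two summation indices brings in the
  -- skew-symmetry of ⟨X_k, ∇Xⱼ⟩.
  have h3 : ∑ j, tangentClifford A x (nablaM (X j) x (b i)) (D s x (X j x))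
      = - ∑ k, tangentClifford A x (X k x) (D s x (nablaM (X k) x (b i))) := by
    have hexp : ∀ w : TangentSpace (𝓡 (2 * n)) x, w = ∑ k, inner ℝ (X k x) w • X k x := fun w => by
      conv_lhs => rw [← (B x hxO).sum_repr' w]
      simp only [hB]
    have e1 : ∀ j, tangentClifford A x (nablaM (X j) x (b i)) (D s x (X j x))
        = ∑ k, inner ℝ (X k x) (nablaM (X j) x (b i)) • cliffordBilin A x (D s x) (X k x) (X j x) := by
      intro j
      rw [← cliffordBilin_apply]
      conv_lhs => rw [hexp (nablaM (X j) x (b i))]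
      simp
    have e2 : ∀ k, tangentClifford A x (X k x) (D s x (nablaM (X k) x (b i)))
        = ∑ j, inner ℝ (X j x) (nablaM (X k) x (b i)) • cliffordBilin A x (D s x) (X k x) (X j x) := by
      intro k
      rw [← cliffordBilin_apply]
      conv_lhs => rw [hexp (nablaM (X k) x (b i))]
      simp
    simp only [e1, e2]
    rw [Finset.sum_comm, ← Finset.sum_neg_distrib]
    refine Finset.sum_congr rfl fun k _ => ?_
    rw [← Finset.sum_neg_distrib]
    refine Finset.sum_congr rfl fun j _ => ?_
    rw [real_inner_comm, inner_nablaM_frame hM hO hX B hB hxO, neg_smul]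
  rw [h3]
  abel

/-- The connection `D` over `U` is compatible with the scalar product `h ⟨·, ·⟩`. -/
def MetricCompatible (h : M → ℝ)
    (D : (∀ x : M, E x) → ∀ x : M, TangentSpace (𝓡 (2 * n)) x →ₗ[ℝ] E x) (U : Set M) : Prop :=
  ∀ {W : Set M} {s t : ∀ x, E x} {x : M}, IsOpen W → W ⊆ U → SmoothOn n F s W →
    SmoothOn n F t W → x ∈ W → SmoothFun n (fun y => inner ℂ (s y) (t y) * h y) W ∧ ∀ v,
    mvfderiv (𝓡 (2 * n)) (fun y => inner ℂ (s y) (t y) * h y) x v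
      = (inner ℂ (D s x v) (t x) + inner ℂ (s x) (D t x v)) * h x

/-- Differentiate ⟨Z, w⟩ = Re(⟨D_w s, t⟩ h) with both metrics parallel. Its trace over v = w shows
that div Z is the real part of ⟨tr Hess s, t⟩ + ⟨Ds, Dt⟩, weighted by h: this is the integration by
parts behind ∇*∇. -/
theorem inner_nablaM_dual (hM : IsLeviCivita nablaM) (hD : IsConnectionOn F D U) {h : M → ℝ}
    (hh : MetricCompatible (F := F) h D U) (hU : IsOpen U) {s t : ∀ x, E x}
    (hs : SmoothOn n F s U) (ht : SmoothOn n F t U) {Z : ∀ x : M, TangentSpace (𝓡 (2 * n)) x}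
    (hZs : SmoothField Z U)
    (hZ : ∀ y ∈ U, ∀ w, inner ℝ (Z y) w = (inner ℂ (D s y w) (t y) * h y).re) {x : M} (hx : x ∈ U)
    (v w : TangentSpace (𝓡 (2 * n)) x) :
    inner ℝ (nablaM Z x v) w
      = ((inner ℂ (hessian nablaM D s x v w) (t x) + inner ℂ (D s x w) (D t x v)) * h x).re := by
  have hY : SmoothField (fieldExtension w) U := smoothField_fieldExtension w U
  have h1 := hM.1 Z (fieldExtension w) x (hZs.diffAt hU hx) (hY.diffAt hU hx) v
  have hsY := hD.smooth hU subset_rfl hs hY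
  obtain ⟨h2, h3⟩ := hh hU subset_rfl hsY ht hx
  have h4 : mvfderiv (𝓡 (2 * n)) (fun y => inner ℝ (Z y) (fieldExtension w y)) x v
      = Complex.reCLM (mvfderiv (𝓡 (2 * n))
        (fun y => inner ℂ (D s y (fieldExtension w y)) (t y) * h y) x v) := by
    rw [← mvfderiv_clm_comp (h2.diffAt hU hx)]
    exact mvfderiv_congr (Filter.mem_of_superset (hU.mem_nhds hx) fun y hy => hZ y hy _) v
  have h5 := hessian_apply (nablaM := nablaM) hD hU subset_rfl hs hY hx v
  rw [fieldExtension_self] at h1 h5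
  rw [h4, h3, fieldExtension_self, hZ x hx] at h1
  rw [h5, inner_sub_left, ← sub_eq_iff_eq_add.2 h1, Complex.reCLM_apply, ← Complex.sub_re]
  congr 1
  ring

end LocalDirac

/-! ### The curvature of a connection -/

section Curvature

variable {n : ℕ} {M : Type*} [TopologicalSpace M]
  [ChartedSpace (EuclideanSpace ℝ (Fin (2 * n))) M] [IsManifold (𝓡 (2 * n)) ∞ M]
  {F : Type*} [NormedAddCommGroup F] [NormedSpace ℂ F]
  {E : M → Type*} [∀ x, NormedAddCommGroup (E x)] [∀ x, InnerProductSpace ℂ (E x)]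
  [TopologicalSpace (TotalSpace F E)] [FiberBundle F E] [VectorBundle ℂ F E]
  [VectorBundle ℝ F E] [T2Space M]

theorem mvfderiv_complex_mlieBracket (hn : 0 < n) {V W : ∀ x : M, TangentSpace (𝓡 (2 * n)) x}
    {f : M → ℂ} {U : Set M} (hU : IsOpen U) (hV : SmoothField V U) (hW : SmoothField W U)
    (hf : SmoothFun n f U) {x : M} (hx : x ∈ U) :
    mvfderiv (𝓡 (2 * n)) f x (VectorField.mlieBracket (𝓡 (2 * n)) V W x)
      = mvfderiv (𝓡 (2 * n)) (fun y => mvfderiv (𝓡 (2 * n)) f y (W y)) x (V x)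
        - mvfderiv (𝓡 (2 * n)) (fun y => mvfderiv (𝓡 (2 * n)) f y (V y)) x (W x) := by
  have key : ∀ T : ℂ →L[ℝ] ℝ, T (mvfderiv (𝓡 (2 * n)) f x
      (VectorField.mlieBracket (𝓡 (2 * n)) V W x))
      = T (mvfderiv (𝓡 (2 * n)) (fun y => mvfderiv (𝓡 (2 * n)) f y (W y)) x (V x)
        - mvfderiv (𝓡 (2 * n)) (fun y => mvfderiv (𝓡 (2 * n)) f y (V y)) x (W x)) := by
    intro T
    have hT : SmoothFun n (fun y => T (f y)) U := T.contMDiff.comp_contMDiffOn hf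
    have h1 : ∀ {Y Z : ∀ x : M, TangentSpace (𝓡 (2 * n)) x}, SmoothField Z U →
        mvfderiv (𝓡 (2 * n)) (fun y => mvfderiv (𝓡 (2 * n)) (fun y => T (f y)) y (Z y)) x (Y x)
          = T (mvfderiv (𝓡 (2 * n)) (fun y => mvfderiv (𝓡 (2 * n)) f y (Z y)) x (Y x)) := by
      intro Y Z hZ
      rw [← mvfderiv_clm_comp ((hf.mvfderiv_apply hU hZ).diffAt hU hx)]
      exact mvfderiv_congr (Filter.mem_of_superset (hU.mem_nhds hx) fun y hy =>
        mvfderiv_clm_comp (hf.diffAt hU hy) T _) _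
    rw [← mvfderiv_clm_comp (hf.diffAt hU hx), mvfderiv_mlieBracket hn hU hV hW hT hx, h1 hW,
      h1 hV, map_sub]
  exact Complex.ext (key Complex.reCLM) (key Complex.imCLM)

section ConnectionOp

variable [FiniteDimensional ℂ F] [ContMDiffVectorBundle ∞ F E (𝓡 (2 * n))]
  {nabla : CovariantDerivative (𝓡 (2 * n)) F E}

/-- The covariant derivative as a family of linear maps. -/
def connectionOp (nabla : CovariantDerivative (𝓡 (2 * n)) F E) (s : ∀ x, E x) (x : M) :
    TangentSpace (𝓡 (2 * n)) x →ₗ[ℝ] E x := (nabla s x).toLinearMap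

theorem connectionOp_apply (s : ∀ x, E x) (x : M) (v : TangentSpace (𝓡 (2 * n)) x) :
    connectionOp nabla s x v = nabla s x v := rfl

theorem isConnectionOn_connectionOp (hsm : nabla.ContMDiffCovariantDerivative ∞) (U : Set M) :
    IsConnectionOn F (connectionOp nabla) U where
  smooth hW _ hs hX := SmoothOn.nabla_apply hsm hW hs hX
  congr hW _ hs h hx := by
    ext v
    simp only [connectionOp_apply]
    rw [nabla_congr nabla (hs.diffAt hW hx) (Filter.mem_of_superset (hW.mem_nhds hx) h)]
  add hW _ hs ht hx := by
    ext v
    simp only [connectionOp_apply, LinearMap.add_apply]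
    rw [nabla_add nabla (hs.diffAt hW hx) (ht.diffAt hW hx)]
    rfl
  smul hW _ hf hs hx v := nabla_real_smul nabla (hs.diffAt hW hx) (hf.diffAt hW hx) v

end ConnectionOp

variable (F) in
/-- The Leibniz rule for products with complex valued functions, over `U`. -/
def ComplexLeibniz (D : (∀ x : M, E x) → ∀ x : M, TangentSpace (𝓡 (2 * n)) x →ₗ[ℝ] E x)
    (U : Set M) : Prop :=
  ∀ {W : Set M} {f : M → ℂ} {s : ∀ x, E x} {x : M}, IsOpen W → W ⊆ U → SmoothFun n f W →
    SmoothOn n F s W → x ∈ W → ∀ v, D (fun y => f y • s y) x v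
      = f x • D s x v + mvfderiv (𝓡 (2 * n)) f x v • s x

variable [RiemannianBundle (fun x : M => TangentSpace (𝓡 (2 * n)) x)]
  [IsContMDiffRiemannianBundle (𝓡 (2 * n)) ∞ (EuclideanSpace ℝ (Fin (2 * n)))
      (fun x : M => TangentSpace (𝓡 (2 * n)) x)]
  {nablaM : CovariantDerivative (𝓡 (2 * n)) (EuclideanSpace ℝ (Fin (2 * n)))
      (fun x : M => TangentSpace (𝓡 (2 * n)) x)}
  {D : (∀ x : M, E x) → ∀ x : M, TangentSpace (𝓡 (2 * n)) x →ₗ[ℝ] E x} {U : Set M}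

variable (nablaM D) in
/-- The curvature of a connection, applied to a section. -/
def curvatureOp (s : ∀ x, E x) (x : M) :
    TangentSpace (𝓡 (2 * n)) x →ₗ[ℝ] TangentSpace (𝓡 (2 * n)) x →ₗ[ℝ] E x :=
  hessian nablaM D s x - (hessian nablaM D s x).flip

theorem curvatureOp_apply (s : ∀ x, E x) (x : M) (v w : TangentSpace (𝓡 (2 * n)) x) :
    curvatureOp nablaM D s x v w = hessian nablaM D s x v w - hessian nablaM D s x w v := rfl

theorem curvatureOp_fields (hM : IsLeviCivita nablaM) (hD : IsConnectionOn F D U) {W : Set M}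
    (hW : IsOpen W) (hWU : W ⊆ U) {s : ∀ x, E x} (hs : SmoothOn n F s W)
    {Y Z : ∀ x : M, TangentSpace (𝓡 (2 * n)) x}
    (hY : SmoothField Y W) (hZ : SmoothField Z W) {x : M} (hx : x ∈ W) :
    curvatureOp nablaM D s x (Y x) (Z x)
      = D (fun y => D s y (Z y)) x (Y x) - D (fun y => D s y (Y y)) x (Z x)
        - D s x (VectorField.mlieBracket (𝓡 (2 * n)) Y Z x) :=
  hessian_sub_swap hM hD hW hWU hs hY hZ hx

theorem curvatureOp_fields_smooth (hM : IsLeviCivita nablaM) (hD : IsConnectionOn F D U)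
    {W : Set M} (hW : IsOpen W) (hWU : W ⊆ U) {s : ∀ x, E x} (hs : SmoothOn n F s W)
    {Y Z : ∀ x : M, TangentSpace (𝓡 (2 * n)) x}
    (hY : SmoothField Y W) (hZ : SmoothField Z W) :
    SmoothOn n F (fun x => curvatureOp nablaM D s x (Y x) (Z x)) W := by
  refine SmoothOn.congr_eqOn ?_ fun x hx => curvatureOp_fields hM hD hW hWU hs hY hZ hx
  exact ContMDiffOn.sub_section (ContMDiffOn.sub_section
    (hD.smooth hW hWU (hD.smooth hW hWU hs hZ) hY) (hD.smooth hW hWU (hD.smooth hW hWU hs hY) hZ))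
    (hD.smooth hW hWU hs (SmoothOn.mlieBracket hW hY hZ))

theorem curvatureOp_sum (hM : IsLeviCivita nablaM) (hD : IsConnectionOn F D U) {W : Set M}
    (hW : IsOpen W) (hWU : W ⊆ U) {ι : Type*} (u : Finset ι) {s : ι → ∀ x, E x}
    (hs : ∀ i ∈ u, SmoothOn n F (s i) W) {t : ∀ x, E x} (ht : ∀ y ∈ W, t y = ∑ i ∈ u, s i y)
    {x : M} (hx : x ∈ W) (v w : TangentSpace (𝓡 (2 * n)) x) :
    curvatureOp nablaM D t x v w = ∑ i ∈ u, curvatureOp nablaM D (s i) x v w := by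
  have hsum : SmoothOn n F (fun y => ∑ i ∈ u, s i y) W := ContMDiffOn.sum_section hs
  have ht' : SmoothOn n F t W := hsum.congr_eqOn ht
  have hY := smoothField_fieldExtension v W
  have hZ := smoothField_fieldExtension w W
  have h1 : ∀ y ∈ W, D t y = ∑ i ∈ u, D (s i) y := fun y hy => by
    rw [hD.congr hW hWU hsum ht hy, hD.sum u hW hWU hs hy]
  have h2 : ∀ {Z : ∀ x : M, TangentSpace (𝓡 (2 * n)) x}, SmoothField Z W →
      D (fun y => D t y (Z y)) x = ∑ i ∈ u, D (fun y => D (s i) y (Z y)) x := by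
    intro Z hZ
    have h3 : ∀ i ∈ u, SmoothOn n F (fun y => D (s i) y (Z y)) W := fun i hi =>
      hD.smooth hW hWU (hs i hi) hZ
    rw [← hD.sum u hW hWU h3 hx]
    refine hD.congr hW hWU (ContMDiffOn.sum_section h3) (fun y hy => ?_) hx
    rw [h1 y hy, LinearMap.sum_apply]
  have key : ∀ t, SmoothOn n F t W → curvatureOp nablaM D t x v w = _ := fun t ht => by
    have := curvatureOp_fields hM hD hW hWU ht hY hZ hx
    simp only [fieldExtension_self] at this
    exact this
  rw [key t ht', Finset.sum_congr rfl fun i hi => key (s i) (hs i hi), h2 hY, h2 hZ, h1 x hx]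
  simp only [LinearMap.sum_apply, Finset.sum_sub_distrib]

/-- In the commutator the terms with one derivative of f and one of s are symmetric and cancel; the
second derivatives of f and the bracket term cancel by the commutator formula for functions. -/
theorem curvatureOp_smul (hn : 0 < n) (hM : IsLeviCivita nablaM) (hD : IsConnectionOn F D U)
    (hc : ComplexLeibniz F D U) {W : Set M}
    (hW : IsOpen W) (hWU : W ⊆ U) {f : M → ℂ} (hf : SmoothFun n f W) {s : ∀ x, E x}
    (hs : SmoothOn n F s W) {x : M} (hx : x ∈ W) (v w : TangentSpace (𝓡 (2 * n)) x) :
    curvatureOp nablaM D (fun y => f y • s y) x v w = f x • curvatureOp nablaM D s x v w := by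
  have hY := smoothField_fieldExtension v W
  have hZ := smoothField_fieldExtension w W
  have key : ∀ t, SmoothOn n F t W → curvatureOp nablaM D t x v w = _ := fun t ht => by
    have := curvatureOp_fields hM hD hW hWU ht hY hZ hx
    simp only [fieldExtension_self] at this
    exact this
  have h2 : ∀ {Z : ∀ x : M, TangentSpace (𝓡 (2 * n)) x}, SmoothField Z W → ∀ v,
      D (fun y => D (fun y => f y • s y) y (Z y)) x v
        = (f x • D (fun y => D s y (Z y)) x v + mvfderiv (𝓡 (2 * n)) f x v • D s x (Z x))
          + (mvfderiv (𝓡 (2 * n)) f x (Z x) • D s x v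
            + mvfderiv (𝓡 (2 * n)) (fun y => mvfderiv (𝓡 (2 * n)) f y (Z y)) x v • s x) := by
    intro Z hZ v
    have h3 := hD.smooth hW hWU hs hZ
    have h4 := hf.mvfderiv_apply hW hZ
    rw [hD.congr hW hWU (s := fun y => f y • D s y (Z y) + mvfderiv (𝓡 (2 * n)) f y (Z y) • s y)
      (ContMDiffOn.add_section (SmoothOn.complex_smul hf h3) (SmoothOn.complex_smul h4 hs))
      (fun y hy => hc hW hWU hf hs hy _) hx,
      hD.add hW hWU (SmoothOn.complex_smul hf h3) (SmoothOn.complex_smul h4 hs) hx,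
      LinearMap.add_apply, hc hW hWU hf h3 hx, hc hW hWU h4 hs hx]
  rw [key _ (SmoothOn.complex_smul hf hs), key s hs, h2 hY, h2 hZ, hc hW hWU hf hs hx]
  have h5 := mvfderiv_complex_mlieBracket hn hW hY hZ hf hx
  simp only [fieldExtension_self] at h5 ⊢
  rw [h5]
  module

/-- The bilinear map `T` contracted with Clifford multiplication in the second variable. -/
def cliffordContract (A : CliffordAction n F E) (x : M) {ι : Type*} [Fintype ι]
    (b : OrthonormalBasis ι ℝ (TangentSpace (𝓡 (2 * n)) x))
    (T : TangentSpace (𝓡 (2 * n)) x →ₗ[ℝ] TangentSpace (𝓡 (2 * n)) x →ₗ[ℝ] E x) :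
    TangentSpace (𝓡 (2 * n)) x →ₗ[ℝ] E x where
  toFun v := ∑ j, cliffordBilin A x (T v) (b j) (b j)
  map_add' v w := by simp [cliffordBilin_apply, Finset.sum_add_distrib]
  map_smul' r v := by
    simp only [cliffordBilin_apply, map_smul, LinearMap.smul_apply, Finset.smul_sum,
      RingHom.id_apply]
    refine Finset.sum_congr rfl fun i _ => ?_
    rw [← Complex.coe_smul, ← Complex.coe_smul, map_smul]

theorem sum_sum_clifford_contract (A : CliffordAction n F E) (x : M) {ι κ : Type*} [Fintype ι]
    [Fintype κ] (b : OrthonormalBasis ι ℝ (TangentSpace (𝓡 (2 * n)) x))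
    (b' : OrthonormalBasis κ ℝ (TangentSpace (𝓡 (2 * n)) x))
    (T : TangentSpace (𝓡 (2 * n)) x →ₗ[ℝ] TangentSpace (𝓡 (2 * n)) x →ₗ[ℝ] E x) :
    ∑ i, ∑ j, tangentClifford A x (b' i) (tangentClifford A x (b' j) (T (b' i) (b' j)))
      = ∑ i, cliffordBilin A x (cliffordContract A x b T) (b' i) (b' i) := by
  refine Finset.sum_congr rfl fun i _ => ?_
  rw [← map_sum, cliffordBilin_apply]
  exact congrArg _ (sum_orthonormalBasis_eq (cliffordBilin A x (T (b' i))) b' b)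

theorem sum_sum_clifford_eq (A : CliffordAction n F E) (x : M) {ι κ : Type*} [Fintype ι]
    [Fintype κ] (b : OrthonormalBasis ι ℝ (TangentSpace (𝓡 (2 * n)) x))
    (b' : OrthonormalBasis κ ℝ (TangentSpace (𝓡 (2 * n)) x))
    (T : TangentSpace (𝓡 (2 * n)) x →ₗ[ℝ] TangentSpace (𝓡 (2 * n)) x →ₗ[ℝ] E x) :
    ∑ i, ∑ j, tangentClifford A x (b i) (tangentClifford A x (b j) (T (b i) (b j)))
      = ∑ i, ∑ j, tangentClifford A x (b' i) (tangentClifford A x (b' j) (T (b' i) (b' j))) := by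
  rw [sum_sum_clifford_contract A x b b, sum_sum_clifford_contract A x b b']
  exact sum_orthonormalBasis_eq _ b b'

variable (nablaM D) in
/-- The curvature term `½ ∑ c(eᵢ) c(eⱼ) R(eᵢ, eⱼ)` of the Weitzenböck formula. -/
def weitzenbock (A : CliffordAction n F E) (s : ∀ x, E x) (x : M) : E x :=
  (1 / 2 : ℂ) • ∑ i, ∑ j,
    tangentClifford A x (stdOrthonormalBasis ℝ (TangentSpace (𝓡 (2 * n)) x) i)
      (tangentClifford A x (stdOrthonormalBasis ℝ (TangentSpace (𝓡 (2 * n)) x) j)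
        (curvatureOp nablaM D s x (stdOrthonormalBasis ℝ (TangentSpace (𝓡 (2 * n)) x) i)
          (stdOrthonormalBasis ℝ (TangentSpace (𝓡 (2 * n)) x) j)))

variable {A : CliffordAction n F E}

theorem weitzenbock_eq (s : ∀ x, E x) (x : M) {ι : Type*} [Fintype ι]
    (b : OrthonormalBasis ι ℝ (TangentSpace (𝓡 (2 * n)) x)) :
    weitzenbock nablaM D A s x = (1 / 2 : ℂ) • ∑ i, ∑ j,
      tangentClifford A x (b i) (tangentClifford A x (b j) (curvatureOp nablaM D s x (b i) (b j))) := by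
  rw [weitzenbock, sum_sum_clifford_eq A x _ b]

variable [FiniteDimensional ℂ F] [ContMDiffVectorBundle ∞ F E (𝓡 (2 * n))]

theorem smoothOn_weitzenbock (hM : IsLeviCivita nablaM) (hD : IsConnectionOn F D U) {W : Set M}
    (hW : IsOpen W) (hWU : W ⊆ U) {s : ∀ x, E x} (hs : SmoothOn n F s W) :
    SmoothOn n F (weitzenbock nablaM D A s) W := by
  refine smoothOn_of_locally fun x hx => ?_
  obtain ⟨O, X, B, hO, hxO, hX, hB⟩ := exists_tangent_orthonormal_frame (n := n) x
  refine ⟨fun y => (1 / 2 : ℂ) • ∑ i, ∑ j, tangentClifford A y (X i y)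
    (tangentClifford A y (X j y) (curvatureOp nablaM D s y (X i y) (X j y))), W ∩ O, hW.inter hO,
    ⟨hx, hxO⟩, ?_, fun y hy => ?_⟩
  · have hX' : ∀ i, SmoothField (X i) (W ∩ O) := fun i => (hX i).mono Set.inter_subset_right
    refine SmoothOn.complex_const_smul _ (ContMDiffOn.sum_section fun i _ =>
      ContMDiffOn.sum_section fun j _ => ?_)
    exact SmoothOn.clifford A (hW.inter hO) (hX' i) (SmoothOn.clifford A (hW.inter hO) (hX' j)
      (curvatureOp_fields_smooth hM hD (hW.inter hO) (fun y hy => hWU hy.1)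
        (hs.mono Set.inter_subset_left) (hX' i) (hX' j)))
  · rw [weitzenbock_eq s y (B y hy.2)]
    simp only [hB]

theorem weitzenbock_sum_smul (hn : 0 < n) (hM : IsLeviCivita nablaM) (hD : IsConnectionOn F D U)
    (hc : ComplexLeibniz F D U) {W : Set M} (hW : IsOpen W) (hWU : W ⊆ U) {ι : Type*}
    (u : Finset ι) {f : ι → M → ℝ} (hf : ∀ i ∈ u, SmoothFun n (f i) W) {s : ι → ∀ x, E x}
    (hs : ∀ i ∈ u, SmoothOn n F (s i) W) {t : ∀ x, E x}
    (ht : ∀ y ∈ W, t y = ∑ i ∈ u, f i y • s i y) {x : M} (hx : x ∈ W) :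
    weitzenbock nablaM D A t x = ∑ i ∈ u, f i x • weitzenbock nablaM D A (s i) x := by
  have h1 : ∀ v w, curvatureOp nablaM D t x v w
      = ∑ i ∈ u, (f i x : ℂ) • curvatureOp nablaM D (s i) x v w := fun v w => by
    rw [curvatureOp_sum hM hD hW hWU u (s := fun i y => (f i y : ℂ) • s i y)
      (fun i hi => SmoothOn.complex_smul (hf i hi).ofReal (hs i hi))
      (fun y hy => by simpa using ht y hy) hx]
    exact Finset.sum_congr rfl fun i hi =>
      curvatureOp_smul hn hM hD hc hW hWU (hf i hi).ofReal (hs i hi) hx v w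
  simp only [weitzenbock, h1, map_sum, map_smul]
  simp only [← Complex.coe_smul (f _ x), Finset.smul_sum]
  conv_rhs => rw [Finset.sum_comm]
  refine Finset.sum_congr rfl fun i _ => ?_
  conv_rhs => rw [Finset.sum_comm]
  refine Finset.sum_congr rfl fun j _ => Finset.sum_congr rfl fun k _ => ?_
  rw [smul_comm]

/-- The curvature term is linear over functions, so in a local orthonormal frame of E it is
controlled by its values on the frame. These are smooth, hence their norms are bounded near x₀, by a
constant independent of s. -/
theorem exists_weitzenbock_bound (hn : 0 < n) (hM : IsLeviCivita nablaM)
    (hE : IsSmoothHermitian n F E) (hU : IsOpen U) (hD : IsConnectionOn F D U)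
    (hc : ComplexLeibniz F D U) {x₀ : M} (hx₀ : x₀ ∈ U) :
    ∃ (O : Set M) (C : ℝ), IsOpen O ∧ x₀ ∈ O ∧ ∀ (W : Set M) (s : ∀ x, E x) (x : M), IsOpen W →
      W ⊆ U → SmoothOn n F s W → x ∈ W → x ∈ O → ‖weitzenbock nablaM D A s x‖ ≤ C * ‖s x‖ := by
  have : FiniteDimensional ℝ F := FiniteDimensional.complexToReal F
  -- The fibres are regarded as real Euclidean spaces, so that the real Gram–Schmidt frames apply.
  let _ : ∀ x, InnerProductSpace ℝ (E x) := fun x => InnerProductSpace.complexToReal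
  have hreal : ∀ (U : Set M) (s t : ∀ x, E x), IsOpen U → SmoothOn n F s U → SmoothOn n F t U →
      SmoothFun n (fun x => inner ℝ (s x) (t x)) U := fun U s t hU hs ht =>
    (SmoothFun.inner_section hE hU hs ht).re
  obtain ⟨O, X, B, hO, hxO, hX, hB⟩ := exists_orthonormal_frame (n := n) (F := F) (V := E)
    (Module.finBasis ℝ F) hreal x₀
  have hX' : ∀ i, SmoothOn n F (X i) (O ∩ U) := fun i => (hX i).mono Set.inter_subset_left
  have hw : ∀ i, SmoothOn n F (weitzenbock nablaM D A (X i)) (O ∩ U) := fun i =>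
    smoothOn_weitzenbock hM hD (hO.inter hU) Set.inter_subset_right (hX' i)
  have hcont : ContinuousAt (fun y => ∑ i, √(inner ℝ (weitzenbock nablaM D A (X i) y)
      (weitzenbock nablaM D A (X i) y))) x₀ := by
    refine tendsto_finsetSum _ fun i _ => ?_
    exact (((hreal _ _ _ (hO.inter hU) (hw i) (hw i)).continuousOn).continuousAt
      ((hO.inter hU).mem_nhds ⟨hxO, hx₀⟩)).sqrt
  obtain ⟨C, hC⟩ := exists_gt (∑ i, √(inner ℝ (weitzenbock nablaM D A (X i) x₀)
      (weitzenbock nablaM D A (X i) x₀)))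
  obtain ⟨O', hO'1, hO', hxO'⟩ := eventually_nhds_iff.1 (hcont.eventually (gt_mem_nhds hC))
  refine ⟨O' ∩ O, C, hO'.inter hO, ⟨hxO', hxO⟩, fun W s x hW hWU hs hx hxO => ?_⟩
  have h1 := weitzenbock_sum_smul (A := A) hn hM hD hc (hW.inter hO) (fun y hy => hWU hy.1)
    Finset.univ (f := fun i y => inner ℝ (X i y) (s y)) (s := X) (t := s)
    (fun i _ => hreal _ _ _ (hW.inter hO) ((hX i).mono Set.inter_subset_right)
      (hs.mono Set.inter_subset_left)) (fun i _ => (hX i).mono Set.inter_subset_right)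
    (fun y hy => by
      conv_lhs => rw [← (B y hy.2).sum_repr' (s y)]
      simp only [hB]) (x := x) ⟨hx, hxO.2⟩
  rw [h1]
  have h2 : ∀ i, ‖X i x‖ = 1 := fun i => by
    rw [← hB x hxO.2 i]
    exact (B x hxO.2).norm_eq_one i
  calc ‖∑ i, inner ℝ (X i x) (s x) • weitzenbock nablaM D A (X i) x‖
      ≤ ∑ i, ‖s x‖ * √(inner ℝ (weitzenbock nablaM D A (X i) x)
          (weitzenbock nablaM D A (X i) x)) := by
        refine (norm_sum_le _ _).trans (Finset.sum_le_sum fun i _ => ?_)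
        rw [norm_smul, real_inner_self_eq_norm_sq, Real.sqrt_sq (norm_nonneg _)]
        gcongr
        refine (norm_inner_le_norm _ _).trans ?_
        rw [h2, one_mul]
    _ ≤ _ := by
        rw [← Finset.mul_sum, mul_comm]
        exact mul_le_mul_of_nonneg_right (hO'1 x hxO.1).le (norm_nonneg _)

end Curvature

/-! ### Products, inverses and powers of smooth complex functions. -/

section ComplexFunctions

variable {n : ℕ} {M : Type*} [TopologicalSpace M]
  [ChartedSpace (EuclideanSpace ℝ (Fin (2 * n))) M]

theorem SmoothFun.complex_mul {f g : M → ℂ} {U : Set M} (hf : SmoothFun n f U)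
    (hg : SmoothFun n g U) : SmoothFun n (fun x => f x * g x) U :=
  ((ContinuousLinearMap.mul ℝ ℂ).contMDiff.comp_contMDiffOn hf).clm_apply hg

theorem SmoothFun.complex_inv {f : M → ℂ} {U : Set M} (hf : SmoothFun n f U)
    (h0 : ∀ x ∈ U, f x ≠ 0) : SmoothFun n (fun x => (f x)⁻¹) U := fun x hx =>
  (contDiffAt_inv ℝ (h0 x hx)).contMDiffAt.comp_contMDiffWithinAt x (hf x hx)

theorem SmoothFun.complex_pow {f : M → ℂ} {U : Set M} (hf : SmoothFun n f U) (k : ℕ) :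
    SmoothFun n (fun x => f x ^ k) U := by
  induction k with
  | zero => simpa using contMDiffOn_const
  | succ k ih => simpa only [pow_succ] using ih.complex_mul hf

theorem mdifferentiableAt_bilin {G G' G'' : Type*} [NormedAddCommGroup G] [NormedSpace ℝ G]
    [NormedAddCommGroup G'] [NormedSpace ℝ G'] [NormedAddCommGroup G''] [NormedSpace ℝ G'']
    {f : M → G} {g : M → G'} {x : M} (B : G →L[ℝ] G' →L[ℝ] G'')
    (hf : MDifferentiableAt (𝓡 (2 * n)) 𝓘(ℝ, G) f x)
    (hg : MDifferentiableAt (𝓡 (2 * n)) 𝓘(ℝ, G') g x) :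
    MDifferentiableAt (𝓡 (2 * n)) 𝓘(ℝ, G'') (fun y => B (f y) (g y)) x :=
  MDifferentiableAt.clm_apply ((B.contMDiff.mdifferentiable (n := 1) (by simp) _).comp x hf) hg

end ComplexFunctions

/-! ### Adding a one-form to a connection -/

section TwistedOp

variable {n : ℕ} {M : Type*} [TopologicalSpace M]
  [ChartedSpace (EuclideanSpace ℝ (Fin (2 * n))) M] [IsManifold (𝓡 (2 * n)) ∞ M]
  {F : Type*} [NormedAddCommGroup F] [NormedSpace ℂ F]
  {E : M → Type*} [∀ x, NormedAddCommGroup (E x)] [∀ x, InnerProductSpace ℂ (E x)]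
  [TopologicalSpace (TotalSpace F E)] [FiberBundle F E] [VectorBundle ℂ F E]
  [VectorBundle ℝ F E]

/-- The complex valued one-form `ψ` is smooth on `U`. -/
def SmoothForm (ψ : ∀ x : M, TangentSpace (𝓡 (2 * n)) x →ₗ[ℝ] ℂ) (U : Set M) : Prop :=
  ∀ {W : Set M} {X : ∀ x : M, TangentSpace (𝓡 (2 * n)) x}, IsOpen W → W ⊆ U → SmoothField X W →
    SmoothFun n (fun x => ψ x (X x)) W

/-- The connection `D + ψ`. -/
def twistedOp (D : (∀ x : M, E x) → ∀ x : M, TangentSpace (𝓡 (2 * n)) x →ₗ[ℝ] E x)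
    (ψ : ∀ x : M, TangentSpace (𝓡 (2 * n)) x →ₗ[ℝ] ℂ) (s : ∀ x, E x) (x : M) :
    TangentSpace (𝓡 (2 * n)) x →ₗ[ℝ] E x :=
  D s x + (ψ x).smulRight (s x)

/-- The exterior derivative of a one-form, evaluated on two vector fields. -/
def formDeriv (ψ : ∀ x : M, TangentSpace (𝓡 (2 * n)) x →ₗ[ℝ] ℂ)
    (Y Z : ∀ x : M, TangentSpace (𝓡 (2 * n)) x) (x : M) : ℂ :=
  mvfderiv (𝓡 (2 * n)) (fun y => ψ y (Z y)) x (Y x)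
    - mvfderiv (𝓡 (2 * n)) (fun y => ψ y (Y y)) x (Z x)
    - ψ x (VectorField.mlieBracket (𝓡 (2 * n)) Y Z x)

variable {D : (∀ x : M, E x) → ∀ x : M, TangentSpace (𝓡 (2 * n)) x →ₗ[ℝ] E x} {U : Set M}
  {ψ : ∀ x : M, TangentSpace (𝓡 (2 * n)) x →ₗ[ℝ] ℂ}

theorem twistedOp_apply (s : ∀ x, E x) (x : M) (v : TangentSpace (𝓡 (2 * n)) x) :
    twistedOp D ψ s x v = D s x v + ψ x v • s x := rfl

theorem isConnectionOn_twistedOp (hD : IsConnectionOn F D U) (hψ : SmoothForm ψ U) :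
    IsConnectionOn F (twistedOp D ψ) U where
  smooth hW hWU hs hX := ContMDiffOn.add_section (hD.smooth hW hWU hs hX)
    (SmoothOn.complex_smul (hψ hW hWU hX) hs)
  congr hW hWU hs h hx := by
    ext v
    simp only [twistedOp_apply]
    rw [hD.congr hW hWU hs h hx, h _ hx]
  add hW hWU hs ht hx := by
    ext v
    simp only [twistedOp_apply, LinearMap.add_apply]
    rw [hD.add hW hWU hs ht hx, LinearMap.add_apply]
    module
  smul {W f s x} hW hWU hf hs hx v := by
    simp only [twistedOp_apply]
    rw [hD.smul hW hWU hf hs hx]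
    simp only [← Complex.coe_smul (f x)]
    module

variable [RiemannianBundle (fun x : M => TangentSpace (𝓡 (2 * n)) x)]
  {nablaM : CovariantDerivative (𝓡 (2 * n)) (EuclideanSpace ℝ (Fin (2 * n)))
      (fun x : M => TangentSpace (𝓡 (2 * n)) x)}

theorem cliffordCompatible_twistedOp {A : CliffordAction n F E}
    (hA : CliffordCompatible nablaM A D U) : CliffordCompatible nablaM A (twistedOp D ψ) U := by
  intro W Y s x hW hWU hY hs hx v
  simp only [twistedOp_apply]
  rw [hA hW hWU hY hs hx, map_add, map_smul]
  abel

/-- Adding ψ to D adds 2 Re ψ · ⟨s, t⟩ to the right side of the metric rule, which is exactly what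
the logarithmic derivative of h provides. The frame of L therefore need not be unitary. -/
theorem metricCompatible_twistedOp {h : M → ℝ} (hU : IsOpen U)
    (h1 : MetricCompatible (F := F) (fun _ => 1) D U) (hh : SmoothFun n h U)
    (hdh : ∀ x ∈ U, ∀ v, mvfderiv (𝓡 (2 * n)) h x v = 2 * (ψ x v).re * h x) :
    MetricCompatible (F := F) h (twistedOp D ψ) U := by
  intro W s t x hW hWU hs ht hx
  obtain ⟨h2, h3⟩ := h1 hW hWU hs ht hx
  simp only [Complex.ofReal_one, mul_one] at h2 h3
  have hhW : SmoothFun n (fun y => (h y : ℂ)) W := (SmoothFun.ofReal hh).mono hWU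
  refine ⟨h2.complex_mul hhW, fun v => ?_⟩
  rw [mvfderiv_complex_mul (h2.diffAt hW hx) (hhW.diffAt hW hx), h3 v]
  have h4 := mvfderiv_clm_comp (hh.diffAt hU (hWU hx)) Complex.ofRealCLM v
  simp only [Complex.ofRealCLM_apply] at h4
  rw [h4, hdh x (hWU hx)]
  simp only [twistedOp_apply, inner_add_left, inner_add_right, inner_smul_left, inner_smul_right]
  have h5 := Complex.add_conj (ψ x v)
  push_cast at h5 ⊢
  linear_combination -inner ℂ (s x) (t x) * h x * h5

variable [T2Space M]
  [IsContMDiffRiemannianBundle (𝓡 (2 * n)) ∞ (EuclideanSpace ℝ (Fin (2 * n)))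
      (fun x : M => TangentSpace (𝓡 (2 * n)) x)]

/-- The products of two values of ψ, and those of ψ with Ds, are symmetric in Y and Z and drop out;
only dψ is left. -/
theorem curvatureOp_twistedOp (hM : IsLeviCivita nablaM) (hD : IsConnectionOn F D U)
    (hc : ComplexLeibniz F D U) (hψ : SmoothForm ψ U) {W : Set M} (hW : IsOpen W) (hWU : W ⊆ U)
    {s : ∀ x, E x} (hs : SmoothOn n F s W) {Y Z : ∀ x : M, TangentSpace (𝓡 (2 * n)) x}
    (hY : SmoothField Y W) (hZ : SmoothField Z W) {x : M} (hx : x ∈ W) :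
    curvatureOp nablaM (twistedOp D ψ) s x (Y x) (Z x)
      = curvatureOp nablaM D s x (Y x) (Z x) + formDeriv ψ Y Z x • s x := by
  rw [curvatureOp_fields hM (isConnectionOn_twistedOp hD hψ) hW hWU hs hY hZ hx,
    curvatureOp_fields hM hD hW hWU hs hY hZ hx]
  have h1 : ∀ {Z : ∀ x : M, TangentSpace (𝓡 (2 * n)) x}, SmoothField Z W → ∀ v,
      twistedOp D ψ (fun y => twistedOp D ψ s y (Z y)) x v = D (fun y => D s y (Z y)) x v
        + (ψ x (Z x) • D s x v + mvfderiv (𝓡 (2 * n)) (fun y => ψ y (Z y)) x v • s x)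
        + ψ x v • (D s x (Z x) + ψ x (Z x) • s x) := by
    intro Z hZ v
    have h2 := hD.smooth hW hWU hs hZ
    have h3 := hψ hW hWU hZ
    simp only [twistedOp_apply]
    rw [hD.add hW hWU h2 (SmoothOn.complex_smul h3 hs) hx, LinearMap.add_apply,
      hc hW hWU h3 hs hx]
  rw [h1 hY, h1 hZ, twistedOp_apply, formDeriv]
  module

end TwistedOp

/-! ### Line bundles -/

theorem smoothOn_trivialization_symm {n : ℕ} {M : Type*} [TopologicalSpace M]
    [ChartedSpace (EuclideanSpace ℝ (Fin (2 * n))) M]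
    {F : Type*} [NormedAddCommGroup F] [NormedSpace ℝ F]
    {V : M → Type*} [TopologicalSpace (TotalSpace F V)]
    [∀ x, AddCommGroup (V x)] [∀ x, Module ℝ (V x)] [∀ x : M, TopologicalSpace (V x)]
    [FiberBundle F V] [VectorBundle ℝ F V] [ContMDiffVectorBundle ∞ F V (𝓡 (2 * n))] (x₀ : M)
    (w : F) :
    SmoothOn n F (fun y => (trivializationAt F V x₀).symm y w)
      (trivializationAt F V x₀).baseSet := by
  rw [SmoothOn, (trivializationAt F V x₀).contMDiffOn_section_baseSet_iff]
  refine (contMDiffOn_const (c := w)).congr fun y hy => ?_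
  rw [(trivializationAt F V x₀).apply_mk_symm hy]

section LineBundle

variable {n : ℕ} {M : Type*} [TopologicalSpace M]
  [ChartedSpace (EuclideanSpace ℝ (Fin (2 * n))) M] [IsManifold (𝓡 (2 * n)) ∞ M] [T2Space M]
  {L : M → Type*} [∀ x, NormedAddCommGroup (L x)] [∀ x, InnerProductSpace ℂ (L x)]
  [TopologicalSpace (TotalSpace ℂ L)] [FiberBundle ℂ L] [VectorBundle ℂ ℂ L]

theorem lineCoord_smul_lineFrame_of_mem {x₀ y : M} (hy : y ∈ (trivializationAt ℂ L x₀).baseSet)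
    (l : L y) : lineCoord L x₀ y l • lineFrame L x₀ y = l := by
  rw [lineCoord, lineFrame, ← map_smul, smul_eq_mul, mul_one,
    Trivialization.symmₗ_linearMapAt _ hy]

theorem lineCoord_lineFrame {x₀ y : M} (hy : y ∈ (trivializationAt ℂ L x₀).baseSet) :
    lineCoord L x₀ y (lineFrame L x₀ y) = 1 := by
  rw [lineCoord, lineFrame, Trivialization.linearMapAt_symmₗ _ hy]

theorem lineFrame_ne_zero {x₀ y : M} (hy : y ∈ (trivializationAt ℂ L x₀).baseSet) :
    lineFrame L x₀ y ≠ 0 := fun h => by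
  have := lineCoord_lineFrame (L := L) hy
  rw [h, map_zero] at this
  exact zero_ne_one this

/-- This expresses the coordinate by the metric, so that its smoothness follows from that of the
Hermitian scalar product. -/
theorem lineCoord_eq_inner_div {x₀ y : M} (hy : y ∈ (trivializationAt ℂ L x₀).baseSet) (l : L y) :
    lineCoord L x₀ y l = inner ℂ (lineFrame L x₀ y) l
      / inner ℂ (lineFrame L x₀ y) (lineFrame L x₀ y) := by
  have h0 : inner ℂ (lineFrame L x₀ y) (lineFrame L x₀ y) ≠ 0 := by
    rw [Ne, inner_self_eq_zero]; exact lineFrame_ne_zero hy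
  rw [eq_div_iff h0]
  conv_rhs => rw [← lineCoord_smul_lineFrame_of_mem hy l, inner_smul_right]

variable [VectorBundle ℝ ℂ L] [ContMDiffVectorBundle ∞ ℂ L (𝓡 (2 * n))]

theorem smoothOn_lineFrame (x₀ : M) :
    SmoothOn n ℂ (lineFrame L x₀) (trivializationAt ℂ L x₀).baseSet :=
  (smoothOn_trivialization_symm x₀ 1).congr_eqOn fun y hy => by
    rw [lineFrame, Trivialization.symmₗ_apply _ hy]

theorem smoothFun_lineCoord (hL : IsSmoothHermitian n ℂ L) {x₀ : M} {W : Set M} (hW : IsOpen W)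
    (hWU : W ⊆ (trivializationAt ℂ L x₀).baseSet) {s : ∀ x, L x} (hs : SmoothOn n ℂ s W) :
    SmoothFun n (fun y => lineCoord L x₀ y (s y)) W := by
  have h1 := (smoothOn_lineFrame (n := n) (L := L) x₀).mono hWU
  refine ((SmoothFun.inner_section hL hW h1 hs).complex_mul
    ((SmoothFun.inner_section hL hW h1 h1).complex_inv fun y hy => ?_)).congr fun y hy =>
      lineCoord_eq_inner_div (hWU hy) _
  rw [inner_self_ne_zero]
  exact lineFrame_ne_zero (hWU hy)

variable {nablaL : CovariantDerivative (𝓡 (2 * n)) ℂ L}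

variable (nablaL) in
/-- The connection form `θ` in the gauge `lineFrame L x₀`. -/
def connectionForm (x₀ y : M) : TangentSpace (𝓡 (2 * n)) y →ₗ[ℝ] ℂ :=
  (lineCoord L x₀ y).restrictScalars ℝ ∘ₗ connectionOp nablaL (lineFrame L x₀) y

theorem nabla_lineFrame {x₀ y : M} (hy : y ∈ (trivializationAt ℂ L x₀).baseSet)
    (v : TangentSpace (𝓡 (2 * n)) y) :
    nablaL (lineFrame L x₀) y v = connectionForm nablaL x₀ y v • lineFrame L x₀ y :=
  (lineCoord_smul_lineFrame_of_mem hy _).symm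

theorem smoothForm_connectionForm (hL : IsSmoothHermitian n ℂ L)
    (hLs : nablaL.ContMDiffCovariantDerivative ∞) (x₀ : M) :
    SmoothForm (connectionForm nablaL x₀) (trivializationAt ℂ L x₀).baseSet := by
  intro W X hW hWU hX
  exact smoothFun_lineCoord hL hW hWU
    (SmoothOn.nabla_apply hLs hW ((smoothOn_lineFrame x₀).mono hWU) hX)

theorem complexLeibniz_connectionOp {F : Type*} [NormedAddCommGroup F] [NormedSpace ℂ F]
    {E : M → Type*} [∀ x, NormedAddCommGroup (E x)] [∀ x, InnerProductSpace ℂ (E x)]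
    [TopologicalSpace (TotalSpace F E)] [FiberBundle F E] [VectorBundle ℂ F E]
    [VectorBundle ℝ F E] [FiniteDimensional ℂ F] [ContMDiffVectorBundle ∞ F E (𝓡 (2 * n))]
    {nabla : CovariantDerivative (𝓡 (2 * n)) F E} (hE : IsSmoothHermitian n F E)
    (hherm : IsHermitianConnection nabla) (U : Set M) :
    ComplexLeibniz F (connectionOp nabla) U := fun hW _ hf hs hx v =>
  nabla_complex_smul hherm hE hW hf hs hx v

theorem mvfderiv_real_pow {f : M → ℝ} {x : M} (hf : MDifferentiableAt (𝓡 (2 * n)) 𝓘(ℝ, ℝ) f x)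
    {v : TangentSpace (𝓡 (2 * n)) x} {a : ℝ} (h : mvfderiv (𝓡 (2 * n)) f x v = a * f x) (k : ℕ) :
    MDifferentiableAt (𝓡 (2 * n)) 𝓘(ℝ, ℝ) (fun y => f y ^ k) x ∧
    mvfderiv (𝓡 (2 * n)) (fun y => f y ^ k) x v = k * a * f x ^ k := by
  induction k with
  | zero => exact ⟨by simpa using mdifferentiableAt_const, by simp only [pow_zero]; simp [mvfderiv]⟩
  | succ k ih =>
    simp only [pow_succ]
    refine ⟨mdifferentiableAt_bilin (ContinuousLinearMap.mul ℝ ℝ) ih.1 hf, ?_⟩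
    rw [mvfderiv_real_mul ih.1 hf, ih.2, h]
    push_cast
    ring

theorem mvfderiv_complex_pow {f : M → ℂ} {x : M} (hf : MDifferentiableAt (𝓡 (2 * n)) 𝓘(ℝ, ℂ) f x)
    {v : TangentSpace (𝓡 (2 * n)) x} {a : ℂ} (h : mvfderiv (𝓡 (2 * n)) f x v = a * f x) (k : ℕ) :
    MDifferentiableAt (𝓡 (2 * n)) 𝓘(ℝ, ℂ) (fun y => f y ^ k) x ∧
    mvfderiv (𝓡 (2 * n)) (fun y => f y ^ k) x v = k * a * f x ^ k := by
  induction k with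
  | zero => exact ⟨by simpa using mdifferentiableAt_const, by simp only [pow_zero]; simp [mvfderiv]⟩
  | succ k ih =>
    simp only [pow_succ]
    refine ⟨mdifferentiableAt_bilin (ContinuousLinearMap.mul ℝ ℂ) ih.1 hf, ?_⟩
    rw [mvfderiv_complex_mul ih.1 hf, ih.2, h]
    push_cast
    ring

/-- The weight `|ℓ|^{2k}`, where `ℓ` is `lineFrame L x₀`. -/
def lineWeight (L : M → Type*) [∀ x, NormedAddCommGroup (L x)] [∀ x, InnerProductSpace ℂ (L x)]
    [TopologicalSpace (TotalSpace ℂ L)] [FiberBundle ℂ L] [VectorBundle ℂ ℂ L] (k : ℕ) (x₀ y : M) :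
    ℝ := ‖lineFrame L x₀ y‖ ^ (2 * k)

theorem lineWeight_eq (k : ℕ) (x₀ y : M) :
    lineWeight L k x₀ y = (inner ℂ (lineFrame L x₀ y) (lineFrame L x₀ y)).re ^ k := by
  have := norm_sq_eq_re_inner (𝕜 := ℂ) (lineFrame L x₀ y)
  rw [RCLike.re_eq_complex_re] at this
  rw [lineWeight, pow_mul, this]

theorem lineWeight_pos (k : ℕ) {x₀ y : M} (hy : y ∈ (trivializationAt ℂ L x₀).baseSet) :
    0 < lineWeight L k x₀ y := pow_pos (norm_pos_iff.2 (lineFrame_ne_zero hy)) _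

theorem smoothFun_lineWeight (hL : IsSmoothHermitian n ℂ L) (k : ℕ) (x₀ : M) :
    SmoothFun n (lineWeight L k x₀) (trivializationAt ℂ L x₀).baseSet := by
  have h1 := smoothOn_lineFrame (n := n) (L := L) x₀
  have h2 : SmoothFun n (fun y => (inner ℂ (lineFrame L x₀ y) (lineFrame L x₀ y)).re ^ k)
      (trivializationAt ℂ L x₀).baseSet :=
    ContMDiffOn.pow (SmoothFun.inner_section hL (trivializationAt ℂ L x₀).open_baseSet h1 h1).re k
  exact h2.congr fun y _ => lineWeight_eq k x₀ y

/-- Since the connection is Hermitian, d|ℓ|² = 2 Re θ · |ℓ|²; taking the k-th power multiplies the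
factor by k. This is the condition in `metricCompatible_twistedOp` for ψ = kθ. -/
theorem mvfderiv_lineWeight (hL : IsSmoothHermitian n ℂ L) (hLh : IsHermitianConnection nablaL)
    (k : ℕ) {x₀ y : M} (hy : y ∈ (trivializationAt ℂ L x₀).baseSet)
    (v : TangentSpace (𝓡 (2 * n)) y) :
    mvfderiv (𝓡 (2 * n)) (lineWeight L k x₀) y v
      = 2 * (((k : ℂ) • connectionForm nablaL x₀ y) v).re * lineWeight L k x₀ y := by
  have hU := (trivializationAt ℂ L x₀).open_baseSet
  have h1 := smoothOn_lineFrame (n := n) (L := L) x₀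
  have h2 := SmoothFun.inner_section hL hU h1 h1
  have h3 := hLh _ _ y (h1.diffAt hU hy) (h1.diffAt hU hy) v
  have h4 := mvfderiv_clm_comp (h2.diffAt hU hy) Complex.reCLM v
  simp only [Complex.reCLM_apply] at h4
  rw [show lineWeight L k x₀ = fun y => (inner ℂ (lineFrame L x₀ y) (lineFrame L x₀ y)).re ^ k from
    funext (lineWeight_eq k x₀)]
  rw [h3, nabla_lineFrame hy, inner_smul_left, inner_smul_right, ← add_mul, add_comm,
    Complex.add_conj, Complex.re_ofReal_mul] at h4
  rw [(mvfderiv_real_pow (h2.re.diffAt hU hy) h4 k).2]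
  have h5 : (((k : ℂ) • connectionForm nablaL x₀ y) v).re
      = k * (connectionForm nablaL x₀ y v).re := by
    rw [LinearMap.smul_apply, smul_eq_mul, ← Complex.ofReal_natCast, Complex.re_ofReal_mul]
  rw [h5]
  ring

end LineBundle

/-! ### Change of gauge and curvature of the line bundle. -/

section LineCurvature

variable {n : ℕ} {M : Type*} [TopologicalSpace M]
  [ChartedSpace (EuclideanSpace ℝ (Fin (2 * n))) M] [IsManifold (𝓡 (2 * n)) ∞ M] [T2Space M]
  {L : M → Type*} [∀ x, NormedAddCommGroup (L x)] [∀ x, InnerProductSpace ℂ (L x)]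
  [TopologicalSpace (TotalSpace ℂ L)] [FiberBundle ℂ L] [VectorBundle ℂ ℂ L]
  [VectorBundle ℝ ℂ L] [ContMDiffVectorBundle ∞ ℂ L (𝓡 (2 * n))]
  {nablaL : CovariantDerivative (𝓡 (2 * n)) ℂ L}

/-- The transition function between the local frames of `L` around `x₀` and `x₁`. -/
def lineTransition (L : M → Type*) [∀ x, NormedAddCommGroup (L x)] [∀ x, InnerProductSpace ℂ (L x)]
    [TopologicalSpace (TotalSpace ℂ L)] [FiberBundle ℂ L] [VectorBundle ℂ ℂ L] (x₀ x₁ y : M) : ℂ :=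
  lineCoord L x₀ y (lineFrame L x₁ y)

theorem lineTransition_smul {x₀ y : M} (hy : y ∈ (trivializationAt ℂ L x₀).baseSet) (x₁ : M) :
    lineTransition L x₀ x₁ y • lineFrame L x₀ y = lineFrame L x₁ y :=
  lineCoord_smul_lineFrame_of_mem hy _

theorem smoothFun_lineTransition (hL : IsSmoothHermitian n ℂ L) (x₀ x₁ : M) :
    SmoothFun n (lineTransition L x₀ x₁)
      ((trivializationAt ℂ L x₀).baseSet ∩ (trivializationAt ℂ L x₁).baseSet) :=
  smoothFun_lineCoord hL
    ((trivializationAt ℂ L x₀).open_baseSet.inter (trivializationAt ℂ L x₁).open_baseSet)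
    Set.inter_subset_left ((smoothOn_lineFrame x₁).mono Set.inter_subset_right)

/-- Differentiating ℓ₁ = g ℓ₀ gives θ₁ = θ₀ + dg/g. -/
theorem mvfderiv_lineTransition (hL : IsSmoothHermitian n ℂ L) (hLh : IsHermitianConnection nablaL)
    {x₀ x₁ y : M} (hy : y ∈ (trivializationAt ℂ L x₀).baseSet)
    (hy' : y ∈ (trivializationAt ℂ L x₁).baseSet) (v : TangentSpace (𝓡 (2 * n)) y) :
    mvfderiv (𝓡 (2 * n)) (lineTransition L x₀ x₁) y v
      = (connectionForm nablaL x₁ y v - connectionForm nablaL x₀ y v)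
        * lineTransition L x₀ x₁ y := by
  have hW := (trivializationAt ℂ L x₀).open_baseSet.inter (trivializationAt ℂ L x₁).open_baseSet
  have h0 : SmoothOn n ℂ (lineFrame L x₀) ((trivializationAt ℂ L x₀).baseSet ∩
    (trivializationAt ℂ L x₁).baseSet) := (smoothOn_lineFrame x₀).mono Set.inter_subset_left
  have hg := smoothFun_lineTransition hL x₀ x₁
  have h1 := nabla_complex_smul hLh hL hW hg h0 ⟨hy, hy'⟩ v
  have h2 : nablaL (fun z => lineTransition L x₀ x₁ z • lineFrame L x₀ z) y
      = nablaL (lineFrame L x₁) y :=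
    nabla_congr nablaL ((smoothOn_lineFrame x₁).diffAt (trivializationAt ℂ L x₁).open_baseSet hy')
      (Filter.mem_of_superset (hW.mem_nhds ⟨hy, hy'⟩) fun z hz => lineTransition_smul hz.1 x₁)
  rw [h2, nabla_lineFrame hy', nabla_lineFrame hy, ← lineTransition_smul hy x₁, smul_smul, smul_smul,
    ← add_smul] at h1
  have h3 : _ = _ := smul_left_injective ℂ (lineFrame_ne_zero hy) h1
  linear_combination -h3

variable [RiemannianBundle (fun x : M => TangentSpace (𝓡 (2 * n)) x)]
  [IsContMDiffRiemannianBundle (𝓡 (2 * n)) ∞ (EuclideanSpace ℝ (Fin (2 * n)))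
      (fun x : M => TangentSpace (𝓡 (2 * n)) x)]
  {nablaM : CovariantDerivative (𝓡 (2 * n)) (EuclideanSpace ℝ (Fin (2 * n)))
      (fun x : M => TangentSpace (𝓡 (2 * n)) x)}

variable (nablaM nablaL) in
/-- The curvature two-form of `L` as a bilinear map. -/
def curvatureForm (x : M) :
    TangentSpace (𝓡 (2 * n)) x →ₗ[ℝ] TangentSpace (𝓡 (2 * n)) x →ₗ[ℝ] ℂ :=
  (curvatureOp nablaM (connectionOp nablaL) (lineFrame L x) x).compr₂
    ((lineCoord L x x).restrictScalars ℝ)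

/-- The extensions of v and w are smooth only on a trivializing set around x, which suffices because
the curvature operator can be evaluated on any smooth local fields. -/
theorem curvature_eq_curvatureForm (hM : IsLeviCivita nablaM)
    (hLs : nablaL.ContMDiffCovariantDerivative ∞) (x : M) (v w : TangentSpace (𝓡 (2 * n)) x) :
    curvature nablaL x v w = curvatureForm nablaL nablaM x v w := by
  let T := fun x : M => TangentSpace (𝓡 (2 * n)) x
  let e := trivializationAt (EuclideanSpace ℝ (Fin (2 * n))) T x
  let f := trivializationAt ℂ L x
  have hx : x ∈ e.baseSet ∩ f.baseSet := ⟨FiberBundle.mem_baseSet_trivializationAt' x,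
    FiberBundle.mem_baseSet_trivializationAt' x⟩
  have hW := e.open_baseSet.inter f.open_baseSet
  have hext : ∀ v : TangentSpace (𝓡 (2 * n)) x, SmoothField
      (FiberBundle.extend (EuclideanSpace ℝ (Fin (2 * n))) (E := T) v) (e.baseSet ∩ f.baseSet) :=
    fun v => ContMDiffOn.mono (smoothOn_trivialization_symm (V := T) x _) Set.inter_subset_left
  have h := curvatureOp_fields hM (isConnectionOn_connectionOp hLs Set.univ) hW
    (Set.subset_univ _) ((smoothOn_lineFrame x).mono Set.inter_subset_right) (hext v) (hext w) hx
  simp only [FiberBundle.extend_apply_self, connectionOp_apply] at h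
  exact congrArg (lineCoord L x x) h.symm

/-- `curvatureForm` at x uses the frame centred at x, which changes with the point. Tensoriality in
the section lets it be computed in one fixed gauge, where F = dθ; this gives smooth dependence on x.
-/
theorem curvatureForm_eq_formDeriv (hn : 0 < n) (hM : IsLeviCivita nablaM)
    (hL : IsSmoothHermitian n ℂ L) (hLs : nablaL.ContMDiffCovariantDerivative ∞)
    (hLh : IsHermitianConnection nablaL) {x₀ : M} {W : Set M} (hW : IsOpen W)
    (hWU : W ⊆ (trivializationAt ℂ L x₀).baseSet)
    {Y Z : ∀ x : M, TangentSpace (𝓡 (2 * n)) x} (hY : SmoothField Y W) (hZ : SmoothField Z W)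
    {x : M} (hx : x ∈ W) :
    curvatureForm nablaL nablaM x (Y x) (Z x) = formDeriv (connectionForm nablaL x₀) Y Z x := by
  have hD := isConnectionOn_connectionOp hLs Set.univ
  have hc : ComplexLeibniz ℂ (connectionOp nablaL) Set.univ :=
    complexLeibniz_connectionOp hL hLh Set.univ
  have hxx : x ∈ (trivializationAt ℂ L x).baseSet := FiberBundle.mem_baseSet_trivializationAt' x
  have hW' := hW.inter (trivializationAt ℂ L x).open_baseSet
  have hl0 : SmoothOn n ℂ (lineFrame L x₀) W := (smoothOn_lineFrame x₀).mono hWU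
  have hlx := smoothOn_lineFrame (n := n) (L := L) x
  have hθ : SmoothForm (connectionForm nablaL x₀) (trivializationAt ℂ L x₀).baseSet :=
    smoothForm_connectionForm hL hLs x₀
  have h1 : ∀ v w, curvatureOp nablaM (connectionOp nablaL) (lineFrame L x) x v w
      = lineTransition L x₀ x x • curvatureOp nablaM (connectionOp nablaL) (lineFrame L x₀) x v w := by
    intro v w
    have hg : SmoothFun n (lineTransition L x₀ x) (W ∩ (trivializationAt ℂ L x).baseSet) :=
      (smoothFun_lineTransition hL x₀ x).mono (Set.inter_subset_inter_left _ hWU)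
    have h0' : SmoothOn n ℂ (lineFrame L x₀) (W ∩ (trivializationAt ℂ L x).baseSet) :=
      hl0.mono Set.inter_subset_left
    rw [← curvatureOp_smul hn hM hD hc hW' (Set.subset_univ _) hg h0' ⟨hx, hxx⟩,
      curvatureOp_sum hM hD hW' (Set.subset_univ _) {()}
        (s := fun _ y => lineTransition L x₀ x y • lineFrame L x₀ y)
        (fun _ _ => SmoothOn.complex_smul hg h0')
        (fun y hy => by simp [lineTransition_smul (hWU hy.1)]) ⟨hx, hxx⟩]
    simp
  have h2 : curvatureOp nablaM (connectionOp nablaL) (lineFrame L x₀) x (Y x) (Z x)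
      = formDeriv (connectionForm nablaL x₀) Y Z x • lineFrame L x₀ x := by
    rw [curvatureOp_fields hM hD hW (Set.subset_univ _) hl0 hY hZ hx]
    have h3 : ∀ {Z : ∀ x : M, TangentSpace (𝓡 (2 * n)) x}, SmoothField Z W → ∀ v,
        connectionOp nablaL (fun y => connectionOp nablaL (lineFrame L x₀) y (Z y)) x v
          = connectionForm nablaL x₀ x (Z x) • connectionForm nablaL x₀ x v • lineFrame L x₀ x
            + mvfderiv (𝓡 (2 * n)) (fun y => connectionForm nablaL x₀ y (Z y)) x v
              • lineFrame L x₀ x := by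
      intro Z hZ v
      rw [hD.congr hW (Set.subset_univ _)
        (s := fun y => connectionForm nablaL x₀ y (Z y) • lineFrame L x₀ y)
        (t := fun y => connectionOp nablaL (lineFrame L x₀) y (Z y))
        (SmoothOn.complex_smul (hθ hW hWU hZ) hl0) (fun y hy => nabla_lineFrame (hWU hy) _) hx,
        hc hW (Set.subset_univ _) (hθ hW hWU hZ) hl0 hx, connectionOp_apply,
        nabla_lineFrame (hWU hx)]
    rw [h3 hY, h3 hZ, connectionOp_apply, nabla_lineFrame (hWU hx), formDeriv]
    module
  change lineCoord L x x (curvatureOp nablaM (connectionOp nablaL) (lineFrame L x) x (Y x) (Z x)) = _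
  rw [h1, h2, smul_comm, lineTransition_smul (hWU hx), map_smul, lineCoord_lineFrame hxx,
    smul_eq_mul, mul_one]

theorem smoothFun_formDeriv {ψ : ∀ x : M, TangentSpace (𝓡 (2 * n)) x →ₗ[ℝ] ℂ} {W : Set M}
    (hW : IsOpen W) (hψ : SmoothForm ψ W) {Y Z : ∀ x : M, TangentSpace (𝓡 (2 * n)) x}
    (hY : SmoothField Y W) (hZ : SmoothField Z W) : SmoothFun n (formDeriv ψ Y Z) W :=
  ContMDiffOn.sub (ContMDiffOn.sub ((hψ hW subset_rfl hZ).mvfderiv_apply hW hY)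
    ((hψ hW subset_rfl hY).mvfderiv_apply hW hZ))
    (hψ hW subset_rfl (SmoothOn.mlieBracket hW hY hZ))

end LineCurvature

/-! ### Sections of E ⊗ L^k in local gauges. -/

section TwistCoord

variable {n : ℕ} {M : Type*} [TopologicalSpace M]
  [ChartedSpace (EuclideanSpace ℝ (Fin (2 * n))) M] [IsManifold (𝓡 (2 * n)) ∞ M]
  {F : Type*} [NormedAddCommGroup F] [NormedSpace ℂ F]
  {E : M → Type*} [∀ x, NormedAddCommGroup (E x)] [∀ x, InnerProductSpace ℂ (E x)]
  [TopologicalSpace (TotalSpace F E)] [FiberBundle F E] [VectorBundle ℂ F E]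
  [VectorBundle ℝ F E]
  {L : M → Type*} [∀ x, NormedAddCommGroup (L x)] [∀ x, InnerProductSpace ℂ (L x)]
  [TopologicalSpace (TotalSpace ℂ L)] [FiberBundle ℂ L] [VectorBundle ℂ ℂ L] [T2Space M]
  [VectorBundle ℝ ℂ L] [ContMDiffVectorBundle ∞ ℂ L (𝓡 (2 * n))]

theorem powCoord_tprod (k : ℕ) (x₀ y : M) (l : Fin k → L y) :
    powCoord L k x₀ y (PiTensorProduct.tprod ℂ l) = ∏ i, lineCoord L x₀ y (l i) := by
  simp [powCoord]

theorem powCoord_powFrame (k : ℕ) (x₀ x₁ y : M) :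
    powCoord L k x₀ y (powFrame L k x₁ y) = lineTransition L x₀ x₁ y ^ k := by
  simp [powFrame, powCoord_tprod, lineTransition]

theorem twistCoord_tmul (k : ℕ) (x₀ y : M) (e : E y) (t : ⨂[ℂ]^k (L y)) :
    twistCoord k x₀ y (e ⊗ₜ[ℂ] t) = powCoord L k x₀ y t • e := by
  simp [twistCoord]

theorem powCoord_smul_powFrame (k : ℕ) {x₀ y : M} (hy : y ∈ (trivializationAt ℂ L x₀).baseSet)
    (t : ⨂[ℂ]^k (L y)) : powCoord L k x₀ y t • powFrame L k x₀ y = t := by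
  have : (powCoord L k x₀ y).smulRight (powFrame L k x₀ y) = LinearMap.id := by
    refine PiTensorProduct.ext (MultilinearMap.ext fun l => ?_)
    simp only [LinearMap.compMultilinearMap_apply, LinearMap.smulRight_apply, LinearMap.id_apply,
      powCoord_tprod]
    rw [powFrame, ← MultilinearMap.map_smul_univ]
    congr 1
    funext i
    exact lineCoord_smul_lineFrame_of_mem hy _
  exact LinearMap.congr_fun this t

theorem twistCoord_tmul_powFrame (k : ℕ) {x₀ y : M} (hy : y ∈ (trivializationAt ℂ L x₀).baseSet)
    (a : Twist E L k y) : twistCoord k x₀ y a ⊗ₜ[ℂ] powFrame L k x₀ y = a := by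
  induction a using TensorProduct.induction_on with
  | zero => simp
  | tmul e t =>
    rw [twistCoord_tmul, TensorProduct.smul_tmul, powCoord_smul_powFrame k hy]
  | add a b ha hb => rw [map_add, TensorProduct.add_tmul, ha, hb]

theorem twistCoord_injective (k : ℕ) {x₀ y : M} (hy : y ∈ (trivializationAt ℂ L x₀).baseSet) :
    Function.Injective (twistCoord k x₀ y : Twist E L k y → E y) := fun a b h => by
  rw [← twistCoord_tmul_powFrame k hy a, ← twistCoord_tmul_powFrame k hy b, h]

theorem twistCoord_transition (k : ℕ) (x₀ : M) {x₁ y : M}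
    (hy : y ∈ (trivializationAt ℂ L x₁).baseSet) (a : Twist E L k y) :
    twistCoord k x₀ y a = lineTransition L x₀ x₁ y ^ k • twistCoord k x₁ y a := by
  conv_lhs => rw [← twistCoord_tmul_powFrame k hy a, twistCoord_tmul, powCoord_powFrame]

/-- The scalar product was defined with the frame centred at y. Under change of frame the factors
|g|^{2k} from the coordinates and from the weight agree. -/
theorem twistInner_eq (k : ℕ) {x₀ y : M} (hy : y ∈ (trivializationAt ℂ L x₀).baseSet)
    (a b : Twist E L k y) :
    twistInner k y a b = inner ℂ (twistCoord k x₀ y a) (twistCoord k x₀ y b)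
      * (lineWeight L k x₀ y : ℂ) := by
  have hyy : y ∈ (trivializationAt ℂ L y).baseSet := FiberBundle.mem_baseSet_trivializationAt' y
  have h1 : lineFrame L x₀ y = lineTransition L y x₀ y • lineFrame L y y :=
    (lineTransition_smul hyy x₀).symm
  rw [twistInner, twistCoord_transition k y hy a, twistCoord_transition k y hy b, inner_smul_left,
    inner_smul_right, lineWeight, h1, norm_smul, map_pow]
  have h2 := Complex.conj_mul' (lineTransition L y x₀ y)
  push_cast
  rw [mul_pow, pow_mul (‖lineTransition L y x₀ y‖ : ℂ), ← h2]
  ring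

theorem twistCoord_rTensor (k : ℕ) (x₀ y : M) (T : E y →ₗ[ℂ] E y) (a : Twist E L k y) :
    twistCoord k x₀ y (LinearMap.rTensor (⨂[ℂ]^k (L y)) T a) = T (twistCoord k x₀ y a) := by
  induction a using TensorProduct.induction_on with
  | zero => simp
  | tmul e t => rw [LinearMap.rTensor_tmul, twistCoord_tmul, twistCoord_tmul, map_smul]
  | add a b ha hb => simp only [map_add, ha, hb]

variable [FiniteDimensional ℂ F] [ContMDiffVectorBundle ∞ F E (𝓡 (2 * n))]
  {nablaE : CovariantDerivative (𝓡 (2 * n)) F E} {nablaL : CovariantDerivative (𝓡 (2 * n)) ℂ L}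

variable (nablaE nablaL) in
/-- The connection on `E ⊗ L^k` in the gauge `lineFrame L x₀`. -/
def gaugeOp (k : ℕ) (x₀ : M) : (∀ x : M, E x) → ∀ x : M, TangentSpace (𝓡 (2 * n)) x →ₗ[ℝ] E x :=
  twistedOp (connectionOp nablaE) fun y => (k : ℂ) • connectionForm nablaL x₀ y

/-- The product connection at y was also defined with the frame centred at y. Passing to a fixed
gauge multiplies coordinates by g^k, and the derivative of g^k supplies the k(θ_y - θ_{x₀}) that
changes one connection form into the other. -/
theorem twistCoord_twistNabla (hE : IsSmoothHermitian n F E) (hEh : IsHermitianConnection nablaE)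
    (hL : IsSmoothHermitian n ℂ L) (hLh : IsHermitianConnection nablaL) {k : ℕ}
    {s : ∀ x : M, Twist E L k x} (hs : IsSmoothTwist n F k s) {x₀ y : M}
    (hy : y ∈ (trivializationAt ℂ L x₀).baseSet) (v : TangentSpace (𝓡 (2 * n)) y) :
    twistCoord k x₀ y (twistNabla nablaE nablaL k s y v)
      = gaugeOp nablaE nablaL k x₀ (fun z => twistCoord k x₀ z (s z)) y v := by
  have hyy : y ∈ (trivializationAt ℂ L y).baseSet := FiberBundle.mem_baseSet_trivializationAt' y
  have hW := (trivializationAt ℂ L x₀).open_baseSet.inter (trivializationAt ℂ L y).open_baseSet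
  have hg := smoothFun_lineTransition hL x₀ y
  have hsy : SmoothOn n F (fun z => twistCoord k y z (s z)) ((trivializationAt ℂ L x₀).baseSet ∩
    (trivializationAt ℂ L y).baseSet) := (hs y).mono Set.inter_subset_right
  have h1 := nabla_complex_smul hEh hE hW (hg.complex_pow k) hsy ⟨hy, hyy⟩ v
  have h2 : nablaE (fun z => lineTransition L x₀ y z ^ k • twistCoord k y z (s z)) y
      = nablaE (fun z => twistCoord k x₀ z (s z)) y :=
    nabla_congr nablaE (SmoothOn.diffAt (hs x₀) (trivializationAt ℂ L x₀).open_baseSet hy)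
      (Filter.mem_of_superset (hW.mem_nhds ⟨hy, hyy⟩) fun z hz =>
        (twistCoord_transition k x₀ hz.2 (s z)).symm)
  have h3 := (mvfderiv_complex_pow (hg.diffAt hW ⟨hy, hyy⟩)
    (mvfderiv_lineTransition hL hLh hy hyy v) k).2
  rw [h2, h3] at h1
  change twistCoord k x₀ y ((nablaE (fun z => twistCoord k y z (s z)) y v
    + ((k : ℂ) * connectionForm nablaL y y v) • twistCoord k y y (s y)) ⊗ₜ[ℂ] powFrame L k y y)
    = nablaE (fun z => twistCoord k x₀ z (s z)) y v
      + ((k : ℂ) * connectionForm nablaL x₀ y v) • twistCoord k x₀ y (s y)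
  rw [twistCoord_tmul, powCoord_powFrame, h1, twistCoord_transition k x₀ hyy (s y)]
  module

end TwistCoord

/-! ### Coordinate vector fields and divergence -/

/-- The determinant as a continuous multilinear function of the rows. -/
def detMultilinear (m : ℕ) : ContinuousMultilinearMap ℝ (fun _ : Fin m => Fin m → ℝ) ℝ where
  toMultilinearMap := (Matrix.detRowAlternating (n := Fin m) (R := ℝ)).toMultilinearMap
  cont := Continuous.matrix_det (A := fun A : Fin m → Fin m → ℝ => Matrix.of A)
    (continuous_id (X := Fin m → Fin m → ℝ))

theorem hasFDerivAt_det {m : ℕ} (A : Fin m → Fin m → ℝ) :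
    HasFDerivAt (fun B : Fin m → Fin m → ℝ => (Matrix.of B).det) ((detMultilinear m).linearDeriv A)
      A :=
  (detMultilinear m).hasFDerivAt A

/-- Jacobi's formula: by Cramer's rule, replacing the i-th row of A by that of B yields the i-th
diagonal entry of B adj A. -/
theorem linearDeriv_det {m : ℕ} (A B : Fin m → Fin m → ℝ) :
    (detMultilinear m).linearDeriv A B = ((Matrix.of B) * (Matrix.of A).adjugate).trace := by
  rw [ContinuousMultilinearMap.linearDeriv_apply, Matrix.trace]
  refine Finset.sum_congr rfl fun i _ => ?_
  have h : detMultilinear m (Function.update A i (B i)) = (Matrix.updateRow (Matrix.of A) i (B i)).det :=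
    rfl
  rw [h, ← Matrix.cramer_transpose_apply, Matrix.cramer_eq_adjugate_mulVec, ← Matrix.adjugate_transpose,
    Matrix.mulVec_transpose, Matrix.diag_apply, Matrix.mul_apply_eq_vecMul]
  rfl

section Coordinates

variable {n : ℕ} {M : Type*} [TopologicalSpace M]
  [ChartedSpace (EuclideanSpace ℝ (Fin (2 * n))) M] [IsManifold (𝓡 (2 * n)) ∞ M]

theorem mvfderiv_comp_hasFDerivAt {G G' : Type*} [NormedAddCommGroup G] [NormedSpace ℝ G]
    [NormedAddCommGroup G'] [NormedSpace ℝ G'] {f : M → G} {x : M} {g : G → G'} {g' : G →L[ℝ] G'}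
    (hg : HasFDerivAt g g' (f x)) (hf : MDifferentiableAt (𝓡 (2 * n)) 𝓘(ℝ, G) f x)
    (v : TangentSpace (𝓡 (2 * n)) x) :
    mvfderiv (𝓡 (2 * n)) (fun y => g (f y)) x v = g' (mvfderiv (𝓡 (2 * n)) f x v) := by
  have hx : (extChartAt (𝓡 (2 * n)) x).symm (extChartAt (𝓡 (2 * n)) x x) = x :=
    (extChartAt (𝓡 (2 * n)) x).left_inv (mem_extChartAt_source x)
  refine mvfderiv_eq_of_hasFDerivAt
    (hg.differentiableAt.mdifferentiableAt.comp x hf) ?_ v (f' := g'.comp (chartDeriv f x))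
  exact HasFDerivAt.comp (g := g) _ (by simpa [hx] using hg) (hasFDerivAt_chart hf)

theorem mvfderiv_det {m : ℕ} {A : M → Fin m → Fin m → ℝ} {U : Set M} (hU : IsOpen U)
    (hA : ∀ i j, SmoothFun n (fun y => A y i j) U) {x : M} (hx : x ∈ U)
    (v : TangentSpace (𝓡 (2 * n)) x) :
    mvfderiv (𝓡 (2 * n)) (fun y => (Matrix.of (A y)).det) x v
      = ((Matrix.of fun i j => mvfderiv (𝓡 (2 * n)) (fun y => A y i j) x v)
        * (Matrix.of (A x)).adjugate).trace := by
  have hA' : MDifferentiableAt (𝓡 (2 * n)) 𝓘(ℝ, Fin m → Fin m → ℝ) A x :=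
    SmoothFun.diffAt (contMDiffOn_pi_space.2 fun i => contMDiffOn_pi_space.2 fun j => hA i j) hU hx
  rw [mvfderiv_comp_hasFDerivAt (hasFDerivAt_det (A x)) hA' v, linearDeriv_det]
  congr 3
  funext i j
  exact (mvfderiv_clm_comp hA' ((ContinuousLinearMap.proj j).comp
    (ContinuousLinearMap.proj (R := ℝ) (φ := fun _ : Fin m => Fin m → ℝ) i)) v).symm

/-- The `i`-th coordinate vector field of the chart at `x₀`. -/
def coordField (x₀ : M) (i : Fin (2 * n)) (x : M) : TangentSpace (𝓡 (2 * n)) x :=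
  (trivializationAt (EuclideanSpace ℝ (Fin (2 * n))) (fun x : M => TangentSpace (𝓡 (2 * n)) x)
    x₀).symm x (EuclideanSpace.basisFun (Fin (2 * n)) ℝ i)

theorem smoothField_coordField (x₀ : M) (i : Fin (2 * n)) :
    SmoothField (coordField x₀ i) (extChartAt (𝓡 (2 * n)) x₀).source := by
  rw [extChartAt_source]
  exact smoothOn_trivialization_symm (V := fun x : M => TangentSpace (𝓡 (2 * n)) x) x₀
    (EuclideanSpace.basisFun (Fin (2 * n)) ℝ i)

theorem coordField_eq_mfderiv {x₀ x : M} (hx : x ∈ (extChartAt (𝓡 (2 * n)) x₀).source)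
    (i : Fin (2 * n)) :
    coordField x₀ i x = mfderiv 𝓘(ℝ, EuclideanSpace ℝ (Fin (2 * n))) (𝓡 (2 * n))
      (extChartAt (𝓡 (2 * n)) x₀).symm (extChartAt (𝓡 (2 * n)) x₀ x)
      (EuclideanSpace.basisFun (Fin (2 * n)) ℝ i) := by
  rw [extChartAt_source] at hx
  have h := TangentBundle.symmL_trivializationAt (I := 𝓡 (2 * n)) (𝕜 := ℝ) hx
  rw [ModelWithCorners.Boundaryless.range_eq_univ, mfderivWithin_univ] at h
  have h2 := congrArg (fun T => T (EuclideanSpace.basisFun (Fin (2 * n)) ℝ i)) h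
  refine Eq.trans ?_ h2
  rw [Trivialization.symmL_apply _ (by simpa using hx)]
  rfl

theorem isOpen_chartTarget (x₀ : M) : IsOpen (extChartAt (𝓡 (2 * n)) x₀).target :=
  isOpen_extChartAt_target x₀

theorem mdifferentiableAt_chart_symm {x₀ : M} {y : EuclideanSpace ℝ (Fin (2 * n))}
    (hy : y ∈ (extChartAt (𝓡 (2 * n)) x₀).target) :
    MDifferentiableAt 𝓘(ℝ, EuclideanSpace ℝ (Fin (2 * n))) (𝓡 (2 * n))
      (extChartAt (𝓡 (2 * n)) x₀).symm y := by
  have h := mdifferentiableWithinAt_extChartAt_symm (I := 𝓡 (2 * n)) hy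
  rwa [ModelWithCorners.Boundaryless.range_eq_univ, mdifferentiableWithinAt_univ] at h

theorem hasFDerivAt_comp_chart_symm {f : M → ℝ} {x₀ : M} {y : EuclideanSpace ℝ (Fin (2 * n))}
    (hy : y ∈ (extChartAt (𝓡 (2 * n)) x₀).target)
    (hf : MDifferentiableAt (𝓡 (2 * n)) 𝓘(ℝ, ℝ) f ((extChartAt (𝓡 (2 * n)) x₀).symm y)) :
    DifferentiableAt ℝ (f ∘ (extChartAt (𝓡 (2 * n)) x₀).symm) y ∧
    ∀ i, fderiv ℝ (f ∘ (extChartAt (𝓡 (2 * n)) x₀).symm) y (EuclideanSpace.basisFun (Fin (2 * n)) ℝ i)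
      = mvfderiv (𝓡 (2 * n)) f ((extChartAt (𝓡 (2 * n)) x₀).symm y)
        (coordField x₀ i ((extChartAt (𝓡 (2 * n)) x₀).symm y)) := by
  have h1 := mdifferentiableAt_chart_symm hy
  refine ⟨mdifferentiableAt_iff_differentiableAt.1 (hf.comp y h1), fun i => ?_⟩
  have h2 := mfderiv_comp y hf h1
  rw [mfderiv_eq_fderiv] at h2
  rw [h2, coordField_eq_mfderiv ((extChartAt (𝓡 (2 * n)) x₀).map_target hy),
    (extChartAt (𝓡 (2 * n)) x₀).right_inv hy]
  rfl

end Coordinates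

/-! ### The divergence and the Riemannian density in a chart. -/

section Divergence

/-- With P the matrix of T and G the Gram matrix, the matrix of ⟨Tbᵢ, bⱼ⟩ is PᵀG, and G adj G = det
G. This rewrites the trace in Jacobi's formula as a divergence. -/
theorem trace_mul_det_gram {V : Type*} [NormedAddCommGroup V] [InnerProductSpace ℝ V] {m : ℕ}
    (b : Module.Basis (Fin m) ℝ V) (T : V →ₗ[ℝ] V) :
    LinearMap.trace ℝ V T * (Matrix.of fun i j => inner ℝ (b i) (b j) : Matrix (Fin m) (Fin m) ℝ).det
      = ((Matrix.of fun i j => inner ℝ (T (b i)) (b j) : Matrix (Fin m) (Fin m) ℝ)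
        * (Matrix.of fun i j => inner ℝ (b i) (b j)).adjugate).trace := by
  have h : (Matrix.of fun i j => inner ℝ (T (b i)) (b j) : Matrix (Fin m) (Fin m) ℝ)
      = (LinearMap.toMatrix b b T).transpose * Matrix.of fun i j => inner ℝ (b i) (b j) := by
    ext i j
    rw [Matrix.mul_apply]
    simp only [Matrix.of_apply, Matrix.transpose_apply, LinearMap.toMatrix_apply]
    conv_lhs => rw [← b.sum_repr (T (b i)), sum_inner]
    simp only [inner_smul_left]
    rfl
  rw [h, Matrix.mul_assoc, Matrix.mul_adjugate, Matrix.mul_smul, Matrix.mul_one, Matrix.trace_smul,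
    Matrix.trace_transpose, LinearMap.trace_eq_matrix_trace ℝ b, smul_eq_mul, mul_comm]

variable {n : ℕ} {M : Type*} [TopologicalSpace M]
  [ChartedSpace (EuclideanSpace ℝ (Fin (2 * n))) M] [IsManifold (𝓡 (2 * n)) ∞ M]

/-- The basis of coordinate vectors. -/
def coordBasis {x₀ x : M} (hx : x ∈ (extChartAt (𝓡 (2 * n)) x₀).source) :
    Module.Basis (Fin (2 * n)) ℝ (TangentSpace (𝓡 (2 * n)) x) :=
  (trivializationAt (EuclideanSpace ℝ (Fin (2 * n))) (fun x : M => TangentSpace (𝓡 (2 * n)) x)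
    x₀).basisAt (EuclideanSpace.basisFun (Fin (2 * n)) ℝ).toBasis (by simpa using hx)

theorem coordBasis_apply {x₀ x : M} (hx : x ∈ (extChartAt (𝓡 (2 * n)) x₀).source)
    (i : Fin (2 * n)) : coordBasis hx i = coordField x₀ i x := by
  simp [coordBasis, Trivialization.basisAt, coordField]

/-- The `k`-th coordinate function of the chart at `x₀`. -/
def coordFun (x₀ : M) (k : Fin (2 * n)) (x : M) : ℝ := extChartAt (𝓡 (2 * n)) x₀ x k

theorem smoothFun_coordFun (x₀ : M) (k : Fin (2 * n)) :
    SmoothFun n (coordFun x₀ k) (extChartAt (𝓡 (2 * n)) x₀).source := by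
  have h := contMDiffOn_extChartAt (I := 𝓡 (2 * n)) (n := ∞) (x := x₀)
  rw [← extChartAt_source (𝓡 (2 * n))] at h
  exact (EuclideanSpace.proj (𝕜 := ℝ) k).contMDiff.comp_contMDiffOn h

theorem mvfderiv_coordFun {x₀ x : M} (hx : x ∈ (extChartAt (𝓡 (2 * n)) x₀).source)
    (i k : Fin (2 * n)) :
    mvfderiv (𝓡 (2 * n)) (coordFun x₀ k) x (coordField x₀ i x) = if k = i then 1 else 0 := by
  have hy := (extChartAt (𝓡 (2 * n)) x₀).map_source hx
  have hxy := (extChartAt (𝓡 (2 * n)) x₀).left_inv hx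
  have h := (hasFDerivAt_comp_chart_symm (f := coordFun x₀ k) hy (by
    rw [hxy]
    exact (smoothFun_coordFun x₀ k).diffAt (isOpen_extChartAt_source x₀) hx)).2 i
  rw [hxy] at h
  rw [← h]
  have h2 : coordFun x₀ k ∘ (extChartAt (𝓡 (2 * n)) x₀).symm
      =ᶠ[𝓝 (extChartAt (𝓡 (2 * n)) x₀ x)] EuclideanSpace.proj (𝕜 := ℝ) k := by
    filter_upwards [(isOpen_chartTarget x₀).mem_nhds hy] with z hz
    rw [Function.comp_apply, coordFun, (extChartAt (𝓡 (2 * n)) x₀).right_inv hz]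
    rfl
  rw [h2.fderiv_eq, ContinuousLinearMap.fderiv]
  simp

/-- The bracket kills every coordinate function, since the derivatives of coordinate functions along
coordinate fields are constant. -/
theorem mlieBracket_coordField (hn : 0 < n) [T2Space M] {x₀ x : M}
    (hx : x ∈ (extChartAt (𝓡 (2 * n)) x₀).source) (i j : Fin (2 * n)) :
    VectorField.mlieBracket (𝓡 (2 * n)) (coordField x₀ i) (coordField x₀ j) x = 0 := by
  set w := VectorField.mlieBracket (𝓡 (2 * n)) (coordField x₀ i) (coordField x₀ j) x with hw
  have hO := isOpen_extChartAt_source (I := 𝓡 (2 * n)) x₀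
  have h1 : ∀ k, mvfderiv (𝓡 (2 * n)) (coordFun x₀ k) x w = 0 := fun k => by
    have h2 : ∀ i j : Fin (2 * n), mvfderiv (𝓡 (2 * n)) (fun y => mvfderiv (𝓡 (2 * n))
        (coordFun x₀ k) y (coordField x₀ j y)) x (coordField x₀ i x) = 0 := fun i j => by
      rw [mvfderiv_congr (g := fun _ => if k = j then (1 : ℝ) else 0)
        (Filter.mem_of_superset (hO.mem_nhds hx) fun y hy => mvfderiv_coordFun hy j k)]
      simp [mvfderiv]
    rw [hw, mvfderiv_mlieBracket hn hO (smoothField_coordField x₀ i) (smoothField_coordField x₀ j)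
      (smoothFun_coordFun x₀ k) hx, h2, h2, sub_zero]
  have h3 : ∀ k, (coordBasis hx).repr w k = mvfderiv (𝓡 (2 * n)) (coordFun x₀ k) x w := fun k => by
    conv_rhs => rw [← (coordBasis hx).sum_repr w]
    simp only [map_sum, map_smul, coordBasis_apply, mvfderiv_coordFun hx]
    simp
  exact (coordBasis hx).ext_elem fun k => by rw [h3, h1]; simp

variable [RiemannianBundle (fun x : M => TangentSpace (𝓡 (2 * n)) x)]

variable (n) in
/-- The Riemannian density of the chart at `x₀`, as a function on the manifold. -/
def coordDensity (x₀ x : M) : ℝ :=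
  √ (Matrix.of fun i j : Fin (2 * n) => inner ℝ (coordField x₀ i x) (coordField x₀ j x)).det

theorem chartDensity_eq {x₀ : M} {y : EuclideanSpace ℝ (Fin (2 * n))}
    (hy : y ∈ (extChartAt (𝓡 (2 * n)) x₀).target) :
    chartDensity n x₀ y = coordDensity n x₀ ((extChartAt (𝓡 (2 * n)) x₀).symm y) := by
  have hx := (extChartAt (𝓡 (2 * n)) x₀).map_target hy
  rw [coordDensity, chartDensity]
  congr 2
  ext i j
  rw [Matrix.gram_apply, Matrix.of_apply, coordField_eq_mfderiv hx, coordField_eq_mfderiv hx,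
    (extChartAt (𝓡 (2 * n)) x₀).right_inv hy]

theorem det_metric_pos {x₀ x : M} (hx : x ∈ (extChartAt (𝓡 (2 * n)) x₀).source) :
    0 < (Matrix.of fun i j : Fin (2 * n) =>
      inner ℝ (coordField x₀ i x) (coordField x₀ j x)).det := by
  have h := Matrix.posDef_gram_of_linearIndependent (𝕜 := ℝ) (coordBasis hx).linearIndependent
  have h2 := h.det_pos
  rw [show (coordBasis hx : Fin (2 * n) → TangentSpace (𝓡 (2 * n)) x)
    = fun i => coordField x₀ i x from funext (coordBasis_apply hx)] at h2
  exact h2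

theorem coordDensity_pos {x₀ x : M} (hx : x ∈ (extChartAt (𝓡 (2 * n)) x₀).source) :
    0 < coordDensity n x₀ x := Real.sqrt_pos.2 (det_metric_pos hx)

variable [T2Space M] [IsContMDiffRiemannianBundle (𝓡 (2 * n)) ∞ (EuclideanSpace ℝ (Fin (2 * n)))
      (fun x : M => TangentSpace (𝓡 (2 * n)) x)]
  {nablaM : CovariantDerivative (𝓡 (2 * n)) (EuclideanSpace ℝ (Fin (2 * n)))
      (fun x : M => TangentSpace (𝓡 (2 * n)) x)}

theorem smoothFun_metric (x₀ : M) (i j : Fin (2 * n)) :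
    SmoothFun n (fun x => inner ℝ (coordField x₀ i x) (coordField x₀ j x))
      (extChartAt (𝓡 (2 * n)) x₀).source :=
  ContMDiffOn.inner_bundle (smoothField_coordField x₀ i) (smoothField_coordField x₀ j)

theorem smoothFun_det_metric (x₀ : M) :
    SmoothFun n (fun x => (Matrix.of fun i j : Fin (2 * n) =>
      inner ℝ (coordField x₀ i x) (coordField x₀ j x)).det) (extChartAt (𝓡 (2 * n)) x₀).source := by
  have h : ContDiff ℝ ∞ (detMultilinear (2 * n)) := (detMultilinear (2 * n)).contDiff
  exact h.contMDiff.comp_contMDiffOn (contMDiffOn_pi_space.2 fun i => contMDiffOn_pi_space.2 fun j =>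
    smoothFun_metric x₀ i j)

theorem smoothFun_coordDensity (x₀ : M) :
    SmoothFun n (coordDensity n x₀) (extChartAt (𝓡 (2 * n)) x₀).source :=
  (smoothFun_det_metric x₀).sqrt fun _ hx => (det_metric_pos hx).ne'

/-- The divergence of a vector field. -/
def divergence (nablaM : CovariantDerivative (𝓡 (2 * n)) (EuclideanSpace ℝ (Fin (2 * n)))
      (fun x : M => TangentSpace (𝓡 (2 * n)) x)) (X : ∀ x : M, TangentSpace (𝓡 (2 * n)) x) (x : M) :
    ℝ := LinearMap.trace ℝ (TangentSpace (𝓡 (2 * n)) x) (nablaM X x).toLinearMap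

/-- Coordinate fields commute and the torsion vanishes, so ∂ᵢ g_{jk} = A_{jk} + A_{kj} with A_{jk} =
⟨∇_{∂ⱼ} ∂ᵢ, ∂_k⟩. Jacobi's formula gives ∂ᵢ det g = 2 div(∂ᵢ) det g, and det g is the square of the
density. -/
theorem divergence_coordField (hn : 0 < n) (hM : IsLeviCivita nablaM) {x₀ x : M}
    (hx : x ∈ (extChartAt (𝓡 (2 * n)) x₀).source) (i : Fin (2 * n)) :
    mvfderiv (𝓡 (2 * n)) (coordDensity n x₀) x (coordField x₀ i x)
      = coordDensity n x₀ x * divergence nablaM (coordField x₀ i) x := by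
  have hO := isOpen_extChartAt_source (I := 𝓡 (2 * n)) x₀
  have hd : ∀ i, DiffAt n (EuclideanSpace ℝ (Fin (2 * n))) (coordField x₀ i) x := fun i =>
    (smoothField_coordField x₀ i).diffAt hO hx
  set A : Matrix (Fin (2 * n)) (Fin (2 * n)) ℝ := Matrix.of fun j k =>
    inner ℝ (nablaM (coordField x₀ i) x (coordField x₀ j x)) (coordField x₀ k x) with hA
  set G : Matrix (Fin (2 * n)) (Fin (2 * n)) ℝ := Matrix.of fun j k =>
    inner ℝ (coordField x₀ j x) (coordField x₀ k x) with hG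
  have h1 : divergence nablaM (coordField x₀ i) x * G.det = (A * G.adjugate).trace := by
    have := trace_mul_det_gram (coordBasis hx) (nablaM (coordField x₀ i) x).toLinearMap
    simp only [coordBasis_apply] at this
    exact this
  have hsymm : ∀ j, nablaM (coordField x₀ j) x (coordField x₀ i x)
      = nablaM (coordField x₀ i) x (coordField x₀ j x) := fun j => by
    have := nablaM_torsionFree hM (hd i) (hd j)
    rwa [mlieBracket_coordField hn hx, sub_eq_zero] at this
  have hdG : (Matrix.of fun j k => mvfderiv (𝓡 (2 * n)) (fun y =>
      inner ℝ (coordField x₀ j y) (coordField x₀ k y)) x (coordField x₀ i x)) = A + A.transpose := by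
    ext j k
    have := hM.1 _ _ x (hd j) (hd k) (coordField x₀ i x)
    rw [hsymm, hsymm, real_inner_comm (nablaM (coordField x₀ i) x (coordField x₀ k x))] at this
    exact this
  have hdet := mvfderiv_det hO (A := fun y j k => inner ℝ (coordField x₀ j y) (coordField x₀ k y))
    (smoothFun_metric x₀) hx (coordField x₀ i x)
  have hGt : G.transpose = G := by
    ext j k
    rw [Matrix.transpose_apply, hG, Matrix.of_apply, Matrix.of_apply, real_inner_comm]
  have htr : (A.transpose * G.adjugate).trace = (A * G.adjugate).trace := by
    rw [← Matrix.trace_transpose, Matrix.transpose_mul, Matrix.transpose_transpose,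
      Matrix.adjugate_transpose, hGt, Matrix.trace_mul_comm]
  rw [hdG, Matrix.add_mul, Matrix.trace_add, htr, ← h1] at hdet
  have hpos := coordDensity_pos hx
  have hsq : ∀ y ∈ (extChartAt (𝓡 (2 * n)) x₀).source, (Matrix.of fun j k : Fin (2 * n) =>
      inner ℝ (coordField x₀ j y) (coordField x₀ k y)).det
        = coordDensity n x₀ y * coordDensity n x₀ y :=
    fun y hy => (Real.mul_self_sqrt (det_metric_pos hy).le).symm
  have hρ := (smoothFun_coordDensity (n := n) x₀).diffAt hO hx
  rw [mvfderiv_congr (Filter.mem_of_superset (hO.mem_nhds hx) hsq), mvfderiv_real_mul hρ hρ, hsq x hx]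
    at hdet
  have h2 : coordDensity n x₀ x * (2 * mvfderiv (𝓡 (2 * n)) (coordDensity n x₀) x (coordField x₀ i x))
    = coordDensity n x₀ x * (2 * (coordDensity n x₀ x * divergence nablaM (coordField x₀ i) x)) := by
    linear_combination hdet
  have h3 := mul_left_cancel₀ hpos.ne' h2
  linarith

theorem divergence_eq_sum {ι : Type*} [Fintype ι] (X : ∀ x : M, TangentSpace (𝓡 (2 * n)) x)
    (x : M) (b : OrthonormalBasis ι ℝ (TangentSpace (𝓡 (2 * n)) x)) :
    divergence nablaM X x = ∑ i, inner ℝ (nablaM X x (b i)) (b i) := by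
  rw [divergence, LinearMap.trace_eq_sum_inner _ b]
  exact Finset.sum_congr rfl fun i _ => real_inner_comm _ _

theorem divergence_sum_smul {ι : Type*} (u : Finset ι)
    {f : ι → M → ℝ} {X : ι → ∀ x : M, TangentSpace (𝓡 (2 * n)) x} {W : Set M} (hW : IsOpen W)
    (hf : ∀ i ∈ u, SmoothFun n (f i) W) (hX : ∀ i ∈ u, SmoothField (X i) W)
    {Y : ∀ x : M, TangentSpace (𝓡 (2 * n)) x} (hY : ∀ y ∈ W, Y y = ∑ i ∈ u, f i y • X i y)
    {x : M} (hx : x ∈ W) :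
    divergence nablaM Y x
      = ∑ i ∈ u, (f i x * divergence nablaM (X i) x + mvfderiv (𝓡 (2 * n)) (f i) x (X i x)) := by
  have h3 : SmoothField (fun y => ∑ i ∈ u, f i y • X i y) W :=
    ContMDiffOn.sum_section fun i hi => (hf i hi).smul_section (hX i hi)
  let b := stdOrthonormalBasis ℝ (TangentSpace (𝓡 (2 * n)) x)
  simp only [divergence_eq_sum _ x b]
  rw [nablaM_congr nablaM hW h3 hY hx]
  simp only [nablaM_sum_smul nablaM u hW hf hX hx, sum_inner, inner_add_left, inner_smul_left]
  rw [Finset.sum_comm]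
  refine Finset.sum_congr rfl fun i _ => ?_
  rw [Finset.sum_add_distrib, Finset.mul_sum]
  congr 1
  conv_rhs => rw [← b.sum_repr' (X i x), map_sum]
  refine Finset.sum_congr rfl fun j _ => ?_
  rw [map_smul, smul_eq_mul, mul_comm, real_inner_comm]
  rfl

theorem divergence_coord (hn : 0 < n) (hM : IsLeviCivita nablaM) {x₀ : M}
    {f : Fin (2 * n) → M → ℝ} (hf : ∀ i, SmoothFun n (f i) (extChartAt (𝓡 (2 * n)) x₀).source)
    {Y : ∀ x : M, TangentSpace (𝓡 (2 * n)) x}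
    (hY : ∀ y ∈ (extChartAt (𝓡 (2 * n)) x₀).source, Y y = ∑ i, f i y • coordField x₀ i y)
    {x : M} (hx : x ∈ (extChartAt (𝓡 (2 * n)) x₀).source) :
    coordDensity n x₀ x * divergence nablaM Y x
      = ∑ i, mvfderiv (𝓡 (2 * n)) (fun y => f i y * coordDensity n x₀ y) x (coordField x₀ i x) := by
  have hO := isOpen_extChartAt_source (I := 𝓡 (2 * n)) x₀
  rw [divergence_sum_smul Finset.univ hO (fun i _ => hf i)
    (fun i _ => smoothField_coordField x₀ i) hY hx, Finset.mul_sum]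
  refine Finset.sum_congr rfl fun i _ => ?_
  rw [mvfderiv_real_mul ((hf i).diffAt hO hx) ((smoothFun_coordDensity (n := n) x₀).diffAt hO hx),
    divergence_coordField hn hM hx]
  ring

end Divergence

/-! ### The Riemannian volume -/

section Volume

theorem det_gram_comp {V : Type*} [NormedAddCommGroup V] [InnerProductSpace ℝ V] {m : ℕ}
    (f : EuclideanSpace ℝ (Fin m) →ₗ[ℝ] V)
    (T : EuclideanSpace ℝ (Fin m) →ₗ[ℝ] EuclideanSpace ℝ (Fin m)) :
    (Matrix.gram ℝ fun i => f (T (EuclideanSpace.basisFun (Fin m) ℝ i))).det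
      = LinearMap.det T ^ 2 *
        (Matrix.gram ℝ fun i => f (EuclideanSpace.basisFun (Fin m) ℝ i)).det := by
  set b := (EuclideanSpace.basisFun (Fin m) ℝ).toBasis with hb
  have h : (Matrix.gram ℝ fun i => f (T (EuclideanSpace.basisFun (Fin m) ℝ i)))
      = (LinearMap.toMatrix b b T).transpose
        * (Matrix.gram ℝ fun i => f (EuclideanSpace.basisFun (Fin m) ℝ i))
        * LinearMap.toMatrix b b T := by
    have hT : ∀ i, f (T (EuclideanSpace.basisFun (Fin m) ℝ i))
        = ∑ k, LinearMap.toMatrix b b T k i • f (EuclideanSpace.basisFun (Fin m) ℝ k) := fun i => by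
      conv_lhs => rw [← b.sum_repr (T (EuclideanSpace.basisFun (Fin m) ℝ i)), map_sum]
      simp only [map_smul, LinearMap.toMatrix_apply, hb, OrthonormalBasis.coe_toBasis]
    ext i j
    rw [Matrix.gram_apply, hT, hT, sum_inner, Matrix.mul_apply]
    simp only [inner_sum, inner_smul_left, inner_smul_right, Matrix.mul_apply,
      Matrix.transpose_apply, Matrix.gram_apply, Finset.sum_mul]
    rw [Finset.sum_comm]
    exact Finset.sum_congr rfl fun k _ => Finset.sum_congr rfl fun l _ => by
      simp only [conj_trivial]; ring
  rw [h, Matrix.det_mul, Matrix.det_mul, Matrix.det_transpose, LinearMap.det_toMatrix]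
  ring

variable {n : ℕ} {M : Type*} [TopologicalSpace M]
  [ChartedSpace (EuclideanSpace ℝ (Fin (2 * n))) M] [IsManifold (𝓡 (2 * n)) ∞ M]
  [RiemannianBundle (fun x : M => TangentSpace (𝓡 (2 * n)) x)]

theorem differentiableAt_coordChange {a b x : M} (ha : x ∈ (extChartAt (𝓡 (2 * n)) a).source)
    (hb : x ∈ (extChartAt (𝓡 (2 * n)) b).source) :
    DifferentiableAt ℝ (extChartAt (𝓡 (2 * n)) a ∘ (extChartAt (𝓡 (2 * n)) b).symm)
      (extChartAt (𝓡 (2 * n)) b x) := by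
  rw [← mdifferentiableAt_iff_differentiableAt]
  refine MDifferentiableAt.comp _ (I' := 𝓡 (2 * n)) ?_
    (mdifferentiableAt_chart_symm ((extChartAt (𝓡 (2 * n)) b).map_source hb))
  rw [(extChartAt (𝓡 (2 * n)) b).left_inv hb]
  exact mdifferentiableAt_extChartAt (by simpa using ha)

theorem coordField_coordChange {a b x : M} (ha : x ∈ (extChartAt (𝓡 (2 * n)) a).source)
    (hb : x ∈ (extChartAt (𝓡 (2 * n)) b).source) (i : Fin (2 * n)) :
    coordField b i x = mfderiv 𝓘(ℝ, EuclideanSpace ℝ (Fin (2 * n))) (𝓡 (2 * n))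
      (extChartAt (𝓡 (2 * n)) a).symm (extChartAt (𝓡 (2 * n)) a x)
      (fderiv ℝ (extChartAt (𝓡 (2 * n)) a ∘ (extChartAt (𝓡 (2 * n)) b).symm)
        (extChartAt (𝓡 (2 * n)) b x) (EuclideanSpace.basisFun (Fin (2 * n)) ℝ i)) := by
  rw [coordField_eq_mfderiv hb]
  have hd := differentiableAt_coordChange ha hb
  set φ := extChartAt (𝓡 (2 * n)) a
  set ψ := extChartAt (𝓡 (2 * n)) b
  have hx : (φ ∘ ψ.symm) (ψ x) = φ x := congrArg φ (ψ.left_inv hb)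
  have hev : ψ.symm =ᶠ[𝓝 (ψ x)] φ.symm ∘ (φ ∘ ψ.symm) := by
    have hc : ContinuousAt ψ.symm (ψ x) := continuousAt_extChartAt_symm' hb
    have : ψ.symm ⁻¹' φ.source ∈ 𝓝 (ψ x) := hc.preimage_mem_nhds (by
      rw [ψ.left_inv hb]; exact (isOpen_extChartAt_source a).mem_nhds ha)
    filter_upwards [this] with y hy
    exact (φ.left_inv hy).symm
  have hs : MDifferentiableAt 𝓘(ℝ, EuclideanSpace ℝ (Fin (2 * n))) (𝓡 (2 * n)) φ.symm
      ((φ ∘ ψ.symm) (ψ x)) := by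
    rw [hx]; exact mdifferentiableAt_chart_symm (φ.map_source ha)
  rw [hev.mfderiv_eq, mfderiv_comp (I' := 𝓘(ℝ, EuclideanSpace ℝ (Fin (2 * n)))) _ hs
      hd.mdifferentiableAt, mfderiv_eq_fderiv, ← hx]
  rfl

theorem coordDensity_coordChange {a b x : M} (ha : x ∈ (extChartAt (𝓡 (2 * n)) a).source)
    (hb : x ∈ (extChartAt (𝓡 (2 * n)) b).source) :
    coordDensity n b x
      = |(fderiv ℝ (extChartAt (𝓡 (2 * n)) a ∘ (extChartAt (𝓡 (2 * n)) b).symm)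
          (extChartAt (𝓡 (2 * n)) b x)).det| * coordDensity n a x := by
  have h := det_gram_comp (V := TangentSpace (𝓡 (2 * n)) x)
    (mfderiv 𝓘(ℝ, EuclideanSpace ℝ (Fin (2 * n))) (𝓡 (2 * n))
      (extChartAt (𝓡 (2 * n)) a).symm (extChartAt (𝓡 (2 * n)) a x)).toLinearMap
    (fderiv ℝ (extChartAt (𝓡 (2 * n)) a ∘ (extChartAt (𝓡 (2 * n)) b).symm)
        (extChartAt (𝓡 (2 * n)) b x)).toLinearMap
  have h1 : (Matrix.of fun i j : Fin (2 * n) => inner ℝ (coordField b i x) (coordField b j x)).det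
      = (fderiv ℝ (extChartAt (𝓡 (2 * n)) a ∘ (extChartAt (𝓡 (2 * n)) b).symm)
          (extChartAt (𝓡 (2 * n)) b x)).det ^ 2 *
        (Matrix.of fun i j : Fin (2 * n) =>
          inner ℝ (coordField a i x) (coordField a j x)).det := by
    simp only [coordField_coordChange ha hb]
    simp only [coordField_eq_mfderiv ha]
    exact h
  rw [coordDensity, h1, Real.sqrt_mul (sq_nonneg _), Real.sqrt_sq_eq_abs]
  rfl

variable [MeasurableSpace M] [BorelSpace M]

theorem chart_image_eq {a : M} {T : Set M} (hT : T ⊆ (extChartAt (𝓡 (2 * n)) a).source) :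
    extChartAt (𝓡 (2 * n)) a '' T
      = (extChartAt (𝓡 (2 * n)) a).target ∩ (extChartAt (𝓡 (2 * n)) a).symm ⁻¹' T := by
  have h := (extChartAt (𝓡 (2 * n)) a).image_eq_target_inter_inv_preimage hT
  exact h

theorem aemeasurable_chart_symm (a : M) :
    AEMeasurable (extChartAt (𝓡 (2 * n)) a).symm
      (volume.restrict (extChartAt (𝓡 (2 * n)) a).target) :=
  (continuousOn_extChartAt_symm a).aemeasurable (isOpen_chartTarget a).measurableSet

theorem measurableSet_chart_image {a : M} {T : Set M} (hTm : MeasurableSet T)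
    (hT : T ⊆ (extChartAt (𝓡 (2 * n)) a).source) :
    MeasurableSet (extChartAt (𝓡 (2 * n)) a '' T) := by
  rw [chart_image_eq hT]
  have h := (continuousOn_iff_continuous_domRestrict.1
    (continuousOn_extChartAt_symm (I := 𝓡 (2 * n)) a)).measurable hTm
  have h2 := (isOpen_chartTarget a).measurableSet.subtype_image h
  convert h2 using 1
  ext y
  simp [and_comm]

theorem chartVolume_apply {a : M} {T : Set M} (hTm : MeasurableSet T)
    (hT : T ⊆ (extChartAt (𝓡 (2 * n)) a).source) :
    chartVolume n a T = ∫⁻ y in extChartAt (𝓡 (2 * n)) a '' T, ENNReal.ofReal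
      (coordDensity n a ((extChartAt (𝓡 (2 * n)) a).symm y)) := by
  have hm := measurableSet_chart_image hTm hT
  rw [chart_image_eq hT] at hm ⊢
  rw [chartVolume, Measure.map_apply_of_aemeasurable
    ((aemeasurable_chart_symm a).mono_ac (withDensity_absolutelyContinuous _ _)) hTm]
  rw [withDensity_apply', Measure.restrict_restrict' (isOpen_chartTarget a).measurableSet,
    Set.inter_comm]
  exact setLIntegral_congr_fun hm fun y hy => by rw [chartDensity_eq hy.1]

/-- By the change of variables formula the Jacobian of the transition map is exactly the ratio of
the two densities. -/
theorem chartVolume_coordChange {a b : M} {T : Set M} (hTm : MeasurableSet T)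
    (ha : T ⊆ (extChartAt (𝓡 (2 * n)) a).source) (hb : T ⊆ (extChartAt (𝓡 (2 * n)) b).source) :
    chartVolume n a T = chartVolume n b T := by
  have himg : extChartAt (𝓡 (2 * n)) a '' T
      = (extChartAt (𝓡 (2 * n)) a ∘ (extChartAt (𝓡 (2 * n)) b).symm)
        '' (extChartAt (𝓡 (2 * n)) b '' T) := by
    rw [Set.image_image]
    exact Set.image_congr fun x hx => congrArg (extChartAt (𝓡 (2 * n)) a)
      ((extChartAt (𝓡 (2 * n)) b).left_inv (hb hx)).symm
  rw [chartVolume_apply hTm ha, chartVolume_apply hTm hb, himg,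
    lintegral_image_eq_lintegral_abs_det_fderiv_mul volume (measurableSet_chart_image hTm hb)
      (f' := fderiv ℝ (extChartAt (𝓡 (2 * n)) a ∘ (extChartAt (𝓡 (2 * n)) b).symm))]
  · refine setLIntegral_congr_fun (measurableSet_chart_image hTm hb) ?_
    rintro _ ⟨x, hx, rfl⟩
    simp only [Function.comp_apply]
    rw [(extChartAt (𝓡 (2 * n)) b).left_inv (hb hx), (extChartAt (𝓡 (2 * n)) a).left_inv (ha hx),
      coordDensity_coordChange (ha hx) (hb hx), ENNReal.ofReal_mul (abs_nonneg _)]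
  · rintro _ ⟨x, hx, rfl⟩
    exact (differentiableAt_coordChange (ha hx) (hb hx)).hasFDerivAt.hasFDerivWithinAt
  · rintro _ ⟨x, hx, rfl⟩ _ ⟨y, hy, rfl⟩ h
    simp only [Function.comp_apply] at h
    rw [(extChartAt (𝓡 (2 * n)) b).left_inv (hb hx), (extChartAt (𝓡 (2 * n)) b).left_inv (hb hy)] at h
    rw [(extChartAt (𝓡 (2 * n)) a).injOn (ha hx) (ha hy) h]

theorem chartVolume_compl_source (a : M) :
    chartVolume n a (extChartAt (𝓡 (2 * n)) a).sourceᶜ = 0 := by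
  rw [chartVolume, Measure.map_apply_of_aemeasurable
    ((aemeasurable_chart_symm a).mono_ac (withDensity_absolutelyContinuous _ _))
    (isOpen_extChartAt_source a).measurableSet.compl]
  refine withDensity_absolutelyContinuous _ _ ?_
  rw [Measure.restrict_apply' (isOpen_chartTarget a).measurableSet]
  convert measure_empty (μ := (volume : Measure (EuclideanSpace ℝ (Fin (2 * n)))))
  ext y
  simp only [Set.mem_inter_iff, Set.mem_preimage, Set.mem_compl_iff, Set.mem_empty_iff_false,
    iff_false, not_and]
  exact fun h1 h2 => h1 ((extChartAt (𝓡 (2 * n)) a).map_target h2)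

theorem restrict_chartVolume_coordChange (a b : M) :
    (chartVolume n a).restrict
        ((extChartAt (𝓡 (2 * n)) a).source ∩ (extChartAt (𝓡 (2 * n)) b).source)
      = (chartVolume n b).restrict
        ((extChartAt (𝓡 (2 * n)) a).source ∩ (extChartAt (𝓡 (2 * n)) b).source) := by
  have hm := ((isOpen_extChartAt_source (I := 𝓡 (2 * n)) a).inter
    (isOpen_extChartAt_source (I := 𝓡 (2 * n)) b)).measurableSet
  ext T hT
  rw [Measure.restrict_apply hT, Measure.restrict_apply hT]
  exact chartVolume_coordChange (hT.inter hm) (fun x hx => hx.2.1) fun x hx => hx.2.2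

variable [CompactSpace M] [T2Space M]

theorem exists_finset_chartPartition :
    ∃ t : Finset M, (∀ a ∉ t, ∀ x, chartPartition n M a x = 0) ∧
      ∀ x, ∑ a ∈ t, chartPartition n M a x = 1 := by
  have hfin := (chartPartition n M).locallyFinite.finite_nonempty_of_compact
  have h0 : ∀ a ∉ hfin.toFinset, ∀ x, chartPartition n M a x = 0 := fun a ha x => by
    by_contra hx
    exact ha (hfin.mem_toFinset.2 ⟨x, hx⟩)
  refine ⟨hfin.toFinset, h0, fun x => ?_⟩
  rw [← (chartPartition n M).sum_eq_one (Set.mem_univ x)]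
  exact (finsum_eq_sum_of_support_subset _ fun a ha => by
    by_contra h
    exact ha (h0 a h x)).symm

theorem tsupport_chartPartition (a : M) :
    tsupport (chartPartition n M a) ⊆ (extChartAt (𝓡 (2 * n)) a).source := by
  rw [extChartAt_source]
  exact (SmoothPartitionOfUnity.exists_isSubordinate_chartAt_source (𝓡 (2 * n)) M).choose_spec a

/-- On the domain of a chart the Riemannian volume is the volume of the chart. -/
theorem restrict_riemannianVolume (b : M) :
    (riemannianVolume n M).restrict (extChartAt (𝓡 (2 * n)) b).source = chartVolume n b := by
  obtain ⟨t, ht0, ht1⟩ := exists_finset_chartPartition (n := n) (M := M)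
  have hSm := fun a => (isOpen_extChartAt_source (I := 𝓡 (2 * n)) (a : M)).measurableSet
  ext T hT
  have hχ : ∀ a, Measurable fun x => ENNReal.ofReal (chartPartition n M a x) := fun a =>
    ((chartPartition n M a).contMDiff.continuous.measurable).ennreal_ofReal
  have hzero : ∀ a, ∀ x ∉ (extChartAt (𝓡 (2 * n)) a).source, chartPartition n M a x = 0 :=
    fun a x hx => image_eq_zero_of_notMem_tsupport fun h => hx (tsupport_chartPartition a h)
  have hTb := hT.inter (hSm b)
  rw [Measure.restrict_apply hT, riemannianVolume, Measure.sum_apply _ hTb]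
  -- The a-th weight vanishes outside the a-th chart domain, and on the overlap with the b-th domain
  -- the two chart volumes coincide. So each summand may be computed with the volume of chart b, and
  -- the weights then add up to 1.
  have h1 : ∀ a, ((chartVolume n a).withDensity fun x => ENNReal.ofReal (chartPartition n M a x))
      (T ∩ (extChartAt (𝓡 (2 * n)) b).source)
      = ∫⁻ x in T, ENNReal.ofReal (chartPartition n M a x) ∂(chartVolume n b) := fun a => by
    have key : ∀ (μ : Measure M) (S : Set M), MeasurableSet S →
        ∫⁻ x in S, ENNReal.ofReal (chartPartition n M a x) ∂μ
          = ∫⁻ x in S ∩ (extChartAt (𝓡 (2 * n)) a).source,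
            ENNReal.ofReal (chartPartition n M a x) ∂μ := fun μ S hS => by
      rw [Set.inter_comm, ← setLIntegral_indicator (hSm a)]
      refine lintegral_congr fun x => ?_
      by_cases hx : x ∈ (extChartAt (𝓡 (2 * n)) a).source
      · rw [Set.indicator_of_mem hx]
      · rw [Set.indicator_of_notMem hx, hzero a x hx, ENNReal.ofReal_zero]
    rw [withDensity_apply _ hTb, key _ _ hTb, Set.inter_assoc, Set.inter_comm _ ((extChartAt (𝓡 (2 * n)) a).source),
      ← Measure.restrict_restrict hT, restrict_chartVolume_coordChange,
      Measure.restrict_restrict hT, Set.inter_comm ((extChartAt (𝓡 (2 * n)) a).source),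
      ← Set.inter_assoc, ← key _ _ hTb]
    exact setLIntegral_congr (inter_ae_eq_left_of_ae_eq_univ
      (ae_eq_univ.2 (chartVolume_compl_source b)))
  simp only [h1]
  rw [tsum_eq_sum (s := t) fun a ha => by simp [ht0 a ha], ← lintegral_finsetSum t fun a _ => hχ a]
  have h2 : ∀ x, ∑ a ∈ t, ENNReal.ofReal (chartPartition n M a x) = 1 := fun x => by
    rw [← ENNReal.ofReal_sum_of_nonneg fun a _ => (chartPartition n M).nonneg a x, ht1,
      ENNReal.ofReal_one]
  simp [h2]

variable [IsContMDiffRiemannianBundle (𝓡 (2 * n)) ∞ (EuclideanSpace ℝ (Fin (2 * n)))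
      (fun x : M => TangentSpace (𝓡 (2 * n)) x)]

theorem continuousOn_coordDensity_chart (a : M) :
    ContinuousOn (fun y => coordDensity n a ((extChartAt (𝓡 (2 * n)) a).symm y))
      (extChartAt (𝓡 (2 * n)) a).target :=
  (smoothFun_coordDensity (n := n) a).continuousOn.comp (continuousOn_extChartAt_symm a)
    fun _ hy => (extChartAt (𝓡 (2 * n)) a).map_target hy

/-- A compact neighbourhood inside a chart has finite volume because the density is continuous on
its image; compactness of M does the rest. -/
instance isFiniteMeasure_riemannianVolume : IsFiniteMeasure (riemannianVolume n M) := by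
  have : LocallyCompactSpace M := inferInstance
  have : IsLocallyFiniteMeasure (riemannianVolume n M) := by
    refine ⟨fun x => ?_⟩
    obtain ⟨K, hK, hKS, hKc⟩ := local_compact_nhds
      ((isOpen_extChartAt_source (I := 𝓡 (2 * n)) x).mem_nhds (mem_extChartAt_source x))
    refine ⟨K, hK, ?_⟩
    have h1 : riemannianVolume n M K = chartVolume n x K := by
      rw [← restrict_riemannianVolume x, Measure.restrict_eq_self _ hKS]
    have h2 : IsCompact (extChartAt (𝓡 (2 * n)) x '' K) :=
      hKc.image_of_continuousOn ((continuousOn_extChartAt x).mono hKS)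
    rw [h1, chartVolume_apply hKc.measurableSet hKS]
    refine Integrable.lintegral_lt_top (ContinuousOn.integrableOn_compact h2 ?_)
    refine (continuousOn_coordDensity_chart x).mono ?_
    rintro _ ⟨z, hz, rfl⟩
    exact (extChartAt (𝓡 (2 * n)) x).map_source (hKS hz)
  infer_instance

theorem integrable_of_continuous {f : M → ℝ} (hf : Continuous f) :
    Integrable f (riemannianVolume n M) :=
  hf.integrable_of_hasCompactSupport (HasCompactSupport.of_compactSpace f)

theorem integral_eq_integral_chart {g : M → ℝ} (hg : Measurable g) (a : M)
    (h0 : ∀ x ∉ (extChartAt (𝓡 (2 * n)) a).source, g x = 0) :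
    ∫ x, g x ∂(riemannianVolume n M) = ∫ y in (extChartAt (𝓡 (2 * n)) a).target,
      coordDensity n a ((extChartAt (𝓡 (2 * n)) a).symm y)
        * g ((extChartAt (𝓡 (2 * n)) a).symm y) := by
  have hm := (isOpen_chartTarget (n := n) a).measurableSet
  rw [← setIntegral_eq_integral_of_forall_compl_eq_zero h0, restrict_riemannianVolume, chartVolume,
    integral_map ((aemeasurable_chart_symm a).mono_ac (withDensity_absolutelyContinuous _ _))
      hg.aestronglyMeasurable, integral_withDensity_eq_integral_toReal_smul₀]
  · refine setIntegral_congr_fun hm fun y hy => ?_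
    simp only [smul_eq_mul]
    rw [chartDensity_eq hy, ENNReal.toReal_ofReal
      (coordDensity_pos ((extChartAt (𝓡 (2 * n)) a).map_target hy)).le]
  · refine AEMeasurable.ennreal_ofReal (((continuousOn_coordDensity_chart a).aemeasurable hm).congr ?_)
    filter_upwards [ae_restrict_mem hm] with y hy
    rw [chartDensity_eq hy]
  · exact Filter.Eventually.of_forall fun _ => ENNReal.ofReal_lt_top

/-- Integration by parts against the constant function 1. -/
theorem integral_fderiv_apply_eq_zero {m : ℕ} {g : EuclideanSpace ℝ (Fin m) → ℝ}
    (hg : ContDiff ℝ 1 g) (hc : HasCompactSupport g) (v : EuclideanSpace ℝ (Fin m)) :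
    Integrable (fun y => fderiv ℝ g y v) ∧ ∫ y, fderiv ℝ g y v = 0 := by
  have hd : Integrable (fun y => fderiv ℝ g y v) :=
    ((hg.continuous_fderiv one_ne_zero).clm_apply continuous_const).integrable_of_hasCompactSupport
      (hc.fderiv_apply ℝ v)
  refine ⟨hd, ?_⟩
  have h := integral_mul_fderiv_eq_neg_fderiv_mul_of_integrable (μ := volume) (v := v)
    (f := fun _ : EuclideanSpace ℝ (Fin m) => (1 : ℝ)) (g := g) (by simp) (by simpa using hd)
    (by simpa using hg.continuous.integrable_of_hasCompactSupport hc)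
    (fun _ _ => differentiableAt_const _) (fun x _ => hg.differentiable one_ne_zero x)
  simpa using h

end Volume

/-! ### The divergence theorem -/

section DivergenceTheorem

variable {n : ℕ} {M : Type*} [TopologicalSpace M]
  [ChartedSpace (EuclideanSpace ℝ (Fin (2 * n))) M] [IsManifold (𝓡 (2 * n)) ∞ M]

/-- The coefficients of a vector field with respect to the coordinate fields. -/
def coordCoeff (a : M) (Y : ∀ x : M, TangentSpace (𝓡 (2 * n)) x) (i : Fin (2 * n)) (x : M) : ℝ :=
  (trivializationAt (EuclideanSpace ℝ (Fin (2 * n))) (fun x : M => TangentSpace (𝓡 (2 * n)) x) a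
    ⟨x, Y x⟩).2 i

theorem smoothFun_coordCoeff (a : M) {Y : ∀ x : M, TangentSpace (𝓡 (2 * n)) x}
    (hY : SmoothField Y (extChartAt (𝓡 (2 * n)) a).source) (i : Fin (2 * n)) :
    SmoothFun n (coordCoeff a Y i) (extChartAt (𝓡 (2 * n)) a).source := by
  rw [extChartAt_source] at hY ⊢
  exact (EuclideanSpace.proj (𝕜 := ℝ) i).contMDiff.comp_contMDiffOn
    (((trivializationAt (EuclideanSpace ℝ (Fin (2 * n))) (fun x : M => TangentSpace (𝓡 (2 * n)) x)
      a).contMDiffOn_section_baseSet_iff).1 hY)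

theorem coordCoeff_eq_repr {a : M} (Y : ∀ x : M, TangentSpace (𝓡 (2 * n)) x) {x : M}
    (hx : x ∈ (extChartAt (𝓡 (2 * n)) a).source) (i : Fin (2 * n)) :
    coordCoeff a Y i x = (coordBasis hx).repr (Y x) i :=
  rfl

theorem sum_coordCoeff (a : M) (Y : ∀ x : M, TangentSpace (𝓡 (2 * n)) x) {x : M}
    (hx : x ∈ (extChartAt (𝓡 (2 * n)) a).source) :
    Y x = ∑ i, coordCoeff a Y i x • coordField a i x := by
  simp only [coordCoeff_eq_repr Y hx, ← coordBasis_apply hx]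
  exact ((coordBasis hx).sum_repr (Y x)).symm

theorem contDiffAt_comp_chart_symm {f : M → ℝ} {a : M}
    (hf : SmoothFun n f (extChartAt (𝓡 (2 * n)) a).source) {y : EuclideanSpace ℝ (Fin (2 * n))}
    (hy : y ∈ (extChartAt (𝓡 (2 * n)) a).target) :
    ContDiffAt ℝ ∞ (f ∘ (extChartAt (𝓡 (2 * n)) a).symm) y := by
  rw [← contMDiffAt_iff_contDiffAt]
  refine ContMDiffAt.comp y (I' := 𝓡 (2 * n)) ?_ ?_
  · exact hf.contMDiffAt ((isOpen_extChartAt_source a).mem_nhds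
      ((extChartAt (𝓡 (2 * n)) a).map_target hy))
  · exact (contMDiffOn_extChartAt_symm a).contMDiffAt ((isOpen_chartTarget a).mem_nhds hy)

/-- The support lies in the image of K, which is compact and contained in the open chart target, so
extension by zero creates no singularity at the edge of the target. -/
theorem contDiff_indicator_chart {f : M → ℝ} {a : M}
    (hf : SmoothFun n f (extChartAt (𝓡 (2 * n)) a).source) {K : Set M} (hK : IsCompact K)
    (hKS : K ⊆ (extChartAt (𝓡 (2 * n)) a).source)
    (h0 : ∀ x ∈ (extChartAt (𝓡 (2 * n)) a).source, x ∉ K → f x = 0) :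
    ContDiff ℝ ∞ ((extChartAt (𝓡 (2 * n)) a).target.indicator
      (f ∘ (extChartAt (𝓡 (2 * n)) a).symm)) ∧
    HasCompactSupport ((extChartAt (𝓡 (2 * n)) a).target.indicator
      (f ∘ (extChartAt (𝓡 (2 * n)) a).symm)) := by
  have hc : IsCompact (extChartAt (𝓡 (2 * n)) a '' K) :=
    hK.image_of_continuousOn ((continuousOn_extChartAt a).mono hKS)
  have hz : ∀ y ∉ extChartAt (𝓡 (2 * n)) a '' K, (extChartAt (𝓡 (2 * n)) a).target.indicator
      (f ∘ (extChartAt (𝓡 (2 * n)) a).symm) y = 0 := fun y hy => by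
    rw [Set.indicator_apply_eq_zero]
    exact fun hyt => h0 _ ((extChartAt (𝓡 (2 * n)) a).map_target hyt) fun hK' => hy ⟨_, hK', (extChartAt (𝓡 (2 * n)) a).right_inv hyt⟩
  refine ⟨contDiff_iff_contDiffAt.2 fun y => ?_, HasCompactSupport.intro hc hz⟩
  by_cases hy : y ∈ (extChartAt (𝓡 (2 * n)) a).target
  · refine (contDiffAt_comp_chart_symm hf hy).congr_of_eventuallyEq ?_
    filter_upwards [(isOpen_chartTarget a).mem_nhds hy] with z hz
    rw [Set.indicator_of_mem hz]
  · have hy' : y ∉ extChartAt (𝓡 (2 * n)) a '' K := by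
      rintro ⟨x, hx, rfl⟩
      exact hy ((extChartAt (𝓡 (2 * n)) a).map_source (hKS hx))
    refine (contDiffAt_const (c := (0 : ℝ))).congr_of_eventuallyEq ?_
    filter_upwards [hc.isClosed.isOpen_compl.mem_nhds hy'] with z hz'
    exact hz z hz'

variable [RiemannianBundle (fun x : M => TangentSpace (𝓡 (2 * n)) x)]
  [T2Space M] [IsContMDiffRiemannianBundle (𝓡 (2 * n)) ∞ (EuclideanSpace ℝ (Fin (2 * n)))
      (fun x : M => TangentSpace (𝓡 (2 * n)) x)]
  {nablaM : CovariantDerivative (𝓡 (2 * n)) (EuclideanSpace ℝ (Fin (2 * n)))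
      (fun x : M => TangentSpace (𝓡 (2 * n)) x)}

theorem continuous_divergence (hn : 0 < n) (hM : IsLeviCivita nablaM)
    {Y : ∀ x : M, TangentSpace (𝓡 (2 * n)) x} (hY : SmoothField Y Set.univ) :
    Continuous (divergence nablaM Y) := by
  rw [continuous_iff_continuousAt]
  intro a
  have hO := isOpen_extChartAt_source (I := 𝓡 (2 * n)) a
  have ha := mem_extChartAt_source (I := 𝓡 (2 * n)) a
  have hf := smoothFun_coordCoeff a (hY.mono (Set.subset_univ _))
  have hρ := smoothFun_coordDensity (n := n) a
  have h1 : ContinuousOn (fun x => (coordDensity n a x)⁻¹ * ∑ i, mvfderiv (𝓡 (2 * n))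
      (fun y => coordCoeff a Y i y * coordDensity n a y) x (coordField a i x))
      (extChartAt (𝓡 (2 * n)) a).source :=
    (hρ.continuousOn.inv₀ fun x hx => (coordDensity_pos hx).ne').mul
      (continuousOn_finsetSum _ fun i _ => (SmoothFun.mvfderiv_apply hO
        (ContMDiffOn.mul (hf i) hρ) (smoothField_coordField a i)).continuousOn)
  refine (h1.congr fun x hx => ?_).continuousAt (hO.mem_nhds ha)
  rw [← divergence_coord hn hM hf (fun y hy => sum_coordCoeff a Y hy) hx,
    inv_mul_cancel_left₀ (coordDensity_pos hx).ne']

variable [MeasurableSpace M] [BorelSpace M] [CompactSpace M]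

/-- In the chart, density times divergence is a sum of coordinate derivatives of compactly supported
smooth functions, each with integral zero. -/
theorem integral_divergence_of_subset_source (hn : 0 < n) (hM : IsLeviCivita nablaM) {a : M}
    {Y : ∀ x : M, TangentSpace (𝓡 (2 * n)) x} (hY : SmoothField Y Set.univ) {K : Set M}
    (hK : IsClosed K) (hKS : K ⊆ (extChartAt (𝓡 (2 * n)) a).source) (h0 : ∀ x ∉ K, Y x = 0) :
    ∫ x, divergence nablaM Y x ∂(riemannianVolume n M) = 0 := by
  have hO := isOpen_extChartAt_source (I := 𝓡 (2 * n)) a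
  have hf := smoothFun_coordCoeff a (hY.mono (Set.subset_univ _))
  have hρ := smoothFun_coordDensity (n := n) a
  have hdiv0 : ∀ x ∉ K, divergence nablaM Y x = 0 := fun x hx => by
    -- On the open complement of K the field is an empty sum, so its divergence vanishes there.
    rw [divergence_sum_smul (∅ : Finset Empty) (f := fun _ _ => 0) (X := fun _ _ => 0)
      hK.isOpen_compl (by simp) (by simp) (fun y hy => by simpa using h0 y hy) hx]
    simp
  rw [integral_eq_integral_chart (continuous_divergence hn hM hY).measurable a
    fun x hx => hdiv0 x fun h => hx (hKS h)]
  set g : Fin (2 * n) → EuclideanSpace ℝ (Fin (2 * n)) → ℝ := fun i =>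
    (extChartAt (𝓡 (2 * n)) a).target.indicator
      ((fun x => coordCoeff a Y i x * coordDensity n a x) ∘ (extChartAt (𝓡 (2 * n)) a).symm)
  have hfρ : ∀ i, SmoothFun n (fun x => coordCoeff a Y i x * coordDensity n a x)
      (extChartAt (𝓡 (2 * n)) a).source := fun i => ContMDiffOn.mul (hf i) hρ
  have hgc := fun i => contDiff_indicator_chart (hfρ i) hK.isCompact hKS fun x hx hxK => by
    rw [coordCoeff_eq_repr Y hx, h0 x hxK, map_zero, Finsupp.zero_apply, zero_mul]
  have hgint := fun i => integral_fderiv_apply_eq_zero ((hgc i).1.of_le (by simp)) (hgc i).2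
    (EuclideanSpace.basisFun (Fin (2 * n)) ℝ i)
  have hsum : ∀ y ∈ (extChartAt (𝓡 (2 * n)) a).target,
      coordDensity n a ((extChartAt (𝓡 (2 * n)) a).symm y)
        * divergence nablaM Y ((extChartAt (𝓡 (2 * n)) a).symm y)
      = ∑ i, fderiv ℝ (g i) y (EuclideanSpace.basisFun (Fin (2 * n)) ℝ i) := fun y hy => by
    have hx := (extChartAt (𝓡 (2 * n)) a).map_target hy
    rw [divergence_coord hn hM hf (fun y hy => sum_coordCoeff a Y hy) hx]
    refine Finset.sum_congr rfl fun i _ => ?_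
    have h := (hasFDerivAt_comp_chart_symm hy ((hfρ i).diffAt hO hx)).2 i
    rw [← h]
    refine congrArg (fun T : EuclideanSpace ℝ (Fin (2 * n)) →L[ℝ] ℝ =>
      T (EuclideanSpace.basisFun (Fin (2 * n)) ℝ i)) (Filter.EventuallyEq.fderiv_eq ?_)
    filter_upwards [(isOpen_chartTarget a).mem_nhds hy] with z hz
    exact (Set.indicator_of_mem hz _).symm
  have hout : ∀ y ∉ (extChartAt (𝓡 (2 * n)) a).target,
      ∑ i, fderiv ℝ (g i) y (EuclideanSpace.basisFun (Fin (2 * n)) ℝ i) = 0 := fun y hy =>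
    Finset.sum_eq_zero fun i _ => by
      have hy' : y ∉ tsupport (g i) := fun h => hy (by
        have hc : IsCompact (extChartAt (𝓡 (2 * n)) a '' K) :=
          hK.isCompact.image_of_continuousOn ((continuousOn_extChartAt a).mono hKS)
        have hsub : tsupport (g i) ⊆ extChartAt (𝓡 (2 * n)) a '' K := by
          refine closure_minimal (fun z hz => ?_) hc.isClosed
          by_contra hzK
          have hzt : z ∈ (extChartAt (𝓡 (2 * n)) a).target := by
            by_contra hzt
            exact hz (Set.indicator_of_notMem hzt _)
          have hzS := (extChartAt (𝓡 (2 * n)) a).map_target hzt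
          refine hz ((Set.indicator_of_mem hzt _).trans ?_)
          rw [Function.comp_apply, coordCoeff_eq_repr Y hzS, h0 _ fun h => hzK
            ⟨_, h, (extChartAt (𝓡 (2 * n)) a).right_inv hzt⟩, map_zero, Finsupp.zero_apply, zero_mul]
        obtain ⟨x, hx, rfl⟩ := hsub h
        exact (extChartAt (𝓡 (2 * n)) a).map_source (hKS hx))
      rw [fderiv_of_notMem_tsupport (𝕜 := ℝ) hy']
      rfl
  rw [setIntegral_congr_fun (isOpen_chartTarget a).measurableSet hsum,
    setIntegral_eq_integral_of_forall_compl_eq_zero hout, integral_finsetSum _ fun i _ => (hgint i).1]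
  exact Finset.sum_eq_zero fun i _ => (hgint i).2

/-- The divergence theorem on a closed manifold. -/
theorem integral_divergence (hn : 0 < n) (hM : IsLeviCivita nablaM)
    {Y : ∀ x : M, TangentSpace (𝓡 (2 * n)) x} (hY : SmoothField Y Set.univ) :
    ∫ x, divergence nablaM Y x ∂(riemannianVolume n M) = 0 := by
  obtain ⟨t, -, ht1⟩ := exists_finset_chartPartition (n := n) (M := M)
  have hχ : ∀ a, SmoothFun n (chartPartition n M a) Set.univ := fun a =>
    (chartPartition n M a).contMDiff.contMDiffOn
  have hχY : ∀ a, SmoothField (fun x => chartPartition n M a x • Y x) Set.univ := fun a =>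
    (hχ a).smul_section hY
  have hsum : ∀ x, divergence nablaM Y x
      = ∑ a ∈ t, divergence nablaM (fun x => chartPartition n M a x • Y x) x := fun x => by
    -- Y is the sum of the χ_a Y with constant coefficients 1, so no derivative of a coefficient
    -- enters.
    rw [divergence_sum_smul t (f := fun _ _ => 1)
      (X := fun a x => chartPartition n M a x • Y x) isOpen_univ
      (fun _ _ => contMDiffOn_const) (fun a _ => hχY a)
      (fun y _ => by simp only [one_smul]; rw [← Finset.sum_smul, ht1, one_smul]) (Set.mem_univ x)]
    refine Finset.sum_congr rfl fun a _ => ?_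
    simp [mvfderiv]
  simp only [hsum]
  rw [integral_finsetSum _ fun a _ => integrable_of_continuous (continuous_divergence hn hM (hχY a))]
  refine Finset.sum_eq_zero fun a _ => integral_divergence_of_subset_source hn hM (hχY a)
    (isClosed_tsupport _) (tsupport_chartPartition a) fun x hx => ?_
  rw [image_eq_zero_of_notMem_tsupport hx, zero_smul]

end DivergenceTheorem

/-! ### The Weitzenböck formula for twisted Dirac operators -/

section TwistedDirac

variable {n : ℕ} {M : Type*} [TopologicalSpace M]
  [ChartedSpace (EuclideanSpace ℝ (Fin (2 * n))) M] [IsManifold (𝓡 (2 * n)) ∞ M] [T2Space M]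
  [RiemannianBundle (fun x : M => TangentSpace (𝓡 (2 * n)) x)]
  [IsContMDiffRiemannianBundle (𝓡 (2 * n)) ∞ (EuclideanSpace ℝ (Fin (2 * n)))
      (fun x : M => TangentSpace (𝓡 (2 * n)) x)]
  {F : Type*} [NormedAddCommGroup F] [NormedSpace ℂ F] [FiniteDimensional ℂ F]
  {E : M → Type*} [∀ x, NormedAddCommGroup (E x)] [∀ x, InnerProductSpace ℂ (E x)]
  [TopologicalSpace (TotalSpace F E)] [FiberBundle F E] [VectorBundle ℂ F E]
  [VectorBundle ℝ F E] [ContMDiffVectorBundle ∞ F E (𝓡 (2 * n))]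
  {L : M → Type*} [∀ x, NormedAddCommGroup (L x)] [∀ x, InnerProductSpace ℂ (L x)]
  [TopologicalSpace (TotalSpace ℂ L)] [FiberBundle ℂ L] [VectorBundle ℂ ℂ L]
  [VectorBundle ℝ ℂ L] [ContMDiffVectorBundle ∞ ℂ L (𝓡 (2 * n))]

/-- A Hermitian Clifford module and a Hermitian line bundle, with their connections, over a
Riemannian manifold with its Levi-Civita connection. -/
structure IsTwistedCliffordModule
    (nablaM : CovariantDerivative (𝓡 (2 * n)) (EuclideanSpace ℝ (Fin (2 * n)))
      (fun x : M => TangentSpace (𝓡 (2 * n)) x)) (A : CliffordAction n F E)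
    (nablaE : CovariantDerivative (𝓡 (2 * n)) F E)
    (nablaL : CovariantDerivative (𝓡 (2 * n)) ℂ L) : Prop where
  pos : 0 < n
  leviCivita : IsLeviCivita nablaM
  smoothE : IsSmoothHermitian n F E
  smoothNablaE : nablaE.ContMDiffCovariantDerivative ∞
  hermitianE : IsHermitianConnection nablaE
  clifford : IsCliffordConnection nablaM A nablaE
  smoothL : IsSmoothHermitian n ℂ L
  smoothNablaL : nablaL.ContMDiffCovariantDerivative ∞
  hermitianL : IsHermitianConnection nablaL

variable {nablaM : CovariantDerivative (𝓡 (2 * n)) (EuclideanSpace ℝ (Fin (2 * n)))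
      (fun x : M => TangentSpace (𝓡 (2 * n)) x)} {A : CliffordAction n F E}
    {nablaE : CovariantDerivative (𝓡 (2 * n)) F E}
    {nablaL : CovariantDerivative (𝓡 (2 * n)) ℂ L}

namespace IsTwistedCliffordModule

theorem smoothForm (H : IsTwistedCliffordModule nablaM A nablaE nablaL) (k : ℕ) (x₀ : M) :
    SmoothForm (fun y => (k : ℂ) • connectionForm nablaL x₀ y)
      (trivializationAt ℂ L x₀).baseSet := by
  intro W X hW hWU hX
  have hθ : SmoothForm (connectionForm nablaL x₀) (trivializationAt ℂ L x₀).baseSet :=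
    smoothForm_connectionForm H.smoothL H.smoothNablaL x₀
  exact SmoothFun.complex_mul contMDiffOn_const (hθ hW hWU hX)

theorem isConnectionOn (H : IsTwistedCliffordModule nablaM A nablaE nablaL) (k : ℕ) (x₀ : M) :
    IsConnectionOn F (gaugeOp nablaE nablaL k x₀) (trivializationAt ℂ L x₀).baseSet :=
  isConnectionOn_twistedOp (isConnectionOn_connectionOp H.smoothNablaE _) (H.smoothForm k x₀)

theorem cliffordCompatible (H : IsTwistedCliffordModule nablaM A nablaE nablaL) (k : ℕ) (x₀ : M) :
    CliffordCompatible nablaM A (gaugeOp nablaE nablaL k x₀)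
      (trivializationAt ℂ L x₀).baseSet := by
  have h : CliffordCompatible nablaM A (connectionOp nablaE) (trivializationAt ℂ L x₀).baseSet := by
    intro W Y s x hW _ hY hs hx v
    exact H.clifford Y s x (hY.diffAt hW hx) (hs.diffAt hW hx) v
  intro W Y s x hW hWU hY hs hx v
  exact cliffordCompatible_twistedOp h hW hWU hY hs hx v

theorem metricCompatible (H : IsTwistedCliffordModule nablaM A nablaE nablaL) (k : ℕ) (x₀ : M) :
    MetricCompatible (F := F) (lineWeight L k x₀) (gaugeOp nablaE nablaL k x₀)
      (trivializationAt ℂ L x₀).baseSet := by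
  have h : MetricCompatible (F := F) (fun _ => 1) (connectionOp nablaE)
      (trivializationAt ℂ L x₀).baseSet := by
    intro W s t x hW _ hs ht hx
    simp only [Complex.ofReal_one, mul_one]
    exact ⟨SmoothFun.inner_section H.smoothE hW hs ht,
      fun v => H.hermitianE s t x (hs.diffAt hW hx) (ht.diffAt hW hx) v⟩
  intro W s t x hW hWU hs ht hx
  exact metricCompatible_twistedOp (trivializationAt ℂ L x₀).open_baseSet h
    (smoothFun_lineWeight H.smoothL k x₀)
    (fun x hx v => mvfderiv_lineWeight H.smoothL H.hermitianL k hx v) hW hWU hs ht hx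

variable {k : ℕ} {s t : ∀ x : M, Twist E L k x}

theorem twistCoord_dirac (H : IsTwistedCliffordModule nablaM A nablaE nablaL)
    (hs : IsSmoothTwist n F k s) {x₀ y : M} (hy : y ∈ (trivializationAt ℂ L x₀).baseSet) :
    twistCoord k x₀ y (dirac A nablaE nablaL k s y)
      = localDirac A (gaugeOp nablaE nablaL k x₀) (fun z => twistCoord k x₀ z (s z)) y := by
  simp only [dirac, localDirac, map_sum, twistClifford, twistCoord_rTensor]
  refine Finset.sum_congr rfl fun i _ => ?_
  rw [twistCoord_twistNabla H.smoothE H.hermitianE H.smoothL H.hermitianL hs hy]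
  rfl

theorem isSmoothTwist_dirac (H : IsTwistedCliffordModule nablaM A nablaE nablaL)
    (hs : IsSmoothTwist n F k s) : IsSmoothTwist n F k (dirac A nablaE nablaL k s) := fun x₀ =>
  SmoothOn.congr_eqOn ((H.isConnectionOn k x₀).smoothOn_localDirac (A := A)
    (trivializationAt ℂ L x₀).open_baseSet subset_rfl (hs x₀)) fun _ hy => H.twistCoord_dirac hs hy

theorem twistCoord_dirac_dirac (H : IsTwistedCliffordModule nablaM A nablaE nablaL)
    (hs : IsSmoothTwist n F k s) {x₀ y : M} (hy : y ∈ (trivializationAt ℂ L x₀).baseSet)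
    {ι : Type*} [Fintype ι] (b : OrthonormalBasis ι ℝ (TangentSpace (𝓡 (2 * n)) y)) :
    twistCoord k x₀ y (dirac A nablaE nablaL k (dirac A nablaE nablaL k s) y)
      = weitzenbock nablaM (gaugeOp nablaE nablaL k x₀) A (fun z => twistCoord k x₀ z (s z)) y
        - ∑ i, hessian nablaM (gaugeOp nablaE nablaL k x₀) (fun z => twistCoord k x₀ z (s z)) y
          (b i) (b i) := by
  have hU := (trivializationAt ℂ L x₀).open_baseSet
  have hD := H.isConnectionOn k x₀
  have hsm := hD.smoothOn_localDirac (A := A) hU subset_rfl (hs x₀)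
  have h1 : localDirac A (gaugeOp nablaE nablaL k x₀)
      (fun z => twistCoord k x₀ z (dirac A nablaE nablaL k s z)) y
      = localDirac A (gaugeOp nablaE nablaL k x₀) (localDirac A (gaugeOp nablaE nablaL k x₀)
        fun z => twistCoord k x₀ z (s z)) y := by
    unfold localDirac
    rw [hD.congr hU subset_rfl hsm (fun z hz => H.twistCoord_dirac hs hz) hy]
    rfl
  rw [H.twistCoord_dirac (H.isSmoothTwist_dirac hs) hy, h1,
    localDirac_localDirac H.leviCivita hD (H.cliffordCompatible k x₀) hU (hs x₀) hy b,
    weitzenbock_eq _ y b]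
  rfl

end IsTwistedCliffordModule

variable (nablaM nablaL A) in
/-- Clifford multiplication by the curvature of `L`. -/
def lineCliffordTerm (x : M) : Module.End ℂ (E x) :=
  (1 / 2 : ℂ) • ∑ i, ∑ j,
    curvatureForm nablaL nablaM x (stdOrthonormalBasis ℝ (TangentSpace (𝓡 (2 * n)) x) i)
        (stdOrthonormalBasis ℝ (TangentSpace (𝓡 (2 * n)) x) j) •
      (tangentClifford A x (stdOrthonormalBasis ℝ (TangentSpace (𝓡 (2 * n)) x) i)
        * tangentClifford A x (stdOrthonormalBasis ℝ (TangentSpace (𝓡 (2 * n)) x) j))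

theorem formDeriv_const_smul {ψ : ∀ x : M, TangentSpace (𝓡 (2 * n)) x →ₗ[ℝ] ℂ} {U : Set M}
    (hU : IsOpen U) (hψ : SmoothForm ψ U) (z : ℂ) {Y Z : ∀ x : M, TangentSpace (𝓡 (2 * n)) x}
    (hY : SmoothField Y U) (hZ : SmoothField Z U) {x : M} (hx : x ∈ U) :
    formDeriv (fun y => z • ψ y) Y Z x = z * formDeriv ψ Y Z x := by
  have h : ∀ {Y : ∀ x : M, TangentSpace (𝓡 (2 * n)) x}, SmoothField Y U → ∀ v,
      mvfderiv (𝓡 (2 * n)) (fun y => (z • ψ y) (Y y)) x v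
        = z * mvfderiv (𝓡 (2 * n)) (fun y => ψ y (Y y)) x v := fun hY v =>
    mvfderiv_clm_comp ((hψ hU subset_rfl hY).diffAt hU hx) (ContinuousLinearMap.mul ℝ ℂ z) v
  rw [formDeriv, formDeriv, h hY, h hZ, LinearMap.smul_apply, smul_eq_mul]
  ring

/-- The curvature of ∇^E + kθ is R^E + k dθ = R^E + kF. This separates the part independent of k
from the part linear in k. -/
theorem weitzenbock_gaugeOp (H : IsTwistedCliffordModule nablaM A nablaE nablaL) (k : ℕ) {x₀ : M}
    {W : Set M} (hW : IsOpen W) (hWU : W ⊆ (trivializationAt ℂ L x₀).baseSet) {s : ∀ x, E x}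
    (hs : SmoothOn n F s W) {x : M} (hx : x ∈ W) :
    weitzenbock nablaM (gaugeOp nablaE nablaL k x₀) A s x
      = weitzenbock nablaM (connectionOp nablaE) A s x
        + (k : ℂ) • lineCliffordTerm nablaM A nablaL x (s x) := by
  have hθ : SmoothForm (connectionForm nablaL x₀) W := by
    intro O X hO hOW hX
    exact smoothForm_connectionForm H.smoothL H.smoothNablaL x₀ hO (hOW.trans hWU) hX
  have hc : ComplexLeibniz F (connectionOp nablaE) (trivializationAt ℂ L x₀).baseSet :=
    complexLeibniz_connectionOp H.smoothE H.hermitianE _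
  have h1 : ∀ v w, curvatureOp nablaM (gaugeOp nablaE nablaL k x₀) s x v w
      = curvatureOp nablaM (connectionOp nablaE) s x v w
        + ((k : ℂ) * curvatureForm nablaL nablaM x v w) • s x := fun v w => by
    have hv := smoothField_fieldExtension v W
    have hw := smoothField_fieldExtension w W
    have h2 := curvatureOp_twistedOp H.leviCivita (isConnectionOn_connectionOp H.smoothNablaE _) hc
      (H.smoothForm k x₀) hW hWU hs hv hw hx
    have h3 := curvatureForm_eq_formDeriv H.pos H.leviCivita H.smoothL H.smoothNablaL H.hermitianL
      hW hWU hv hw hx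
    rw [formDeriv_const_smul hW hθ _ hv hw hx, ← h3] at h2
    simp only [fieldExtension_self] at h2
    exact h2
  simp only [weitzenbock, lineCliffordTerm, h1, map_add, map_smul, Finset.sum_add_distrib, smul_add,
    LinearMap.smul_apply, LinearMap.sum_apply, Module.End.mul_apply]
  congr 1
  rw [smul_comm (k : ℂ)]
  simp only [Finset.smul_sum, smul_smul]

theorem weitzenbock_smul (H : IsTwistedCliffordModule nablaM A nablaE nablaL)
    {W : Set M} (hW : IsOpen W) {f : M → ℂ} (hf : SmoothFun n f W) {s t : ∀ x, E x}
    (hs : SmoothOn n F s W) (ht : ∀ y ∈ W, t y = f y • s y) {x : M} (hx : x ∈ W) :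
    weitzenbock nablaM (connectionOp nablaE) A t x
      = f x • weitzenbock nablaM (connectionOp nablaE) A s x := by
  have hc : ComplexLeibniz F (connectionOp nablaE) Set.univ :=
    complexLeibniz_connectionOp H.smoothE H.hermitianE _
  have hD := isConnectionOn_connectionOp H.smoothNablaE Set.univ
  have h1 : ∀ v w, curvatureOp nablaM (connectionOp nablaE) t x v w
      = f x • curvatureOp nablaM (connectionOp nablaE) s x v w := fun v w => by
    rw [← curvatureOp_smul H.pos H.leviCivita hD hc hW (Set.subset_univ _) hf hs hx,
      curvatureOp_sum H.leviCivita hD hW (Set.subset_univ _) {()} (s := fun _ y => f y • s y)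
        (fun _ _ => SmoothOn.complex_smul hf hs) (fun y hy => by simpa using ht y hy) hx]
    simp
  simp only [weitzenbock, h1, map_smul]
  rw [smul_comm (f x)]
  simp only [Finset.smul_sum]

variable (nablaM A nablaE nablaL) in
/-- The curvature term of the Weitzenböck formula on `E ⊗ L^k`. -/
def twistWeitzenbock (k : ℕ) (s : ∀ x : M, Twist E L k x) (x : M) : Twist E L k x :=
  (weitzenbock nablaM (connectionOp nablaE) A (fun y => twistCoord k x y (s y)) x
    + (k : ℂ) • lineCliffordTerm nablaM A nablaL x (twistCoord k x x (s x)))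
  ⊗ₜ[ℂ] powFrame L k x x

namespace IsTwistedCliffordModule

variable {k : ℕ} {s t : ∀ x : M, Twist E L k x}

theorem twistCoord_twistWeitzenbock (H : IsTwistedCliffordModule nablaM A nablaE nablaL)
    (hs : IsSmoothTwist n F k s) {x₀ y : M} (hy : y ∈ (trivializationAt ℂ L x₀).baseSet) :
    twistCoord k x₀ y (twistWeitzenbock nablaM A nablaE nablaL k s y)
      = weitzenbock nablaM (connectionOp nablaE) A (fun z => twistCoord k x₀ z (s z)) y
        + (k : ℂ) • lineCliffordTerm nablaM A nablaL y (twistCoord k x₀ y (s y)) := by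
  have hyy : y ∈ (trivializationAt ℂ L y).baseSet := FiberBundle.mem_baseSet_trivializationAt' y
  have hW := (trivializationAt ℂ L x₀).open_baseSet.inter (trivializationAt ℂ L y).open_baseSet
  have hsy : SmoothOn n F (fun z => twistCoord k y z (s z)) ((trivializationAt ℂ L x₀).baseSet ∩
    (trivializationAt ℂ L y).baseSet) := (hs y).mono Set.inter_subset_right
  rw [weitzenbock_smul H hW ((smoothFun_lineTransition H.smoothL x₀ y).complex_pow k) hsy
    (fun z hz => twistCoord_transition k x₀ hz.2 (s z)) ⟨hy, hyy⟩,
    twistCoord_transition k x₀ hyy (s y), twistWeitzenbock, twistCoord_tmul, powCoord_powFrame,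
    map_smul, smul_add, smul_comm (k : ℂ)]

theorem twistCoord_twistWeitzenbock' (H : IsTwistedCliffordModule nablaM A nablaE nablaL)
    (hs : IsSmoothTwist n F k s) {x₀ y : M} (hy : y ∈ (trivializationAt ℂ L x₀).baseSet) :
    twistCoord k x₀ y (twistWeitzenbock nablaM A nablaE nablaL k s y)
      = weitzenbock nablaM (gaugeOp nablaE nablaL k x₀) A (fun z => twistCoord k x₀ z (s z)) y := by
  rw [H.twistCoord_twistWeitzenbock hs hy, weitzenbock_gaugeOp H k
    (trivializationAt ℂ L x₀).open_baseSet subset_rfl (hs x₀) hy]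

theorem isSmoothTwist_twistWeitzenbock (H : IsTwistedCliffordModule nablaM A nablaE nablaL)
    (hs : IsSmoothTwist n F k s) :
    IsSmoothTwist n F k (twistWeitzenbock nablaM A nablaE nablaL k s) := fun x₀ =>
  SmoothOn.congr_eqOn (smoothOn_weitzenbock (A := A) H.leviCivita (H.isConnectionOn k x₀)
    (trivializationAt ℂ L x₀).open_baseSet subset_rfl (hs x₀))
    fun _ hy => H.twistCoord_twistWeitzenbock' hs hy

end IsTwistedCliffordModule

end TwistedDirac

/-! ### The Bochner formula for the metric Laplacian -/

section MetricLaplacian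

variable {n : ℕ} {M : Type*} [TopologicalSpace M]
  [ChartedSpace (EuclideanSpace ℝ (Fin (2 * n))) M] [IsManifold (𝓡 (2 * n)) ∞ M] [T2Space M]
  [RiemannianBundle (fun x : M => TangentSpace (𝓡 (2 * n)) x)]
  [IsContMDiffRiemannianBundle (𝓡 (2 * n)) ∞ (EuclideanSpace ℝ (Fin (2 * n)))
      (fun x : M => TangentSpace (𝓡 (2 * n)) x)]

/-- The Riesz vector ∑ φ(bᵢ) bᵢ does not depend on the orthonormal basis, so near each point it may
be computed in a smooth frame. -/
theorem exists_dual_field {φ : ∀ x : M, TangentSpace (𝓡 (2 * n)) x →ₗ[ℝ] ℝ}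
    (hφ : ∀ {W : Set M} {X : ∀ x : M, TangentSpace (𝓡 (2 * n)) x}, IsOpen W → SmoothField X W →
      SmoothFun n (fun x => φ x (X x)) W) :
    ∃ Z : ∀ x : M, TangentSpace (𝓡 (2 * n)) x, SmoothField Z Set.univ ∧
      ∀ x w, inner ℝ (Z x) w = φ x w := by
  have key : ∀ (x : M) {ι : Type _} [Fintype ι]
      (b : OrthonormalBasis ι ℝ (TangentSpace (𝓡 (2 * n)) x)) (w : TangentSpace (𝓡 (2 * n)) x),
      inner ℝ (∑ i, φ x (b i) • b i) w = φ x w := fun x ι _ b w => by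
    conv_rhs => rw [← b.sum_repr' w, map_sum]
    rw [sum_inner]
    exact Finset.sum_congr rfl fun i _ => by
      rw [inner_smul_left, map_smul, smul_eq_mul, mul_comm]; rfl
  let Z : ∀ x : M, TangentSpace (𝓡 (2 * n)) x := fun x =>
    ∑ i, φ x (stdOrthonormalBasis ℝ (TangentSpace (𝓡 (2 * n)) x) i) •
      stdOrthonormalBasis ℝ (TangentSpace (𝓡 (2 * n)) x) i
  refine ⟨Z, smoothOn_of_locally fun x _ => ?_, fun x w => key x _ w⟩
  obtain ⟨O, X, B, hO, hxO, hX, hB⟩ := exists_tangent_orthonormal_frame (n := n) x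
  refine ⟨fun y => ∑ i, φ y (X i y) • X i y, O, hO, hxO,
    ContMDiffOn.sum_section fun i _ => (hφ hO (hX i)).smul_section (hX i), fun y hy => ?_⟩
  refine ext_inner_right ℝ fun w => ?_
  have := key y (B y hy) w
  simp only [hB] at this
  rw [this]
  exact key y _ w

variable
  {F : Type*} [NormedAddCommGroup F] [NormedSpace ℂ F] [FiniteDimensional ℂ F]
  {E : M → Type*} [∀ x, NormedAddCommGroup (E x)] [∀ x, InnerProductSpace ℂ (E x)]
  [TopologicalSpace (TotalSpace F E)] [FiberBundle F E] [VectorBundle ℂ F E]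
  [VectorBundle ℝ F E] [ContMDiffVectorBundle ∞ F E (𝓡 (2 * n))]
  {L : M → Type*} [∀ x, NormedAddCommGroup (L x)] [∀ x, InnerProductSpace ℂ (L x)]
  [TopologicalSpace (TotalSpace ℂ L)] [FiberBundle ℂ L] [VectorBundle ℂ ℂ L]
  [VectorBundle ℝ ℂ L] [ContMDiffVectorBundle ∞ ℂ L (𝓡 (2 * n))]
  {nablaM : CovariantDerivative (𝓡 (2 * n)) (EuclideanSpace ℝ (Fin (2 * n)))
      (fun x : M => TangentSpace (𝓡 (2 * n)) x)} {A : CliffordAction n F E}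
    {nablaE : CovariantDerivative (𝓡 (2 * n)) F E}
    {nablaL : CovariantDerivative (𝓡 (2 * n)) ℂ L}
  {k : ℕ} {s t u : ∀ x : M, Twist E L k x}

theorem twistInner_add_left (x : M) (a b c : Twist E L k x) :
    twistInner k x (a + b) c = twistInner k x a c + twistInner k x b c := by
  simp only [twistInner, map_add, inner_add_left, add_mul]

theorem twistInner_sub_left (x : M) (a b c : Twist E L k x) :
    twistInner k x (a - b) c = twistInner k x a c - twistInner k x b c := by
  simp only [twistInner, map_sub, inner_sub_left, sub_mul]

theorem twistInner_smul_left (x : M) (z : ℂ) (a b : Twist E L k x) :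
    twistInner k x (z • a) b = (starRingEnd ℂ) z * twistInner k x a b := by
  simp only [twistInner, map_smul, inner_smul_left, mul_assoc]

theorem twistInner_smul_right (x : M) (z : ℂ) (a b : Twist E L k x) :
    twistInner k x a (z • b) = z * twistInner k x a b := by
  simp only [twistInner, map_smul, inner_smul_right, mul_assoc]

theorem IsSmoothTwist.sub (hs : IsSmoothTwist n F k s) (ht : IsSmoothTwist n F k t) :
    IsSmoothTwist n F k fun x => s x - t x := fun x₀ => by
  simp only [map_sub]
  exact ContMDiffOn.sub_section (hs x₀) (ht x₀)

theorem IsSmoothTwist.const_smul (z : ℂ) (hs : IsSmoothTwist n F k s) :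
    IsSmoothTwist n F k fun x => z • s x := fun x₀ => by
  simp only [map_smul]
  exact SmoothOn.complex_const_smul z (hs x₀)

theorem smoothFun_twistInner (hE : IsSmoothHermitian n F E) (hL : IsSmoothHermitian n ℂ L)
    {W : Set M} (hW : IsOpen W) (hs : ∀ x₀ : M, SmoothOn n F (fun y => twistCoord k x₀ y (s y))
      (W ∩ (trivializationAt ℂ L x₀).baseSet)) (ht : IsSmoothTwist n F k t) :
    SmoothFun n (fun x => twistInner k x (s x) (t x)) W := by
  refine smoothFun_of_locally fun x hx => ?_
  have hU := (trivializationAt ℂ L x).open_baseSet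
  refine ⟨W ∩ (trivializationAt ℂ L x).baseSet, hW.inter hU,
    ⟨hx, FiberBundle.mem_baseSet_trivializationAt' x⟩,
    ContMDiffOn.congr ?_ fun y hy => twistInner_eq k hy.2 _ _⟩
  exact SmoothFun.complex_mul (SmoothFun.inner_section hE (hW.inter hU) (hs x)
    (ContMDiffOn.mono (ht x) Set.inter_subset_right))
    (SmoothFun.ofReal ((smoothFun_lineWeight hL k x).mono Set.inter_subset_right))

theorem continuous_twistInner (hE : IsSmoothHermitian n F E) (hL : IsSmoothHermitian n ℂ L)
    (hs : IsSmoothTwist n F k s) (ht : IsSmoothTwist n F k t) :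
    Continuous fun x => twistInner k x (s x) (t x) :=
  continuousOn_univ.1 (smoothFun_twistInner hE hL isOpen_univ
    (fun x₀ => ContMDiffOn.mono (hs x₀) Set.inter_subset_right) ht).continuousOn

namespace IsTwistedCliffordModule

theorem smoothOn_twistNabla (H : IsTwistedCliffordModule nablaM A nablaE nablaL)
    (hs : IsSmoothTwist n F k s) {W : Set M} (hW : IsOpen W)
    {X : ∀ x : M, TangentSpace (𝓡 (2 * n)) x} (hX : SmoothField X W) (x₀ : M) :
    SmoothOn n F (fun y => twistCoord k x₀ y (twistNabla nablaE nablaL k s y (X y)))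
      (W ∩ (trivializationAt ℂ L x₀).baseSet) :=
  SmoothOn.congr_eqOn ((H.isConnectionOn k x₀).smooth
    (hW.inter (trivializationAt ℂ L x₀).open_baseSet) Set.inter_subset_right
    (ContMDiffOn.mono (hs x₀) Set.inter_subset_right) (hX.mono Set.inter_subset_left))
    fun _ hy => twistCoord_twistNabla H.smoothE H.hermitianE H.smoothL H.hermitianL hs hy.2 _

/-- Z is dual to w ↦ Re⟨∇_w s, t⟩. Its divergence is Re⟨tr Hess s, t⟩ + Re⟨∇s, ∇t⟩, and by the local
Weitzenböck formula -tr Hess s is D²s minus the curvature term. -/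
theorem exists_field_divergence (H : IsTwistedCliffordModule nablaM A nablaE nablaL)
    (hs : IsSmoothTwist n F k s) (ht : IsSmoothTwist n F k t) :
    ∃ Z : ∀ x : M, TangentSpace (𝓡 (2 * n)) x, SmoothField Z Set.univ ∧ ∀ x,
      (∑ i, twistInner k x
        (twistNabla nablaE nablaL k s x (stdOrthonormalBasis ℝ (TangentSpace (𝓡 (2 * n)) x) i))
        (twistNabla nablaE nablaL k t x (stdOrthonormalBasis ℝ (TangentSpace (𝓡 (2 * n)) x) i))).re
      = (twistInner k x (dirac A nablaE nablaL k (dirac A nablaE nablaL k s) x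
          - twistWeitzenbock nablaM A nablaE nablaL k s x) (t x)).re + divergence nablaM Z x := by
  let φ : ∀ x : M, TangentSpace (𝓡 (2 * n)) x →ₗ[ℝ] ℝ := fun x =>
    { toFun := fun w => (twistInner k x (twistNabla nablaE nablaL k s x w) (t x)).re
      map_add' := fun v w => by rw [map_add, twistInner_add_left, Complex.add_re]
      map_smul' := fun r v => by
        rw [map_smul, ← algebraMap_smul ℂ r, Complex.coe_algebraMap, twistInner_smul_left, Complex.conj_ofReal,
          Complex.re_ofReal_mul]
        rfl }
  obtain ⟨Z, hZ, hZφ⟩ := exists_dual_field (φ := φ) fun hW hX =>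
    (smoothFun_twistInner H.smoothE H.smoothL hW (H.smoothOn_twistNabla hs hW hX) ht).re
  refine ⟨Z, hZ, fun x => ?_⟩
  have hU := (trivializationAt ℂ L x).open_baseSet
  have hx : x ∈ (trivializationAt ℂ L x).baseSet := FiberBundle.mem_baseSet_trivializationAt' x
  have hN := fun {s : ∀ x : M, Twist E L k x} (hs : IsSmoothTwist n F k s) {y : M}
    (hy : y ∈ (trivializationAt ℂ L x).baseSet) (v : TangentSpace (𝓡 (2 * n)) y) =>
    twistCoord_twistNabla H.smoothE H.hermitianE H.smoothL H.hermitianL hs hy v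
  have h1 := inner_nablaM_dual H.leviCivita (H.isConnectionOn k x) (H.metricCompatible k x) hU
    (hs x) (ht x) (Z := Z) (hZ.mono (Set.subset_univ _)) (fun y hy w => by
      rw [hZφ, ← hN hs hy, ← twistInner_eq k hy]; rfl) hx
  let b := stdOrthonormalBasis ℝ (TangentSpace (𝓡 (2 * n)) x)
  have h2 : twistCoord k x x (dirac A nablaE nablaL k (dirac A nablaE nablaL k s) x
      - twistWeitzenbock nablaM A nablaE nablaL k s x)
      = -∑ i, hessian nablaM (gaugeOp nablaE nablaL k x) (fun z => twistCoord k x z (s z)) x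
          (b i) (b i) := by
    rw [map_sub, H.twistCoord_dirac_dirac hs hx b, H.twistCoord_twistWeitzenbock' hs hx]
    abel
  rw [divergence_eq_sum Z x b]
  simp only [h1, twistInner_eq k hx, hN hs hx, hN ht hx, h2]
  rw [← Complex.re_sum, ← Complex.add_re]
  congr 1
  rw [inner_neg_left, sum_inner, ← Finset.sum_mul, ← Finset.sum_mul, Finset.sum_add_distrib]
  ring

variable [MeasurableSpace M] [BorelSpace M] [CompactSpace M]

theorem integrable_twistInner (H : IsTwistedCliffordModule nablaM A nablaE nablaL)
    (hs : IsSmoothTwist n F k s) (ht : IsSmoothTwist n F k t) :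
    Integrable (fun x => twistInner k x (s x) (t x)) (riemannianVolume n M) :=
  (continuous_twistInner H.smoothE H.smoothL hs ht).integrable_of_hasCompactSupport
    (HasCompactSupport.of_compactSpace _)

theorem innerL2_sub_left (H : IsTwistedCliffordModule nablaM A nablaE nablaL)
    (hs : IsSmoothTwist n F k s) (ht : IsSmoothTwist n F k t) (hu : IsSmoothTwist n F k u) :
    innerL2 n k (fun x => s x - t x) u = innerL2 n k s u - innerL2 n k t u := by
  simp only [innerL2, twistInner_sub_left]
  exact integral_sub (H.integrable_twistInner hs hu) (H.integrable_twistInner ht hu)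

/-- The pointwise identity holds up to a divergence, which integrates to zero. Hence D²s minus the
curvature term is a weak, and smooth, representative of ∇*∇s. -/
theorem innerL2_laplacian (H : IsTwistedCliffordModule nablaM A nablaE nablaL)
    (hs : IsSmoothTwist n F k s) (ht : IsSmoothTwist n F k t) :
    innerL2 n k (fun x => dirac A nablaE nablaL k (dirac A nablaE nablaL k s) x
        - twistWeitzenbock nablaM A nablaE nablaL k s x) t
      = innerL2Form k (twistNabla nablaE nablaL k s) (twistNabla nablaE nablaL k t) := by
  obtain ⟨Z, hZ, hZd⟩ := H.exists_field_divergence hs ht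
  -- The previous identity concerns real parts only; applied to -i t it yields the imaginary parts,
  -- as Re(-iz) = Im z.
  have ht' := ht.const_smul (-Complex.I)
  obtain ⟨Z', hZ', hZd'⟩ := H.exists_field_divergence hs ht'
  have hu := (H.isSmoothTwist_dirac (H.isSmoothTwist_dirac hs)).sub
    (H.isSmoothTwist_twistWeitzenbock hs)
  have hnt : ∀ x v, twistNabla nablaE nablaL k (fun x => (-Complex.I) • t x) x v
      = (-Complex.I) • twistNabla nablaE nablaL k t x v := fun x v => by
    have hU := (trivializationAt ℂ L x).open_baseSet
    have hx : x ∈ (trivializationAt ℂ L x).baseSet := FiberBundle.mem_baseSet_trivializationAt' x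
    have h := nabla_complex_smul H.hermitianE H.smoothE hU (g := fun _ => -Complex.I)
      contMDiffOn_const (ht x) hx v
    refine twistCoord_injective k hx ?_
    rw [map_smul, twistCoord_twistNabla H.smoothE H.hermitianE H.smoothL H.hermitianL ht' hx,
      twistCoord_twistNabla H.smoothE H.hermitianE H.smoothL H.hermitianL ht hx]
    simp only [gaugeOp, twistedOp_apply, map_smul, connectionOp_apply]
    rw [h, smul_add, smul_comm (-Complex.I)]
    simp [mvfderiv]
  have hpt : ∀ x, (∑ i, twistInner k x
        (twistNabla nablaE nablaL k s x (stdOrthonormalBasis ℝ (TangentSpace (𝓡 (2 * n)) x) i))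
        (twistNabla nablaE nablaL k t x (stdOrthonormalBasis ℝ (TangentSpace (𝓡 (2 * n)) x) i)))
      = twistInner k x (dirac A nablaE nablaL k (dirac A nablaE nablaL k s) x
          - twistWeitzenbock nablaM A nablaE nablaL k s x) (t x)
        + ((divergence nablaM Z x : ℂ) + Complex.I * (divergence nablaM Z' x : ℂ)) := fun x => by
    have h1 := hZd x
    have h2 := hZd' x
    simp only [hnt, twistInner_smul_right] at h2
    rw [← Finset.mul_sum] at h2
    refine Complex.ext ?_ ?_
    · simpa using h1
    · simpa using h2
  have hi := integrable_of_continuous (n := n) (continuous_divergence H.pos H.leviCivita hZ)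
  have hi' := integrable_of_continuous (n := n) (continuous_divergence H.pos H.leviCivita hZ')
  have hc : Integrable (fun x => (divergence nablaM Z x : ℂ)) (riemannianVolume n M) := hi.ofReal
  have hc' : Integrable (fun x => Complex.I * (divergence nablaM Z' x : ℂ)) (riemannianVolume n M) :=
    hi'.ofReal.const_mul _
  have hcc : Integrable (fun x => (divergence nablaM Z x : ℂ)
    + Complex.I * (divergence nablaM Z' x : ℂ)) (riemannianVolume n M) := hc.add hc'
  simp only [innerL2, innerL2Form, hpt]
  rw [integral_add (H.integrable_twistInner hu ht) hcc, integral_add hc hc', integral_const_mul,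
    integral_complex_ofReal, integral_complex_ofReal, integral_divergence H.pos H.leviCivita hZ,
    integral_divergence H.pos H.leviCivita hZ']
  simp

/-- The integrated Weitzenböck formula. -/
theorem innerL2_dirac_sub_laplacian (H : IsTwistedCliffordModule nablaM A nablaE nablaL)
    (hs : IsSmoothTwist n F k s) :
    innerL2 n k (dirac A nablaE nablaL k (dirac A nablaE nablaL k s)
        - metricLaplacian nablaE nablaL k s) s
      = innerL2 n k (twistWeitzenbock nablaM A nablaE nablaL k s) s := by
  have hDD := H.isSmoothTwist_dirac (H.isSmoothTwist_dirac hs)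
  have hR := H.isSmoothTwist_twistWeitzenbock hs
  -- Existence of a representative excludes the default value 0 in `nablaStar`. Whatever
  -- representative is chosen, only its pairing with the smooth section s matters, so uniqueness is
  -- not needed.
  have hex : ∃ u : ∀ x : M, Twist E L k x, IsSmoothTwist n F k u ∧
      ∀ t : ∀ x : M, Twist E L k x, IsSmoothTwist n F k t →
        innerL2 n k u t = innerL2Form k (twistNabla nablaE nablaL k s)
          (twistNabla nablaE nablaL k t) :=
    ⟨_, hDD.sub hR, fun t ht => H.innerL2_laplacian hs ht⟩
  have hspec : IsSmoothTwist n F k (metricLaplacian nablaE nablaL k s) ∧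
      innerL2 n k (metricLaplacian nablaE nablaL k s) s
        = innerL2Form k (twistNabla nablaE nablaL k s) (twistNabla nablaE nablaL k s) := by
    rw [metricLaplacian, nablaStar, dif_pos hex]
    exact ⟨hex.choose_spec.1, hex.choose_spec.2 s hs⟩
  have h1 := H.innerL2_sub_left hDD hspec.1 hs
  have h2 := H.innerL2_sub_left hDD hR hs
  rw [H.innerL2_laplacian hs hs, ← hspec.2] at h2
  refine h1.trans ?_
  rw [h2]
  ring

end IsTwistedCliffordModule
end MetricLaplacian

/-! ### The curvature of the line bundle and the estimate -/

section Estimate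

variable {n : ℕ} {M : Type*} [TopologicalSpace M]
  [ChartedSpace (EuclideanSpace ℝ (Fin (2 * n))) M] [IsManifold (𝓡 (2 * n)) ∞ M] [T2Space M]
  [RiemannianBundle (fun x : M => TangentSpace (𝓡 (2 * n)) x)]
  [IsContMDiffRiemannianBundle (𝓡 (2 * n)) ∞ (EuclideanSpace ℝ (Fin (2 * n)))
      (fun x : M => TangentSpace (𝓡 (2 * n)) x)]
  {F : Type*} [NormedAddCommGroup F] [NormedSpace ℂ F] [FiniteDimensional ℂ F]
  {E : M → Type*} [∀ x, NormedAddCommGroup (E x)] [∀ x, InnerProductSpace ℂ (E x)]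
  [TopologicalSpace (TotalSpace F E)] [FiberBundle F E] [VectorBundle ℂ F E]
  [VectorBundle ℝ F E] [ContMDiffVectorBundle ∞ F E (𝓡 (2 * n))]
  {L : M → Type*} [∀ x, NormedAddCommGroup (L x)] [∀ x, InnerProductSpace ℂ (L x)]
  [TopologicalSpace (TotalSpace ℂ L)] [FiberBundle ℂ L] [VectorBundle ℂ ℂ L]
  [VectorBundle ℝ ℂ L] [ContMDiffVectorBundle ∞ ℂ L (𝓡 (2 * n))]
  {nablaM : CovariantDerivative (𝓡 (2 * n)) (EuclideanSpace ℝ (Fin (2 * n)))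
      (fun x : M => TangentSpace (𝓡 (2 * n)) x)} {A : CliffordAction n F E}
    {nablaE : CovariantDerivative (𝓡 (2 * n)) F E}
    {nablaL : CovariantDerivative (𝓡 (2 * n)) ℂ L}

variable (nablaM nablaL) in
/-- The two-form `i F` as a bilinear map. -/
def iCurvatureForm (x : M) :
    TangentSpace (𝓡 (2 * n)) x →ₗ[ℝ] TangentSpace (𝓡 (2 * n)) x →ₗ[ℝ] ℝ :=
  (curvatureForm nablaL nablaM x).compr₂ (Complex.reLm ∘ₗ LinearMap.mulLeft ℝ Complex.I)

theorem iCurvatureForm_apply (x : M) (v w : TangentSpace (𝓡 (2 * n)) x) :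
    iCurvatureForm nablaM nablaL x v w = (Complex.I * curvatureForm nablaL nablaM x v w).re := rfl

theorem curvatureForm_swap (x : M) (v w : TangentSpace (𝓡 (2 * n)) x) :
    curvatureForm nablaL nablaM x v w = -curvatureForm nablaL nablaM x w v := by
  change lineCoord L x x (curvatureOp nablaM (connectionOp nablaL) (lineFrame L x) x v w)
    = -lineCoord L x x (curvatureOp nablaM (connectionOp nablaL) (lineFrame L x) x w v)
  rw [← map_neg, curvatureOp_apply, curvatureOp_apply, neg_sub]

theorem iCurvatureForm_swap (x : M) (v w : TangentSpace (𝓡 (2 * n)) x) :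
    iCurvatureForm nablaM nablaL x v w = -iCurvatureForm nablaM nablaL x w v := by
  rw [iCurvatureForm_apply, iCurvatureForm_apply, curvatureForm_swap, mul_neg, Complex.neg_re]

/-- Re⟨c(eᵢ)c(eⱼ)u, u⟩ is symmetric in i and j because c is skew-adjoint, while a is antisymmetric.
So the real part of F, which `iCurvature` discards, does not affect the estimate. -/
theorem re_inner_sum_clifford_eq_zero {V H : Type*} [NormedAddCommGroup V] [InnerProductSpace ℝ V]
    [NormedAddCommGroup H] [InnerProductSpace ℂ H] {c : V →ₗ[ℝ] Module.End ℂ H} (hc : IsClifford c)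
    {ι : Type*} [Fintype ι] (e : ι → V) (a : ι → ι → ℝ) (ha : ∀ i j, a i j = -a j i) (u : H) :
    (inner ℂ (∑ i, ∑ j, (a i j : ℂ) • c (e i) (c (e j) u)) u).re = 0 := by
  have hq : ∀ i j, (inner ℂ (c (e i) (c (e j) u)) u).re = (inner ℂ (c (e j) (c (e i) u)) u).re :=
    fun i j => by
      rw [hc.skew, hc.skew, neg_neg, ← inner_conj_symm, Complex.conj_re]
  have h1 : (inner ℂ (∑ i, ∑ j, (a i j : ℂ) • c (e i) (c (e j) u)) u).re
      = ∑ i, ∑ j, a i j * (inner ℂ (c (e i) (c (e j) u)) u).re := by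
    simp only [sum_inner, inner_smul_left, Complex.conj_ofReal, Complex.re_sum,
      Complex.re_ofReal_mul]
  have h2 : ∑ i, ∑ j, a i j * (inner ℂ (c (e i) (c (e j) u)) u).re
      = -∑ i, ∑ j, a i j * (inner ℂ (c (e i) (c (e j) u)) u).re := by
    conv_lhs => rw [Finset.sum_comm]
    simp only [← Finset.sum_neg_distrib]
    exact Finset.sum_congr rfl fun i _ => Finset.sum_congr rfl fun j _ => by
      rw [ha j i, hq j i]; ring
  rw [h1]
  linarith

namespace IsTwistedCliffordModule

theorem iCurvature_eq (H : IsTwistedCliffordModule nablaM A nablaE nablaL) (x : M)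
    (v w : TangentSpace (𝓡 (2 * n)) x) :
    iCurvature nablaL x v w = iCurvatureForm nablaM nablaL x v w := by
  rw [iCurvature, curvature_eq_curvatureForm H.leviCivita H.smoothNablaL]
  rfl

theorem iCurvatureTopPower_eq (H : IsTwistedCliffordModule nablaM A nablaE nablaL) (x : M)
    (b : Fin (2 * n) → TangentSpace (𝓡 (2 * n)) x) :
    iCurvatureTopPower nablaL x b
      = topPower (fun v w => iCurvatureForm nablaM nablaL x v w) b := by
  simp only [iCurvatureTopPower, topPower, H.iCurvature_eq]

theorem inner_skewEndo (H : IsTwistedCliffordModule nablaM A nablaE nablaL) (x : M)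
    (v w : TangentSpace (𝓡 (2 * n)) x) :
    iCurvatureForm nablaM nablaL x v w = inner ℝ v (skewEndo nablaL x w) := by
  let e := stdOrthonormalBasis ℝ (TangentSpace (𝓡 (2 * n)) x)
  have h : iCurvatureForm nablaM nablaL x
      = (innerₗ (TangentSpace (𝓡 (2 * n)) x)).compl₂ (skewEndo nablaL x) := by
    refine LinearMap.ext_basis e.toBasis e.toBasis fun i j => ?_
    simp only [LinearMap.compl₂_apply, innerₗ_apply_apply]
    rw [skewEndo, Matrix.toLin_self, inner_sum]
    simp only [OrthonormalBasis.coe_toBasis, inner_smul_right, Matrix.of_apply, H.iCurvature_eq]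
    rw [Finset.sum_eq_single i]
    · rw [real_inner_self_eq_norm_sq, e.norm_eq_one]; simp [e]
    · intro k _ hk
      rw [e.inner_eq_zero (Ne.symm hk), mul_zero]
    · simp
  exact LinearMap.congr_fun₂ h v w

/-- Write F = Re F - iη with η = Re(iF). The second part is the Clifford element bounded in
`clifford_twoForm_lower_bound`; the first contributes nothing to the real part. -/
theorem lineCliffordTerm_lower_bound (H : IsTwistedCliffordModule nablaM A nablaE nablaL)
    {o : ManifoldOrientation n M} {δ : ℤˣ} {x : M}
    (htop : ∀ B : Module.Basis (Fin (2 * n)) ℝ (TangentSpace (𝓡 (2 * n)) x),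
      B.orientation = o.at' x → 0 < ((δ : ℤ) : ℝ) * iCurvatureTopPower nablaL x B) (u : E x)
    (hu : ∀ b : OrthonormalBasis (Fin (2 * n)) ℝ (TangentSpace (𝓡 (2 * n)) x),
      b.toBasis.orientation = o.at' x → chirality A x b u = ((-δ : ℤˣ) : ℤ) • u) :
    -(tau nablaL x - 2 * minEig nablaL x) * ‖u‖ ^ 2
      ≤ (inner ℂ (lineCliffordTerm nablaM A nablaL x u) u).re := by
  let e := stdOrthonormalBasis ℝ (TangentSpace (𝓡 (2 * n)) x)
  have hfin : Module.finrank ℝ (TangentSpace (𝓡 (2 * n)) x) = 2 * n :=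
    finrank_euclideanSpace_fin (𝕜 := ℝ) (n := 2 * n)
  have h1 := clifford_twoForm_lower_bound H.pos hfin (o.at' x) (isClifford_tangentClifford A x)
    (iCurvatureForm nablaM nablaL x) (iCurvatureForm_swap x) (skewEndo nablaL x)
    (H.inner_skewEndo x) δ (fun B hB => by
      rw [← H.iCurvatureTopPower_eq]; exact htop B hB) u hu e
  refine h1.trans (le_of_eq ?_)
  have h2 := re_inner_sum_clifford_eq_zero (isClifford_tangentClifford A x) (fun i => e i)
    (fun i j => (1 / 2) * (curvatureForm nablaL nablaM x (e i) (e j)).re)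
    (fun i j => by rw [curvatureForm_swap, Complex.neg_re]; ring) u
  have h3 : lineCliffordTerm nablaM A nablaL x u
      = (-(Complex.I / 2)) • (∑ i, ∑ j, iCurvatureForm nablaM nablaL x (e i) (e j) •
          (tangentClifford A x (e i) * tangentClifford A x (e j))) u
        + ∑ i, ∑ j, (((1 / 2) * (curvatureForm nablaL nablaM x (e i) (e j)).re : ℝ) : ℂ) •
          tangentClifford A x (e i) (tangentClifford A x (e j) u) := by
    simp only [lineCliffordTerm, LinearMap.smul_apply, LinearMap.sum_apply, Finset.smul_sum,
      ← Finset.sum_add_distrib, Module.End.mul_apply]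
    refine Finset.sum_congr rfl fun i _ => Finset.sum_congr rfl fun j _ => ?_
    rw [← Complex.coe_smul (iCurvatureForm nablaM nablaL x (e i) (e j)), smul_smul, smul_smul,
      ← add_smul]
    congr 1
    rw [iCurvatureForm_apply, Complex.I_mul_re]
    change _ * curvatureForm nablaL nablaM x (e i) (e j) = _
    conv_lhs => rw [← Complex.re_add_im (curvatureForm nablaL nablaM x (e i) (e j))]
    push_cast
    ring
  rw [h3, inner_add_left, Complex.add_re, h2, add_zero]

theorem injective_skewEndo (H : IsTwistedCliffordModule nablaM A nablaE nablaL)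
    {o : ManifoldOrientation n M} {δ : ℤˣ} {x : M}
    (htop : ∀ B : Module.Basis (Fin (2 * n)) ℝ (TangentSpace (𝓡 (2 * n)) x),
      B.orientation = o.at' x → 0 < ((δ : ℤ) : ℝ) * iCurvatureTopPower nablaL x B) :
    Function.Injective (skewEndo nablaL x) := by
  have hfin : Module.finrank ℝ (TangentSpace (𝓡 (2 * n)) x) = 2 * n :=
    finrank_euclideanSpace_fin (𝕜 := ℝ) (n := 2 * n)
  refine injective_of_topPower_ne_zero H.pos hfin (o.at' x) (iCurvatureForm nablaM nablaL x)
    (iCurvatureForm_swap x) _ (H.inner_skewEndo x) fun B hB h => ?_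
  have := htop B hB
  rw [H.iCurvatureTopPower_eq, h, mul_zero] at this
  exact lt_irrefl _ this

/-- Continuity is what makes (τ - 2m)|s|² integrable. In a local orthonormal frame `skewEndo` has a
skew invertible matrix with the entries of iF, and these are continuous because F = dθ in a fixed
gauge. -/
theorem continuous_tau_minEig (H : IsTwistedCliffordModule nablaM A nablaE nablaL)
    {o : ManifoldOrientation n M} {δ : ℤˣ}
    (htop : ∀ (x : M) (B : Module.Basis (Fin (2 * n)) ℝ (TangentSpace (𝓡 (2 * n)) x)),
      B.orientation = o.at' x → 0 < ((δ : ℤ) : ℝ) * iCurvatureTopPower nablaL x B) :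
    Continuous (tau nablaL) ∧ Continuous (minEig nablaL) := by
  have key : ∀ x : M, ContinuousAt (tau nablaL) x ∧ ContinuousAt (minEig nablaL) x := fun x => by
    obtain ⟨O, X, B, hO, hxO, hX, hB⟩ := exists_tangent_orthonormal_frame (n := n) x
    have hx : x ∈ (trivializationAt ℂ L x).baseSet := FiberBundle.mem_baseSet_trivializationAt' x
    have hW := hO.inter (trivializationAt ℂ L x).open_baseSet
    set W := O ∩ (trivializationAt ℂ L x).baseSet with hWdef
    have hXW : ∀ i, SmoothField (X i) W := fun i => (hX i).mono Set.inter_subset_left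
    let G : M → Matrix (Fin (2 * n)) (Fin (2 * n)) ℝ := fun y =>
      Matrix.of fun i j => iCurvatureForm nablaM nablaL y (X i y) (X j y)
    have hθ : SmoothForm (connectionForm nablaL x) W := by
      intro V Y hV hVW hY
      exact smoothForm_connectionForm H.smoothL H.smoothNablaL x hV
        (hVW.trans Set.inter_subset_right) hY
    have hG : ContinuousOn G W := by
      refine continuousOn_pi.2 fun i => continuousOn_pi.2 fun j => ?_
      have h1 : ContinuousOn (fun y => (Complex.I *
          formDeriv (connectionForm nablaL x) (X i) (X j) y).re) W :=
        Complex.continuous_re.comp_continuousOn (continuousOn_const.mul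
          (smoothFun_formDeriv hW hθ (hXW i) (hXW j)).continuousOn)
      refine h1.congr fun y hy => ?_
      exact congrArg (fun z => (Complex.I * z).re) (curvatureForm_eq_formDeriv H.pos H.leviCivita
        H.smoothL H.smoothNablaL H.hermitianL hW Set.inter_subset_right (hXW i) (hXW j) hy)
    have hmat : ∀ y (hy : y ∈ O), LinearMap.toMatrix (B y hy).toBasis (B y hy).toBasis
        (skewEndo nablaL y) = G y := fun y hy => by
      ext i j
      rw [LinearMap.toMatrix_apply]
      simp only [OrthonormalBasis.coe_toBasis, OrthonormalBasis.coe_toBasis_repr_apply,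
        OrthonormalBasis.repr_apply_apply]
      rw [← H.inner_skewEndo, hB, hB]
      rfl
    have hchar : ∀ y ∈ W, (skewEndo nablaL y).charpoly = (G y).charpoly := fun y hy => by
      rw [← hmat y hy.1, LinearMap.charpoly_toMatrix]
    have hskew : ∀ y ∈ W, (G y).transpose = -G y := fun y _ => by
      ext i j
      exact iCurvatureForm_swap y _ _
    have hinj : ∀ y ∈ W, Function.Injective (Matrix.toEuclideanLin (G y)) := fun y hy => by
      have h1 := H.injective_skewEndo (htop y)
      have h2 : Function.Injective (G y).mulVec := by
        rw [Matrix.mulVec_injective_iff_isUnit, Matrix.isUnit_iff_isUnit_det, ← hmat y hy.1,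
          LinearMap.det_toMatrix]
        exact LinearMap.isUnit_det _ ((LinearMap.isUnit_iff_ker_eq_bot _).2
          (LinearMap.ker_eq_bot.2 h1))
      intro v w hvw
      exact WithLp.ofLp_injective 2 (h2 (WithLp.toLp_injective 2 hvw))
    have hmem := hW.mem_nhds (⟨hxO, hx⟩ : x ∈ W)
    constructor
    · exact ((continuousOn_posRootSum hG hskew hinj).congr fun y hy => by
        rw [← hchar y hy]; rfl).continuousAt hmem
    · exact ((continuousOn_minPosRoot H.pos hG hskew hinj).congr fun y hy => by
        rw [← hchar y hy]; rfl).continuousAt hmem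
  exact ⟨continuous_iff_continuousAt.2 fun x => (key x).1,
    continuous_iff_continuousAt.2 fun x => (key x).2⟩

variable [CompactSpace M]

/-- Compactness merges the local bounds. Only E and its connection enter, which is why the constant
is independent of k; allowing sections over open sets lets it apply to the coordinate of a twisted
section in a gauge. -/
theorem exists_weitzenbock_bound (H : IsTwistedCliffordModule nablaM A nablaE nablaL) :
    ∃ C : ℝ, ∀ (x : M) (W : Set M) (s : ∀ x, E x), IsOpen W → SmoothOn n F s W → x ∈ W →
      ‖weitzenbock nablaM (connectionOp nablaE) A s x‖ ≤ C * ‖s x‖ := by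
  have hc : ComplexLeibniz F (connectionOp nablaE) Set.univ :=
    complexLeibniz_connectionOp H.smoothE H.hermitianE _
  have h := isCompact_univ.induction_on (X := M)
    (p := fun S => ∃ C : ℝ, ∀ x ∈ S, ∀ (W : Set M) (s : ∀ x, E x), IsOpen W → SmoothOn n F s W →
      x ∈ W → ‖weitzenbock nablaM (connectionOp nablaE) A s x‖ ≤ C * ‖s x‖)
    ⟨0, by simp⟩ (fun S T hST ⟨C, hC⟩ => ⟨C, fun x hx => hC x (hST hx)⟩)
    (fun S T ⟨C, hC⟩ ⟨C', hC'⟩ => ⟨max C C', fun x hx W s hW hs hxW => ?_⟩)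
    (fun x₀ _ => ?_)
  · obtain ⟨C, hC⟩ := h
    exact ⟨C, fun x => hC x (Set.mem_univ x)⟩
  · rcases hx with hx | hx
    · exact (hC x hx W s hW hs hxW).trans
        (mul_le_mul_of_nonneg_right (le_max_left _ _) (norm_nonneg _))
    · exact (hC' x hx W s hW hs hxW).trans
        (mul_le_mul_of_nonneg_right (le_max_right _ _) (norm_nonneg _))
  · obtain ⟨O, C, hO, hxO, hC⟩ := DiracTwist.exists_weitzenbock_bound (A := A) H.pos H.leviCivita
      H.smoothE isOpen_univ (isConnectionOn_connectionOp H.smoothNablaE Set.univ) hc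
      (Set.mem_univ x₀)
    exact ⟨O, mem_nhdsWithin_of_mem_nhds (hO.mem_nhds hxO), C, fun x hx W s hW hs hxW =>
      hC W s x hW (Set.subset_univ _) hs hxW hx⟩

variable [MeasurableSpace M] [BorelSpace M]

theorem re_integral_eq {f : M → ℂ} (hf : Continuous f) :
    (∫ x, f x ∂(riemannianVolume n M)).re = ∫ x, (f x).re ∂(riemannianVolume n M) :=
  (integral_re (𝕜 := ℂ) (hf.integrable_of_hasCompactSupport
    (HasCompactSupport.of_compactSpace f))).symm

/-- With δ the sign of (iF)ⁿ, both cases concern chirality -δ. The integrated Weitzenböck formula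
reduces the estimate to a pointwise one, where the k-independent curvature costs C|s|² and k c(F)
costs k(τ - 2m)|s|². -/
theorem exists_diracLaplacianEstimate (H : IsTwistedCliffordModule nablaM A nablaE nablaL)
    {o : ManifoldOrientation n M} {δ : ℤˣ}
    (htop : ∀ (x : M) (B : Module.Basis (Fin (2 * n)) ℝ (TangentSpace (𝓡 (2 * n)) x)),
      B.orientation = o.at' x → 0 < ((δ : ℤ) : ℝ) * iCurvatureTopPower nablaL x B) :
    ∃ C : ℝ, ∀ (k : ℕ) (s : ∀ x : M, Twist E L k x), IsSmoothTwist n F k s →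
      HasChirality A o (-δ) k s → DiracLaplacianEstimate A nablaE nablaL k C s := by
  obtain ⟨C, hC⟩ := H.exists_weitzenbock_bound
  obtain ⟨hτ, hm⟩ := H.continuous_tau_minEig htop
  refine ⟨C, fun k s hs hchir => ?_⟩
  have hpt : ∀ x, -(k : ℝ) * (twistInner k x
      (((tau nablaL x - 2 * minEig nablaL x : ℝ) : ℂ) • s x) (s x)).re
      - C * (twistInner k x (s x) (s x)).re
      ≤ (twistInner k x (twistWeitzenbock nablaM A nablaE nablaL k s x) (s x)).re := fun x => by
    have hx : x ∈ (trivializationAt ℂ L x).baseSet := FiberBundle.mem_baseSet_trivializationAt' x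
    have hh := lineWeight_pos (L := L) k hx
    set e := twistCoord k x x (s x) with he
    have h1 := hC x _ _ (trivializationAt ℂ L x).open_baseSet (hs x) hx
    have h2 := H.lineCliffordTerm_lower_bound (htop x) e fun b hb => by
      have := congrArg (twistCoord k x x) (hchir x b hb)
      rw [twistCoord_rTensor, map_smul] at this
      rw [this, Int.cast_smul_eq_zsmul]
    -- Cauchy–Schwarz with the uniform bound on the curvature term of E.
    have h3 : -(C * ‖e‖ ^ 2) ≤ (inner ℂ (weitzenbock nablaM (connectionOp nablaE) A
        (fun z => twistCoord k x z (s z)) x) e).re := by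
      have h4 := (Complex.abs_re_le_norm _).trans (norm_inner_le_norm (𝕜 := ℂ)
        (weitzenbock nablaM (connectionOp nablaE) A (fun z => twistCoord k x z (s z)) x) e)
      have h5 := mul_le_mul_of_nonneg_right h1 (norm_nonneg e)
      have h6 := (abs_le.1 (h4.trans h5)).1
      rw [← he] at h6
      calc -(C * ‖e‖ ^ 2) = -(C * ‖e‖ * ‖e‖) := by ring
        _ ≤ _ := h6
    have hee : (inner ℂ e e).re = ‖e‖ ^ 2 := by
      have := norm_sq_eq_re_inner (𝕜 := ℂ) e
      rw [RCLike.re_eq_complex_re] at this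
      exact this.symm
    rw [twistInner_smul_left, Complex.conj_ofReal, Complex.re_ofReal_mul, twistInner_eq k hx,
      twistInner_eq k hx, H.twistCoord_twistWeitzenbock hs hx, ← he, Complex.re_mul_ofReal,
      Complex.re_mul_ofReal, hee, inner_add_left, inner_smul_left, Complex.conj_natCast,
      Complex.add_re, ← Complex.ofReal_natCast, Complex.re_ofReal_mul]
    have h7 := mul_le_mul_of_nonneg_left h2 (Nat.cast_nonneg (α := ℝ) k)
    -- Multiplication by the positive weight |ℓ|^{2k} passes from the gauge on E back to the metric
    -- of E ⊗ L^k.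
    have h8 := mul_le_mul_of_nonneg_right (add_le_add h3 h7) hh.le
    refine le_trans (le_of_eq ?_) h8
    ring
  have hss := continuous_twistInner H.smoothE H.smoothL hs hs
  have hRs := continuous_twistInner H.smoothE H.smoothL (H.isSmoothTwist_twistWeitzenbock hs) hs
  have hts : Continuous fun x => twistInner k x
      (((tau nablaL x - 2 * minEig nablaL x : ℝ) : ℂ) • s x) (s x) := by
    simp only [twistInner_smul_left, Complex.conj_ofReal]
    exact (Complex.continuous_ofReal.comp (hτ.sub (continuous_const.mul hm))).mul hss
  rw [DiracLaplacianEstimate, H.innerL2_dirac_sub_laplacian hs]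
  simp only [innerL2]
  rw [re_integral_eq hss, re_integral_eq hRs, re_integral_eq hts, ← integral_const_mul,
    ← integral_const_mul]
  have hi1 := (integrable_of_continuous (n := n) (Complex.continuous_re.comp hts)).const_mul (-(k : ℝ))
  have hi2 := (integrable_of_continuous (n := n) (Complex.continuous_re.comp hss)).const_mul C
  have hi3 := integrable_of_continuous (n := n) (Complex.continuous_re.comp hRs)
  refine le_trans (le_of_eq (integral_sub hi1 hi2).symm) ?_
  exact integral_mono (hi1.sub hi2) hi3 hpt

end IsTwistedCliffordModule
end Estimate

end DiracTwist

end

/-! ### The two orientation cases. -/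

open DiracTwist in
theorem propositionP
    {n : ℕ} (hn : 0 < n)
    {M : Type*} [TopologicalSpace M] [ChartedSpace (EuclideanSpace ℝ (Fin (2 * n))) M]
    [IsManifold (𝓡 (2 * n)) ∞ M] [CompactSpace M] [T2Space M] [MeasurableSpace M] [BorelSpace M]
    -- a smooth Riemannian metric, an orientation, the Levi-Civita connection
    [RiemannianBundle (fun x : M => TangentSpace (𝓡 (2 * n)) x)]
    [IsContMDiffRiemannianBundle (𝓡 (2 * n)) ∞ (EuclideanSpace ℝ (Fin (2 * n)))
      (fun x : M => TangentSpace (𝓡 (2 * n)) x)]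
    (o : ManifoldOrientation n M)
    (nablaM : CovariantDerivative (𝓡 (2 * n)) (EuclideanSpace ℝ (Fin (2 * n)))
      (fun x : M => TangentSpace (𝓡 (2 * n)) x))
    (hM : IsLeviCivita nablaM)
    -- a self-adjoint Clifford module with a Hermitian Clifford connection
    {F : Type*} [NormedAddCommGroup F] [NormedSpace ℂ F] [FiniteDimensional ℂ F]
    {E : M → Type*} [∀ x, NormedAddCommGroup (E x)] [∀ x, InnerProductSpace ℂ (E x)]
    [TopologicalSpace (TotalSpace F E)] [FiberBundle F E] [VectorBundle ℂ F E]
    [VectorBundle ℝ F E] [ContMDiffVectorBundle ∞ F E (𝓡 (2 * n))]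
    (hE : IsSmoothHermitian n F E)
    (A : CliffordAction n F E)
    (nablaE : CovariantDerivative (𝓡 (2 * n)) F E)
    (hEsmooth : nablaE.ContMDiffCovariantDerivative ∞)
    (hEherm : IsHermitianConnection nablaE)
    (hEcliff : IsCliffordConnection nablaM A nablaE)
    -- a Hermitian line bundle with a Hermitian connection
    {L : M → Type*} [∀ x, NormedAddCommGroup (L x)] [∀ x, InnerProductSpace ℂ (L x)]
    [TopologicalSpace (TotalSpace ℂ L)] [FiberBundle ℂ L] [VectorBundle ℂ ℂ L]
    [VectorBundle ℝ ℂ L] [ContMDiffVectorBundle ∞ ℂ L (𝓡 (2 * n))]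
    (hL : IsSmoothHermitian n ℂ L)
    (nablaL : CovariantDerivative (𝓡 (2 * n)) ℂ L)
    (hLsmooth : nablaL.ContMDiffCovariantDerivative ∞)
    (hLherm : IsHermitianConnection nablaL)
    (hF : CurvatureNondegenerate nablaL) :
    (OrientationAgrees nablaL o →
      ∃ C : ℝ, ∀ (k : ℕ) (s : ∀ x : M, Twist E L k x),
        IsSmoothTwist n F k s → HasChirality A o (-1) k s →
          DiracLaplacianEstimate A nablaE nablaL k C s) ∧
    (OrientationOpposite nablaL o →
      ∃ C : ℝ, ∀ (k : ℕ) (s : ∀ x : M, Twist E L k x),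
        IsSmoothTwist n F k s → HasChirality A o 1 k s →
          DiracLaplacianEstimate A nablaE nablaL k C s) := by
  have H : IsTwistedCliffordModule nablaM A nablaE nablaL :=
    ⟨hn, hM, hE, hEsmooth, hEherm, hEcliff, hL, hLsmooth, hLherm⟩
  refine ⟨fun h => ?_, fun h => ?_⟩
  · exact H.exists_diracLaplacianEstimate (o := o) (δ := 1) fun x B hB => by
      simpa using h x B hB
  · obtain ⟨C, hC⟩ := H.exists_diracLaplacianEstimate (o := o) (δ := -1) fun x B hB => by
      simpa using h x B hB
    -- For δ = -1 the chirality required is -δ = 1.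
    refine ⟨C, fun k s hs hc => hC k s hs ?_⟩
    rwa [neg_neg]
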